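/- Let $1\le k\le n$ be integers, let $\mathrm{St}^n_k=\{X\in\mathbb R^{n\times k}: X^tX=I_k\}$ be the Stiefel manifold, let $m=nk-\frac{k(k+1)}2$ be its dimension, and let $\mu_{n,k}$ be its surface measure, i.e. the $m$-dimensional (Riemannian, equivalently Hausdorff) measure induced by the embedding in the Euclidean space $\mathbb R^{n\times k}$, whose norm $\|\cdot\|$ is the Frobenius norm. For $\Xi\in\mathbb R^{n\times k}$ put $$\widehat\mu_{n,k}(\Xi)=\int_{\mathrm{St}^n_k}e^{-2\pi i\,\mathrm{Tr}(X^t\Xi)}\,d\mu_{n,k}(X),$$ and let $\lambda_1\ge\lambda_2\ge\cdots\ge\lambda_k\ge0$ be the singular values of $\Xi$. Then, as $\|\Xi\|\to\infty$ within directions for which the singular values are nonzero and pairwise distinct, $$\widehat\mu_{n,k}(\Xi)=2^{\frac{k(k-1)}4}\sum_{s\in\{-1,1\}^k}\cos\Bigl(2\pi\sum_{j=1}^k s_j\bigl(\lambda_j-\tfrac{n-j}8\bigr)\Bigr)\,|\lambda_1\cdots\lambda_k|^{-\frac{n-k}2}\prod_{1\le i<j\le k}|s_i\lambda_i+s_j\lambda_j|^{-\frac12}+O\bigl(\|\Xi\|^{-\frac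 m2-1}\bigr),$$ locally uniformly in the direction $\Xi/\|\Xi\|$. Precisely: for every $\delta>0$ there is a constant $C$, depending only on $n,k,\delta$, such that for every $\Xi$ with $\|\Xi\|\ge1$, $\lambda_j\ge\delta\|\Xi\|$ for all $j$, and $|\lambda_i-\lambda_j|\ge\delta\|\Xi\|$ for all $i\ne j$, the difference of $\widehat\mu_{n,k}(\Xi)$ and the leading term above is at most $C\|\Xi\|^{-\frac m2-1}$ in absolute value; in particular it is at most $C\|\Xi\|^{-\frac{n-k+2}2}$. -/

import Mathlib

open MeasureTheory

noncomputable section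

namespace StiefelFourier

/-- The Euclidean space `ℝ^{n×k}` of `n × k` real matrices; its norm is the Frobenius norm. -/
abbrev MatSpace (n k : ℕ) : Type := EuclideanSpace ℝ (Fin n × Fin k)

/-- A point of `ℝ^{n×k}` read as a matrix. -/
def toMat {n k : ℕ} (X : MatSpace n k) : Matrix (Fin n) (Fin k) ℝ :=
  Matrix.of fun i j => X (i, j)

/-- The Stiefel manifold `{X ∈ ℝ^{n×k} : Xᵗ X = I_k}`. -/
def stiefel (n k : ℕ) : Set (MatSpace n k) :=
  {X | (toMat X).transpose * toMat X = 1}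

/-- The dimension `nk - k(k+1)/2` of the Stiefel manifold (for `k ≤ n`). -/
def stiefelDim (n k : ℕ) : ℕ := n * k - k * (k + 1) / 2

/-- The surface measure of the Stiefel manifold embedded in `ℝ^{n×k}`: the Hausdorff measure of the
dimension of the manifold, normalized to agree with Lebesgue measure on Euclidean spaces of that
dimension, restricted to the manifold. -/
def stiefelMeasure (n k : ℕ) : Measure (MatSpace n k) :=
  (Measure.euclideanHausdorffMeasure (stiefelDim n k)).restrict (stiefel n k)

/-- The Fourier transform `∫ exp(-2πi Tr(Xᵗ Ξ)) dμ(X)` of the surface measure. -/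
def stiefelFourier {n k : ℕ} (Ξ : MatSpace n k) : ℂ :=
  ∫ X, Complex.exp
    (-2 * Real.pi * Complex.I * (((toMat X).transpose * toMat Ξ).trace : ℝ)) ∂(stiefelMeasure n k)

/-- The singular values of `Ξ` in nonincreasing order; the index `j : Fin k` stands for the
`(j+1)`-st singular value. -/
def singularValue {n k : ℕ} (Ξ : MatSpace n k) (j : Fin k) : ℝ :=
  (Matrix.toEuclideanLin (toMat Ξ)).singularValues (j : ℕ)

/-- The leading term, as a function of `l = (λ_1, …, λ_k)`. The sign vectors `s ∈ {±1}^k` are the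
functions `Fin k → ℤˣ`; since `Fin k` starts at `0`, the `j` of the usual numbering is `j + 1`. -/
def leadingTerm (n k : ℕ) (l : Fin k → ℝ) : ℝ :=
  (2 : ℝ) ^ ((k : ℝ) * ((k : ℝ) - 1) / 4) *
    ∑ s : Fin k → ℤˣ,
      Real.cos (2 * Real.pi *
          ∑ j : Fin k, ((s j : ℤ) : ℝ) * (l j - ((n : ℝ) - ((j : ℕ) + 1 : ℝ)) / 8)) *
        |∏ j : Fin k, l j| ^ (-((n : ℝ) - (k : ℝ)) / 2) *
        ∏ i : Fin k, ∏ j ∈ Finset.Ioi i,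
          |((s i : ℤ) : ℝ) * l i + ((s j : ℤ) : ℝ) * l j| ^ (-(1 / 2) : ℝ)

end StiefelFourier

end

open MeasureTheory

noncomputable section

namespace StiefelFourier

open Matrix Filter Topology
open scoped ContDiff

variable {n k : ℕ}

/-! ### The matrix space, the Stiefel manifold and its isometries -/

/-! Multiplication by orthogonal matrices on either side preserves the surface measure, so Ξ may be
replaced by [diag(λ); 0] (`exists_svd`, `stiefelFourier_eq`). The phase becomes ∑ λ_j X_jj. For
distinct nonzero λ_j its critical points on the Stiefel manifold are the 2^k frames [diag(±1); 0],
and sign changes of the columns carry each of them to the base frame E = [I; 0]. What remains is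
stationary phase at E for the phase ∑ w_j (1 - X_jj), uniformly over frequencies w of size R with
|w_j| and |w_i ± w_j| at least cR (`Adm`). In the tangential coordinates indexed by `Low` the
Hessian is diagonal, with entries (w_i + w_j)/2 in the square block and w_j below it.

No Morse lemma is used. Integration by parts runs along the rotation fields X ↦ AX, whose flows
preserve the measure (`osc_mul_vf_phase`). The algebraic core is a commutator identity
(`commutator_identity`, `ent_mul_eq`), by which every off-diagonal entry of X is a combination of
first derivatives of the phase with a gain of 1/R (`red_offDiag`). Consequently amplitudes vanishing
near the critical frames give rapidly decaying integrals (`Off.osc_bound`). An amplitude supported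
near E and vanishing at E costs a factor 1/R relative to the reference integral osc χ of a cutoff χ,
up to R^(-N) (`Amp.osc_bound_of_eq_zero`). The second moments at E are explicit multiples of osc χ
to leading order (`osc_second_moment`, `osc_diag_moment`).

To evaluate osc χ at a real frequency x of size r, move it along w(τ) = x + iτ(1, …, k) into the
upper half plane and set F = weight · osc χ, where the weight is the square root of the Hessian
determinant up to a constant. The logarithmic derivative of the weight cancels the leading part of
the derivative of osc χ, so |F'| ≤ C (r + τ)⁻² (|F| + 1), and F(0) lies within O(1/r) of the limit
at infinity (`norm_sub_le_of_deriv_bound`, `weight_mul_osc_bound`). For large τ the integrand has a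
peak of Gaussian type at E, and Laplace's method gives the limit (`tendsto_laplace`). The
normalization of the surface measure enters only there, by comparison with Lebesgue measure through
the projection to the tangent space.

Dividing by the weight and summing over signs gives the leading term: the eighth roots of unity from
the square roots produce the shifts (n - j)/8, and the symmetry s ↦ -s turns exponentials into
cosines (`statConst_div_weight`, `sum_cexp_critPhase`). -/

/-- A matrix read as a point of `ℝ^{n×k}`. -/
def ofMat (A : Matrix (Fin n) (Fin k) ℝ) : MatSpace n k :=
  WithLp.toLp 2 fun p => A p.1 p.2

@[simp] lemma ofMat_apply (A : Matrix (Fin n) (Fin k) ℝ) (p : Fin n × Fin k) :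
    ofMat A p = A p.1 p.2 := rfl

lemma toMat_apply (X : MatSpace n k) (i : Fin n) (j : Fin k) :
    toMat X i j = X (i, j) := rfl

@[simp] lemma toMat_ofMat (A : Matrix (Fin n) (Fin k) ℝ) : toMat (ofMat A) = A := rfl

@[simp] lemma ofMat_toMat (X : MatSpace n k) : ofMat (toMat X) = X := by
  ext p; rfl

lemma toMat_injective : Function.Injective (toMat : MatSpace n k → _) := fun X Y h => by
  rw [← ofMat_toMat X, h, ofMat_toMat]

@[simp] lemma toMat_add (X Y : MatSpace n k) : toMat (X + Y) = toMat X + toMat Y := rfl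

@[simp] lemma toMat_sub (X Y : MatSpace n k) : toMat (X - Y) = toMat X - toMat Y := rfl

@[simp] lemma toMat_smul (c : ℝ) (X : MatSpace n k) : toMat (c • X) = c • toMat X := rfl

@[simp] lemma ofMat_add (A B : Matrix (Fin n) (Fin k) ℝ) : ofMat (A + B) = ofMat A + ofMat B := rfl

@[simp] lemma ofMat_smul (c : ℝ) (A : Matrix (Fin n) (Fin k) ℝ) : ofMat (c • A) = c • ofMat A := rfl

lemma norm_sq_eq_sum (X : MatSpace n k) : ‖X‖ ^ 2 = ∑ i, ∑ j, X (i, j) ^ 2 := by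
  rw [EuclideanSpace.norm_sq_eq, Fintype.sum_prod_type]
  simp

lemma norm_sq_eq_trace (X : MatSpace n k) : ‖X‖ ^ 2 = ((toMat X)ᵀ * toMat X).trace := by
  rw [norm_sq_eq_sum, Finset.sum_comm]
  simp [Matrix.trace, Matrix.mul_apply, toMat_apply, sq]

/-- Two-sided multiplication `X ↦ U X V`. -/
def biMul (U : Matrix (Fin n) (Fin n) ℝ) (V : Matrix (Fin k) (Fin k) ℝ) :
    MatSpace n k →ₗ[ℝ] MatSpace n k where
  toFun X := ofMat (U * toMat X * V)
  map_add' X Y := by simp [Matrix.mul_add, Matrix.add_mul]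
  map_smul' c X := by simp

@[simp] lemma toMat_biMul (U : Matrix (Fin n) (Fin n) ℝ) (V : Matrix (Fin k) (Fin k) ℝ)
    (X : MatSpace n k) : toMat (biMul U V X) = U * toMat X * V := rfl

/-- For orthogonal `U` and `V`, the map `X ↦ U X V` is an isometry of the matrix space. -/
def biMulIsometry (U : Matrix (Fin n) (Fin n) ℝ) (V : Matrix (Fin k) (Fin k) ℝ)
    (hU : Uᵀ * U = 1) (hV : V * Vᵀ = 1) : MatSpace n k ≃ₗᵢ[ℝ] MatSpace n k where
  toLinearEquiv := LinearEquiv.ofLinearMap (biMul U V) (biMul Uᵀ Vᵀ)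
    (by
      ext1 X
      apply toMat_injective
      simp [Matrix.mul_assoc, mul_eq_one_comm.mp hV]
      simp [← Matrix.mul_assoc, mul_eq_one_comm.mp hU])
    (by
      ext1 X
      apply toMat_injective
      simp [Matrix.mul_assoc, hV]
      simp [← Matrix.mul_assoc, hU])
  norm_map' X := by
    rw [← sq_eq_sq₀ (norm_nonneg _) (norm_nonneg _)]
    simp only [LinearEquiv.coe_ofLinearMap, norm_sq_eq_trace, toMat_biMul]
    simp only [Matrix.transpose_mul, Matrix.mul_assoc]
    rw [Matrix.trace_mul_comm]
    simp only [Matrix.mul_assoc, hV, Matrix.mul_one]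
    rw [← Matrix.mul_assoc Uᵀ, hU, Matrix.one_mul]

@[simp] lemma biMulIsometry_apply (U : Matrix (Fin n) (Fin n) ℝ) (V : Matrix (Fin k) (Fin k) ℝ)
    (hU : Uᵀ * U = 1) (hV : V * Vᵀ = 1) (X : MatSpace n k) :
    biMulIsometry U V hU hV X = biMul U V X := rfl

lemma biMul_mem_stiefel {U : Matrix (Fin n) (Fin n) ℝ} {V : Matrix (Fin k) (Fin k) ℝ}
    (hU : Uᵀ * U = 1) (hV : V * Vᵀ = 1) (X : MatSpace n k) :
    biMul U V X ∈ stiefel n k ↔ X ∈ stiefel n k := by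
  have hV' := mul_eq_one_comm.mp hV
  simp only [stiefel, Set.mem_ofPred_eq, toMat_biMul, Matrix.transpose_mul]
  have h1 : Vᵀ * ((toMat X)ᵀ * Uᵀ) * (U * toMat X * V) = Vᵀ * ((toMat X)ᵀ * toMat X) * V := by
    simp only [Matrix.mul_assoc]
    rw [← Matrix.mul_assoc Uᵀ, hU, Matrix.one_mul]
  rw [h1]
  constructor
  · intro h
    have h2 := congrArg (fun Z => V * Z * Vᵀ) h
    simp only [Matrix.mul_assoc, Matrix.mul_one, hV] at h2
    simpa only [← Matrix.mul_assoc, hV, Matrix.one_mul] using h2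
  · intro h
    rw [h, Matrix.mul_one, hV']

lemma continuous_toMat : Continuous (toMat : MatSpace n k → _) := by
  refine continuous_matrix fun i j => ?_
  simp only [toMat_apply]
  fun_prop

lemma isClosed_stiefel : IsClosed (stiefel n k) :=
  isClosed_eq ((continuous_toMat.matrix_transpose).matrix_mul continuous_toMat) continuous_const

lemma sum_sq_col {X : MatSpace n k} (hX : X ∈ stiefel n k) (j : Fin k) :
    ∑ i, X (i, j) ^ 2 = 1 := by
  have := congrFun (congrFun hX j) j
  simpa [Matrix.mul_apply, toMat_apply, sq] using this

lemma sum_mul_col {X : MatSpace n k} (hX : X ∈ stiefel n k) {p q : Fin k} (hpq : p ≠ q) :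
    ∑ i, X (i, p) * X (i, q) = 0 := by
  have := congrFun (congrFun hX p) q
  simpa [Matrix.mul_apply, toMat_apply, Matrix.one_apply, hpq] using this

lemma norm_sq_of_mem_stiefel {X : MatSpace n k} (hX : X ∈ stiefel n k) : ‖X‖ ^ 2 = k := by
  rw [norm_sq_eq_sum, Finset.sum_comm]
  simp [sum_sq_col hX]

lemma isCompact_stiefel : IsCompact (stiefel n k) := by
  refine Metric.isCompact_of_isClosed_isBounded isClosed_stiefel ?_
  refine (Metric.isBounded_closedBall (x := (0 : MatSpace n k)) (r := √k)).subset fun X hX => ?_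
  rw [mem_closedBall_zero_iff]
  exact Real.le_sqrt_of_sq_le (norm_sq_of_mem_stiefel hX).le

lemma measurableSet_stiefel : MeasurableSet (stiefel n k) := isClosed_stiefel.measurableSet

lemma measurePreserving_biMul {U : Matrix (Fin n) (Fin n) ℝ} {V : Matrix (Fin k) (Fin k) ℝ}
    (hU : Uᵀ * U = 1) (hV : V * Vᵀ = 1) :
    MeasurePreserving (biMulIsometry U V hU hV) (stiefelMeasure n k) (stiefelMeasure n k) := by
  have h := (biMulIsometry U V hU hV).toIsometryEquiv.measurePreserving_euclideanHausdorffMeasure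
    (stiefelDim n k)
  have h2 := h.restrict_preimage (measurableSet_stiefel (n := n) (k := k))
  have h3 : (biMulIsometry U V hU hV).toIsometryEquiv ⁻¹' stiefel n k = stiefel n k := by
    ext X
    exact biMul_mem_stiefel hU hV X
  rw [h3] at h2
  exact h2

lemma integral_biMul {F : Type*} [NormedAddCommGroup F] [NormedSpace ℝ F]
    {U : Matrix (Fin n) (Fin n) ℝ} {V : Matrix (Fin k) (Fin k) ℝ}
    (hU : Uᵀ * U = 1) (hV : V * Vᵀ = 1) (f : MatSpace n k → F) :
    ∫ X, f (biMul U V X) ∂(stiefelMeasure n k) = ∫ X, f X ∂(stiefelMeasure n k) :=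
  (measurePreserving_biMul hU hV).integral_comp
    (biMulIsometry U V hU hV).toHomeomorph.measurableEmbedding f

/-- The frame `[I; 0]` of the first `k` standard basis vectors. -/
def base (hkn : k ≤ n) : MatSpace n k :=
  ofMat (Matrix.of fun i j => if i = Fin.castLE hkn j then 1 else 0)

lemma base_apply (hkn : k ≤ n) (i : Fin n) (j : Fin k) :
    base hkn (i, j) = if i = Fin.castLE hkn j then 1 else 0 := rfl

@[simp] lemma base_diag (hkn : k ≤ n) (j : Fin k) : base hkn (Fin.castLE hkn j, j) = 1 := by
  simp [base_apply]

lemma base_off (hkn : k ≤ n) {i : Fin n} {j : Fin k} (h : i ≠ Fin.castLE hkn j) :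
    base hkn (i, j) = 0 := by
  simp [base_apply, h]

lemma base_mem_stiefel (hkn : k ≤ n) : base hkn ∈ stiefel n k := by
  ext p q
  simp [Matrix.mul_apply, toMat_apply, base_apply, Matrix.one_apply, eq_comm]

/-- The orthogonal group acts transitively on the Stiefel manifold. -/
lemma exists_biMul_base (hkn : k ≤ n) {X : MatSpace n k} (hX : X ∈ stiefel n k) :
    ∃ U : Matrix (Fin n) (Fin n) ℝ, Uᵀ * U = 1 ∧ biMul U 1 (base hkn) = X := by
  let col : Fin k → EuclideanSpace ℝ (Fin n) := fun j => WithLp.toLp 2 fun i => X (i, j)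
  have hcol : ∀ p q, inner ℝ (col p) (col q) = if p = q then (1 : ℝ) else 0 := by
    intro p q
    have := congrFun (congrFun hX p) q
    simpa [Matrix.mul_apply, toMat_apply, Matrix.one_apply, col, PiLp.inner_apply, mul_comm] using this
  -- The zeros are placeholders: orthonormality is only required on the index set `s`, and the
  -- extension lemma supplies the remaining columns.
  let v : Fin n → EuclideanSpace ℝ (Fin n) := fun i =>
    if h : (i : ℕ) < k then col ⟨i, h⟩ else 0
  let s : Set (Fin n) := {i | (i : ℕ) < k}
  have hv : Orthonormal ℝ (s.domRestrict v) := by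
    rw [orthonormal_iff_ite]
    rintro ⟨i, hi⟩ ⟨j, hj⟩
    have hi' : (i : ℕ) < k := hi
    have hj' : (j : ℕ) < k := hj
    simp only [Set.domRestrict_apply, v, hi', hj', dif_pos, hcol, Subtype.mk.injEq,
      Fin.ext_iff]
  obtain ⟨b, hb⟩ := hv.exists_orthonormalBasis_extension_of_card_eq (by simp)
  refine ⟨Matrix.of fun i j => b j i, ?_, ?_⟩
  · ext p q
    have := orthonormal_iff_ite.mp b.orthonormal p q
    simpa [Matrix.mul_apply, Matrix.one_apply, PiLp.inner_apply, mul_comm] using this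
  · apply toMat_injective
    ext i j
    have h1 : b (Fin.castLE hkn j) = col j := by
      rw [hb _ (show Fin.castLE hkn j ∈ s by simp [s])]
      simp [v]
    rw [toMat_biMul, Matrix.mul_one]
    simp [Matrix.mul_apply, toMat_apply, base_apply, h1, col]

/-! ### The tangent space at the base frame -/

/-- Positions strictly below the diagonal; they index an orthonormal basis of the tangent space of
the Stiefel manifold at the base frame. -/
abbrev Low (n k : ℕ) : Type := {p : Fin n × Fin k // (p.2 : ℕ) < (p.1 : ℕ)}

lemma sum_dite_lt {M : Type*} [AddCommMonoid M] (hkn : k ≤ n) (g : Fin k → M) :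
    ∑ i : Fin n, (if h : (i : ℕ) < k then g ⟨i, h⟩ else 0) = ∑ i, g i := by
  symm
  refine Finset.sum_of_injOn (Fin.castLE hkn) (Fin.castLE_injective hkn).injOn (by simp) ?_ ?_
  · intro i _ hi
    refine dif_neg fun h => hi ⟨⟨i, h⟩, by simp, by ext; simp⟩
  · simp

/-- Entries above the diagonal are reflected to positions below it. The reflected entry exists only
when the row index is less than k, hence the case distinction. -/
lemma sum_eq_diag_add_low {M : Type*} [AddCommMonoid M] (hkn : k ≤ n) (f : Fin n → Fin k → M) :
    ∑ i, ∑ j, f i j = ∑ j, f (Fin.castLE hkn j) j +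
      ∑ p : Low n k, (f p.1.1 p.1.2 +
        if h : (p.1.1 : ℕ) < k then f (Fin.castLE hkn p.1.2) ⟨p.1.1, h⟩ else 0) := by
  have h0 : ∀ i j, f i j = (if i = Fin.castLE hkn j then f i j else 0) +
      ((if (j : ℕ) < i then f i j else 0) + if (i : ℕ) < j then f i j else 0) := by
    intro i j
    rcases lt_trichotomy (i : ℕ) (j : ℕ) with h | h | h
    · simp [h, h.not_gt, Fin.ext_iff, h.ne]
    · simp [h, Fin.ext_iff]
    · simp [h, h.not_gt, Fin.ext_iff, h.ne']
  have h1 : ∀ g : Fin n × Fin k → M,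
      ∑ p : Low n k, g p.1 =
        ∑ i : Fin n, ∑ j : Fin k, if (j : ℕ) < (i : ℕ) then g (i, j) else 0 := by
    intro g
    rw [← Fintype.sum_prod_type (f := fun p : Fin n × Fin k =>
      if (p.2 : ℕ) < p.1 then g p else 0), ← Finset.sum_filter]
    exact (Finset.sum_subtype (Finset.univ.filter fun p : Fin n × Fin k => (p.2 : ℕ) < p.1)
      (by simp) g).symm
  have h2 : ∑ i : Fin n, ∑ j : Fin k, (if (i : ℕ) < j then f i j else 0) =
      ∑ i : Fin n, ∑ j : Fin k, if (j : ℕ) < i then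
        (if h : (i : ℕ) < k then f (Fin.castLE hkn j) ⟨i, h⟩ else 0) else 0 := by
    have h3 : ∀ i : Fin n, (∑ j : Fin k, if (j : ℕ) < i then
        (if h : (i : ℕ) < k then f (Fin.castLE hkn j) ⟨i, h⟩ else 0) else 0) =
        if h : (i : ℕ) < k then (fun i' : Fin k => ∑ j : Fin k, if (j : ℕ) < i' then
          f (Fin.castLE hkn j) i' else 0) ⟨i, h⟩ else 0 := by
      intro i
      by_cases h : (i : ℕ) < k <;> simp [h]
    rw [Finset.sum_congr rfl fun i _ => h3 i,
      sum_dite_lt hkn (fun i' : Fin k => ∑ j : Fin k, if (j : ℕ) < i' then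
        f (Fin.castLE hkn j) i' else 0), Finset.sum_comm]
    refine Finset.sum_congr rfl fun j _ => ?_
    rw [← sum_dite_lt hkn]
    refine Finset.sum_congr rfl fun i _ => ?_
    by_cases h : (i : ℕ) < k
    · simp [h]
    · have : ¬ (i : ℕ) < j := by omega
      simp [h, this]
  have h4 : ∑ i : Fin n, ∑ j : Fin k, (if i = Fin.castLE hkn j then f i j else 0) =
      ∑ j, f (Fin.castLE hkn j) j := by
    rw [Finset.sum_comm]
    simp
  rw [Finset.sum_add_distrib, h1 (fun p => f p.1 p.2),
    h1 (fun p => if h : (p.1 : ℕ) < k then f (Fin.castLE hkn p.2) ⟨p.1, h⟩ else 0), ← h2, ← h4,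
    ← Finset.sum_add_distrib, ← Finset.sum_add_distrib]
  refine Finset.sum_congr rfl fun i _ => ?_
  rw [← Finset.sum_add_distrib, ← Finset.sum_add_distrib]
  exact Finset.sum_congr rfl fun j _ => h0 i j

/-- Orthogonal projection to the tangent space at the base frame, in orthonormal coordinates. -/
def tproj (hkn : k ≤ n) : MatSpace n k →L[ℝ] EuclideanSpace ℝ (Low n k) :=
  LinearMap.toContinuousLinearMap
    { toFun := fun X => WithLp.toLp 2 fun p =>
        if h : (p.1.1 : ℕ) < k then (X p.1 - X (Fin.castLE hkn p.1.2, ⟨p.1.1, h⟩)) / √2 else X p.1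
      map_add' := fun X Y => by
        ext p
        by_cases h : (p.1.1 : ℕ) < k <;> simp [h]
        ring
      map_smul' := fun c X => by
        ext p
        by_cases h : (p.1.1 : ℕ) < k <;> simp [h]
        ring }

lemma tproj_apply (hkn : k ≤ n) (X : MatSpace n k) (p : Low n k) : tproj hkn X p =
    if h : (p.1.1 : ℕ) < k then (X p.1 - X (Fin.castLE hkn p.1.2, ⟨p.1.1, h⟩)) / √2 else X p.1 :=
  rfl

/-- The symmetric part of the upper square block, which is the component of `X` normal to the
Stiefel manifold at the base frame. -/
def symPart (hkn : k ≤ n) (X : MatSpace n k) : Matrix (Fin k) (Fin k) ℝ :=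
  Matrix.of fun p q => (X (Fin.castLE hkn p, q) + X (Fin.castLE hkn q, p)) / 2

lemma symPart_apply (hkn : k ≤ n) (X : MatSpace n k) (p q : Fin k) :
    symPart hkn X p q = (X (Fin.castLE hkn p, q) + X (Fin.castLE hkn q, p)) / 2 := rfl

/-- Pythagoras for the splitting into tangent and normal components at the base frame. The factor
1/√2 in `tproj` makes a pair a, b of reflected entries satisfy a² + b² = ((a - b)/√2)² + 2((a +
b)/2)². -/
lemma norm_sq_eq_tproj_add_symPart (hkn : k ≤ n) (X : MatSpace n k) :
    ‖X‖ ^ 2 = ‖tproj hkn X‖ ^ 2 + ∑ p, ∑ q, symPart hkn X p q ^ 2 := by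
  have h1 : ∑ p, ∑ q, symPart hkn X p q ^ 2 = ∑ i : Fin n, ∑ q,
      if h : (i : ℕ) < k then symPart hkn X ⟨i, h⟩ q ^ 2 else 0 := by
    rw [← sum_dite_lt hkn]
    refine Finset.sum_congr rfl fun i _ => ?_
    by_cases h : (i : ℕ) < k <;> simp [h]
  rw [h1, norm_sq_eq_sum, EuclideanSpace.norm_sq_eq,
    sum_eq_diag_add_low hkn (fun i j => X (i, j) ^ 2), sum_eq_diag_add_low hkn, add_left_comm,
    ← Finset.sum_add_distrib]
  congr 1
  · refine Finset.sum_congr rfl fun j _ => ?_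
    simp [symPart_apply]
  · refine Finset.sum_congr rfl fun p _ => ?_
    have h2 : (p.1.2 : ℕ) < k := p.1.2.2
    have hs : √2 ^ 2 = (2 : ℝ) := Real.sq_sqrt (by norm_num)
    by_cases h : (p.1.1 : ℕ) < k
    · have h3 : Fin.castLE hkn ⟨p.1.1, h⟩ = p.1.1 := by ext; simp
      simp only [tproj_apply, symPart_apply, h, dif_pos, Fin.val_castLE, h2, Fin.eta, h3,
        Real.norm_eq_abs, sq_abs, div_pow, hs]
      ring
    · simp [tproj_apply, h]

lemma norm_tproj_le (hkn : k ≤ n) (X : MatSpace n k) : ‖tproj hkn X‖ ≤ ‖X‖ := by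
  refine le_of_sq_le_sq ?_ (norm_nonneg _)
  rw [norm_sq_eq_tproj_add_symPart hkn X]
  exact le_add_of_nonneg_right (Finset.sum_nonneg fun p _ => Finset.sum_nonneg fun q _ => sq_nonneg _)

lemma symPart_eq (hkn : k ≤ n) (X : MatSpace n k) : symPart hkn X =
    (1 / 2 : ℝ) • ((toMat (base hkn))ᵀ * toMat X + (toMat X)ᵀ * toMat (base hkn)) := by
  ext p q
  simp [symPart_apply, Matrix.mul_apply, toMat_apply, base_apply]
  ring

lemma sum_sq_transpose_mul_le (X Y : MatSpace n k) :
    ∑ p, ∑ q, ((toMat X)ᵀ * toMat Y) p q ^ 2 ≤ ‖X‖ ^ 2 * ‖Y‖ ^ 2 := by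
  rw [norm_sq_eq_sum, norm_sq_eq_sum, Finset.sum_comm (f := fun i j => X (i, j) ^ 2),
    Finset.sum_comm (f := fun i j => Y (i, j) ^ 2), Finset.sum_mul_sum]
  refine Finset.sum_le_sum fun p _ => Finset.sum_le_sum fun q _ => ?_
  simpa [Matrix.mul_apply, toMat_apply] using
    Finset.sum_mul_sq_le_sq_mul_sq Finset.univ (fun i => X (i, p)) (fun i => Y (i, q))

/-- With D = X - Y, the relations XᵗX = YᵗY = I give DᵗX + YᵗD = 0. Subtracting this from DᵗE + EᵗD
leaves products of D with X - E and Y - E, so the normal part of D gains a factor ρ. -/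
lemma sum_sq_symPart_sub_le (hkn : k ≤ n) {X Y : MatSpace n k} {ρ : ℝ} (hX : X ∈ stiefel n k)
    (hY : Y ∈ stiefel n k) (hXρ : ‖X - base hkn‖ ≤ ρ) (hYρ : ‖Y - base hkn‖ ≤ ρ) :
    ∑ p, ∑ q, symPart hkn (X - Y) p q ^ 2 ≤ ρ ^ 2 * ‖X - Y‖ ^ 2 := by
  set E := base hkn
  have h1 : symPart hkn (X - Y) = -(1 / 2 : ℝ) •
      ((toMat (X - Y))ᵀ * toMat (X - E) + (toMat (Y - E))ᵀ * toMat (X - Y)) := by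
    have hX' : (toMat X)ᵀ * toMat X = 1 := hX
    have hY' : (toMat Y)ᵀ * toMat Y = 1 := hY
    rw [symPart_eq]
    simp only [toMat_sub, Matrix.transpose_sub, Matrix.sub_mul, Matrix.mul_sub, hX', hY', neg_smul,
      ← smul_neg, E]
    congr 1
    abel
  have h2 : ∀ p q, symPart hkn (X - Y) p q ^ 2 ≤
      (((toMat (X - Y))ᵀ * toMat (X - E)) p q ^ 2 +
        ((toMat (Y - E))ᵀ * toMat (X - Y)) p q ^ 2) / 2 := by
    intro p q
    rw [h1]
    simp only [Matrix.smul_apply, Matrix.add_apply, smul_eq_mul]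
    nlinarith [sq_nonneg (((toMat (X - Y))ᵀ * toMat (X - E)) p q -
        ((toMat (Y - E))ᵀ * toMat (X - Y)) p q)]
  have h3 : ∑ p, ∑ q, symPart hkn (X - Y) p q ^ 2 ≤
      (‖X - Y‖ ^ 2 * ‖X - E‖ ^ 2 + ‖Y - E‖ ^ 2 * ‖X - Y‖ ^ 2) / 2 := by
    refine (Finset.sum_le_sum fun p _ => Finset.sum_le_sum fun q _ => h2 p q).trans ?_
    simp only [← Finset.sum_div, Finset.sum_add_distrib]
    gcongr
    · exact sum_sq_transpose_mul_le _ _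
    · exact sum_sq_transpose_mul_le _ _
  have h4 : ‖X - E‖ ^ 2 ≤ ρ ^ 2 := by gcongr
  have h5 : ‖Y - E‖ ^ 2 ≤ ρ ^ 2 := by gcongr
  nlinarith [sq_nonneg ‖X - Y‖]

/-- Near the base frame, the projection to the tangent space is almost isometric on the Stiefel
manifold. -/
lemma norm_sub_sq_le_tproj (hkn : k ≤ n) {X Y : MatSpace n k} {ρ : ℝ} (hX : X ∈ stiefel n k)
    (hY : Y ∈ stiefel n k) (hXρ : ‖X - base hkn‖ ≤ ρ) (hYρ : ‖Y - base hkn‖ ≤ ρ) :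
    (1 - ρ ^ 2) * ‖X - Y‖ ^ 2 ≤ ‖tproj hkn (X - Y)‖ ^ 2 := by
  have := norm_sq_eq_tproj_add_symPart hkn (X - Y)
  have := sum_sq_symPart_sub_le hkn hX hY hXρ hYρ
  linarith

/-- The tangent vector with given coordinates. -/
def tlift (hkn : k ≤ n) : EuclideanSpace ℝ (Low n k) →ₗ[ℝ] MatSpace n k where
  toFun v := WithLp.toLp 2 fun p =>
    if h : (p.2 : ℕ) < p.1 then (if (p.1 : ℕ) < k then v ⟨p, h⟩ / √2 else v ⟨p, h⟩)
    else if h' : (p.1 : ℕ) < p.2 then -v ⟨(Fin.castLE hkn p.2, ⟨p.1, h'.trans p.2.2⟩), h'⟩ / √2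
    else 0
  map_add' v w := by
    ext p
    simp only [PiLp.add_apply]
    split_ifs <;> ring
  map_smul' c v := by
    ext p
    simp only [PiLp.smul_apply, smul_eq_mul, RingHom.id_apply]
    split_ifs <;> ring

lemma tlift_apply (hkn : k ≤ n) (v : EuclideanSpace ℝ (Low n k)) (p : Fin n × Fin k) :
    tlift hkn v p = if h : (p.2 : ℕ) < p.1 then
      (if (p.1 : ℕ) < k then v ⟨p, h⟩ / √2 else v ⟨p, h⟩)
    else if h' : (p.1 : ℕ) < p.2 then -v ⟨(Fin.castLE hkn p.2, ⟨p.1, h'.trans p.2.2⟩), h'⟩ / √2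
    else 0 := rfl

lemma tproj_tlift (hkn : k ≤ n) (v : EuclideanSpace ℝ (Low n k)) :
    tproj hkn (tlift hkn v) = v := by
  ext ⟨⟨i, j⟩, hp⟩
  have hp' : (j : ℕ) < i := hp
  have hs : √2 * √2 = (2 : ℝ) := Real.mul_self_sqrt (by norm_num)
  by_cases h : (i : ℕ) < k
  · simp [tproj_apply, tlift_apply, h, hp', hp'.not_gt]
    field_simp
    rw [sq, hs]; ring
  · simp [tproj_apply, tlift_apply, h, hp']

lemma symPart_tlift (hkn : k ≤ n) (v : EuclideanSpace ℝ (Low n k)) :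
    symPart hkn (tlift hkn v) = 0 := by
  ext p q
  rcases lt_trichotomy (p : ℕ) q with h | h | h
  · simp [symPart_apply, tlift_apply, h, h.not_gt, q.2]; ring
  · simp [symPart_apply, tlift_apply, h]
  · simp [symPart_apply, tlift_apply, h, h.not_gt, p.2]; ring

lemma symPart_base_mul (hkn : k ≤ n) {S : Matrix (Fin k) (Fin k) ℝ} (hS : Sᵀ = S) :
    symPart hkn (ofMat (toMat (base hkn) * S)) = S := by
  ext p q
  have : S q p = S p q := congrFun (congrFun hS p) q
  simp [symPart_apply, Matrix.mul_apply, toMat_apply, base_apply, this]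

lemma tproj_base_mul (hkn : k ≤ n) {S : Matrix (Fin k) (Fin k) ℝ} (hS : Sᵀ = S) :
    tproj hkn (ofMat (toMat (base hkn) * S)) = 0 := by
  ext p
  obtain ⟨⟨i, j⟩, hp⟩ := p
  by_cases h : (i : ℕ) < k
  · have hi : i = Fin.castLE hkn ⟨i, h⟩ := by ext; simp
    have : S ⟨i, h⟩ j = S j ⟨i, h⟩ := congrFun (congrFun hS j) ⟨i, h⟩
    have h3 : ∀ x : Fin k, i = Fin.castLE hkn x ↔ (⟨i, h⟩ : Fin k) = x := fun x => by
      simp [Fin.ext_iff]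
    simp [tproj_apply, Matrix.mul_apply, toMat_apply, base_apply, h, h3, this]
  · have h3 : ∀ x : Fin k, i ≠ Fin.castLE hkn x := fun x hx => h (by rw [hx]; simp)
    simp [tproj_apply, Matrix.mul_apply, toMat_apply, base_apply, h, h3]

lemma norm_sq_base_mul (hkn : k ≤ n) {S : Matrix (Fin k) (Fin k) ℝ} (hS : Sᵀ = S) :
    ‖ofMat (toMat (base hkn) * S)‖ ^ 2 = ∑ p, ∑ q, S p q ^ 2 := by
  rw [norm_sq_eq_tproj_add_symPart hkn, symPart_base_mul hkn hS, tproj_base_mul hkn hS]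
  simp

/-- `D ↦ D + E Dᵗ D / 2`. The points of the Stiefel manifold are the `E + D` at which it takes
values in the tangent space. -/
def straighten (hkn : k ≤ n) (D : MatSpace n k) : MatSpace n k :=
  D + ofMat (toMat (base hkn) * ((1 / 2 : ℝ) • ((toMat D)ᵀ * toMat D)))

/-- The correction term is quadratic, so the derivative at 0 is the identity and the inverse
function theorem applies. -/
lemma hasStrictFDerivAt_straighten (hkn : k ≤ n) :
    HasStrictFDerivAt (straighten hkn)
      ((ContinuousLinearEquiv.refl ℝ (MatSpace n k) : MatSpace n k ≃L[ℝ] MatSpace n k) :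
        MatSpace n k →L[ℝ] MatSpace n k) 0 := by
  refine ContDiffAt.hasStrictFDerivAt' (n := 1) ?_ ?_ one_ne_zero
  · refine ContDiff.contDiffAt ?_
    rw [contDiff_euclidean]
    intro p
    simp only [straighten, PiLp.add_apply, ofMat_apply, Matrix.mul_apply, Matrix.smul_apply,
      Matrix.transpose_apply, toMat_apply, smul_eq_mul]
    fun_prop
  · rw [hasFDerivAt_iff_isLittleO_nhds_zero]
    have h1 : ∀ h : MatSpace n k, ‖straighten hkn (0 + h) - straighten hkn 0 -
        ((ContinuousLinearEquiv.refl ℝ (MatSpace n k) : MatSpace n k ≃L[ℝ] MatSpace n k) :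
        MatSpace n k →L[ℝ] MatSpace n k) h‖ ≤ ‖h‖ ^ 2 := by
      intro h
      have h2 : straighten hkn (0 + h) - straighten hkn 0 -
        ((ContinuousLinearEquiv.refl ℝ (MatSpace n k) : MatSpace n k ≃L[ℝ] MatSpace n k) :
        MatSpace n k →L[ℝ] MatSpace n k) h =
          ofMat (toMat (base hkn) * ((1 / 2 : ℝ) • ((toMat h)ᵀ * toMat h))) := by
        have : toMat (0 : MatSpace n k) = 0 := rfl
        have h0 : ofMat (0 : Matrix (Fin n) (Fin k) ℝ) = 0 := rfl
        simp [straighten, this, h0]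
      rw [h2]
      refine le_of_sq_le_sq ?_ (by positivity)
      rw [norm_sq_base_mul hkn (by simp [Matrix.transpose_mul])]
      calc ∑ p, ∑ q, ((1 / 2 : ℝ) • ((toMat h)ᵀ * toMat h)) p q ^ 2
          ≤ ∑ p, ∑ q, ((toMat h)ᵀ * toMat h) p q ^ 2 := by
            refine Finset.sum_le_sum fun p _ => Finset.sum_le_sum fun q _ => ?_
            simp only [Matrix.smul_apply, smul_eq_mul]
            nlinarith [sq_nonneg (((toMat h)ᵀ * toMat h) p q)]
        _ ≤ ‖h‖ ^ 2 * ‖h‖ ^ 2 := sum_sq_transpose_mul_le h h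
        _ = (‖h‖ ^ 2) ^ 2 := by ring
    refine Asymptotics.IsBigO.trans_isLittleO (g := fun h : MatSpace n k => ‖h‖ ^ 2) ?_ ?_
    · exact Asymptotics.IsBigO.of_bound 1 (Eventually.of_forall fun h => by simpa using h1 h)
    · exact Asymptotics.isLittleO_norm_pow_id one_lt_two

/-- The symmetric part of the straightened D is half of EᵗD + DᵗE + DᵗD, which is exactly the defect
(E + D)ᵗ(E + D) - I. -/
lemma add_base_mem_stiefel (hkn : k ≤ n) {D : MatSpace n k}
    (h : symPart hkn (straighten hkn D) = 0) : base hkn + D ∈ stiefel n k := by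
  have hS : ((1 / 2 : ℝ) • ((toMat D)ᵀ * toMat D))ᵀ = (1 / 2 : ℝ) • ((toMat D)ᵀ * toMat D) := by
    simp [Matrix.transpose_mul]
  have h1 : symPart hkn D + (1 / 2 : ℝ) • ((toMat D)ᵀ * toMat D) = 0 := by
    have h2 := symPart_base_mul hkn hS
    ext p q
    rw [← h, straighten, Matrix.add_apply, ← congrFun (congrFun h2 p) q]
    simp only [symPart_apply, PiLp.add_apply]
    ring
  rw [symPart_eq, ← smul_add] at h1
  have h2 := (smul_eq_zero.mp h1).resolve_left (by norm_num)
  have hE : (toMat (base hkn))ᵀ * toMat (base hkn) = 1 := base_mem_stiefel hkn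
  change (toMat (base hkn + D))ᵀ * toMat (base hkn + D) = 1
  rw [toMat_add, Matrix.transpose_add, Matrix.add_mul, Matrix.mul_add, Matrix.mul_add, hE]
  refine Eq.trans ?_ (add_zero (1 : Matrix (Fin k) (Fin k) ℝ))
  rw [← h2]
  abel

/-- The image of a neighbourhood of the base frame in the Stiefel manifold under the projection
to the tangent space is a neighbourhood of the origin. -/
lemma exists_ball_subset_image_tproj (hkn : k ≤ n) {ρ : ℝ} (hρ : 0 < ρ) :
    ∃ r > 0, ∀ v : EuclideanSpace ℝ (Low n k), ‖v‖ < r →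
      ∃ X ∈ stiefel n k, ‖X - base hkn‖ < ρ ∧ tproj hkn (X - base hkn) = v := by
  have h0 : straighten hkn 0 = 0 := by
    have : toMat (0 : MatSpace n k) = 0 := rfl
    have h0 : ofMat (0 : Matrix (Fin n) (Fin k) ℝ) = 0 := rfl
    simp [straighten, this, h0]
  have h1 := (hasStrictFDerivAt_straighten hkn).map_nhds_eq_of_equiv
  rw [h0] at h1
  -- The inverse function theorem makes `straighten` open at 0; small tangent vectors are then
  -- values of it at some D, and E + D is the desired frame.
  have h2 : straighten hkn '' Metric.ball 0 ρ ∈ 𝓝 (0 : MatSpace n k) := by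
    rw [← h1]
    exact image_mem_map (Metric.ball_mem_nhds _ hρ)
  have h3 : Tendsto (tlift hkn) (𝓝 0) (𝓝 0) := by
    have := (LinearMap.continuous_of_finiteDimensional (tlift hkn)).tendsto 0
    simpa using this
  obtain ⟨r, hr, hball⟩ := Metric.mem_nhds_iff.mp (h3 h2)
  refine ⟨r, hr, fun v hv => ?_⟩
  obtain ⟨D, hD, hDv⟩ := hball (mem_ball_zero_iff.mpr hv)
  have hS : ((1 / 2 : ℝ) • ((toMat D)ᵀ * toMat D))ᵀ = (1 / 2 : ℝ) • ((toMat D)ᵀ * toMat D) := by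
    simp [Matrix.transpose_mul]
  refine ⟨base hkn + D, add_base_mem_stiefel hkn ?_, ?_, ?_⟩
  · rw [hDv, symPart_tlift]
  · simpa using hD
  · have : tproj hkn (straighten hkn D) = tproj hkn D := by
      rw [straighten, map_add, tproj_base_mul hkn hS, add_zero]
    rw [add_sub_cancel_left, ← this, hDv, tproj_tlift]

/-! ### Comparison of the surface measure with Lebesgue measure on the tangent space -/

/-- Column j, counted from 0, has n - 1 - j positions below the diagonal. -/
lemma card_low (hkn : k ≤ n) : Fintype.card (Low n k) = stiefelDim n k := by
  have h1 : Fintype.card (Low n k) = ∑ j : Fin k, (n - 1 - j) := by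
    rw [Fintype.card_subtype, Finset.card_filter, Fintype.sum_prod_type_right]
    refine Finset.sum_congr rfl fun j _ => ?_
    rw [← Finset.card_filter]
    have : Finset.univ.filter (fun i : Fin n => (j : ℕ) < i) = Finset.Ioi (Fin.castLE hkn j) := by
      ext i
      simp [Fin.lt_def]
    rw [this, Fin.card_Ioi]
    simp
  have h2 : ∀ l ≤ n, 2 * ∑ j ∈ Finset.range l, (n - 1 - j) + l * (l + 1) = 2 * (n * l) := by
    intro l
    induction l with
    | zero => simp
    | succ l ih =>
      intro hl
      have := ih (by omega)
      rw [Finset.sum_range_succ]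
      obtain ⟨c, rfl⟩ := Nat.exists_eq_add_of_le hl
      have h3 : l + 1 + c - 1 - l = c := by omega
      rw [h3]
      nlinarith
  have h3 := h2 k hkn
  rw [← Fin.sum_univ_eq_sum_range (fun j => n - 1 - j)] at h3
  rw [h1, stiefelDim]
  have h4 : 2 * (k * (k + 1) / 2) = k * (k + 1) := Nat.mul_div_cancel' (Nat.even_mul_succ_self k).two_dvd
  omega

lemma euclideanHausdorffMeasure_low (hkn : k ≤ n) :
    (Measure.euclideanHausdorffMeasure (stiefelDim n k) :
      Measure (EuclideanSpace ℝ (Low n k))) = volume := by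
  have := InnerProductSpace.euclideanHausdorffMeasure_eq_volume (V := EuclideanSpace ℝ (Low n k))
  rwa [finrank_euclideanSpace, card_low hkn] at this

lemma euclideanHausdorffMeasure_image_le {X Y : Type*} [EMetricSpace X] [MeasurableSpace X]
    [BorelSpace X] [EMetricSpace Y] [MeasurableSpace Y] [BorelSpace Y] {f : X → Y} {s : Set X}
    {K : NNReal} (h : LipschitzOnWith K f s) (m : ℕ) :
    Measure.euclideanHausdorffMeasure m (f '' s) ≤
      (K : ENNReal) ^ m * Measure.euclideanHausdorffMeasure m s := by
  simp only [Measure.euclideanHausdorffMeasure_def, Measure.smul_apply, ENNReal.smul_def,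
    smul_eq_mul]
  rw [mul_left_comm]
  gcongr
  simpa using h.hausdorffMeasure_image_le (d := m) (by positivity)

/-- The part of the Stiefel manifold at distance at most `ρ` from the base frame. -/
def patch (hkn : k ≤ n) (ρ : ℝ) : Set (MatSpace n k) :=
  stiefel n k ∩ Metric.closedBall (base hkn) ρ

lemma measurableSet_patch (hkn : k ≤ n) (ρ : ℝ) : MeasurableSet (patch hkn ρ) :=
  measurableSet_stiefel.inter Metric.isClosed_closedBall.measurableSet

/-- Tangential coordinates of a frame, relative to the base frame. -/
def tcoord (hkn : k ≤ n) (X : MatSpace n k) : EuclideanSpace ℝ (Low n k) :=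
  tproj hkn (X - base hkn)

lemma continuous_tcoord (hkn : k ≤ n) : Continuous (tcoord hkn) := by
  unfold tcoord; fun_prop

lemma tcoord_sub (hkn : k ≤ n) (X Y : MatSpace n k) :
    tcoord hkn X - tcoord hkn Y = tproj hkn (X - Y) := by
  simp [tcoord, ← map_sub]

lemma lipschitzWith_tcoord (hkn : k ≤ n) : LipschitzWith 1 (tcoord hkn) :=
  LipschitzWith.of_dist_le_mul fun X Y => by
    simpa [dist_eq_norm, tcoord_sub] using norm_tproj_le hkn (X - Y)

lemma volume_image_tcoord_le (hkn : k ≤ n) (S : Set (MatSpace n k)) :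
    volume (tcoord hkn '' S) ≤ Measure.euclideanHausdorffMeasure (stiefelDim n k) S := by
  rw [← euclideanHausdorffMeasure_low hkn]
  simpa using euclideanHausdorffMeasure_image_le (lipschitzWith_tcoord hkn).lipschitzOnWith
    (s := S) (stiefelDim n k)

/-- The Lipschitz constant of the inverse of the tangential coordinates on `patch hkn ρ`. -/
def patchLip (ρ : ℝ) : NNReal := (√(1 - ρ ^ 2))⁻¹.toNNReal

lemma coe_patchLip (ρ : ℝ) : (patchLip ρ : ℝ) = (√(1 - ρ ^ 2))⁻¹ :=
  Real.coe_toNNReal _ (by positivity)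

lemma dist_le_patchLip (hkn : k ≤ n) {ρ : ℝ} (h0 : 0 ≤ ρ) (h1 : ρ < 1) {X Y : MatSpace n k}
    (hX : X ∈ patch hkn ρ) (hY : Y ∈ patch hkn ρ) :
    dist X Y ≤ patchLip ρ * dist (tcoord hkn X) (tcoord hkn Y) := by
  have h2 : 0 < 1 - ρ ^ 2 := by nlinarith
  have h3 := norm_sub_sq_le_tproj hkn hX.1 hY.1 (by simpa [dist_eq_norm] using hX.2)
    (by simpa [dist_eq_norm] using hY.2)
  rw [coe_patchLip, dist_eq_norm, dist_eq_norm, tcoord_sub, inv_mul_eq_div,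
    le_div_iff₀ (by positivity)]
  refine le_of_sq_le_sq ?_ (norm_nonneg _)
  rw [mul_pow, Real.sq_sqrt h2.le]
  linarith

/-- On the patch the tangential coordinates are injective with Lipschitz inverse, and Lipschitz maps
control Hausdorff measure. Since `patchLip ρ` tends to 1 as ρ → 0, this and `volume_image_tcoord_le`
identify the density of the surface measure at the base frame as 1, with no area formula. -/
lemma euclideanHausdorffMeasure_le_of_subset_patch (hkn : k ≤ n) {ρ : ℝ} (h0 : 0 ≤ ρ) (h1 : ρ < 1)
    {S : Set (MatSpace n k)} (hS : S ⊆ patch hkn ρ) :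
    Measure.euclideanHausdorffMeasure (stiefelDim n k) S ≤
      (patchLip ρ : ENNReal) ^ stiefelDim n k * volume (tcoord hkn '' S) := by
  have hinj : Set.InjOn (tcoord hkn) S := fun X hX Y hY h => by
    have := dist_le_patchLip hkn h0 h1 (hS hX) (hS hY)
    rw [h, dist_self, mul_zero] at this
    exact dist_le_zero.mp this
  let g := Function.invFunOn (tcoord hkn) S
  have hg : LipschitzOnWith (patchLip ρ) g (tcoord hkn '' S) := by
    refine LipschitzOnWith.of_dist_le_mul ?_
    rintro _ ⟨X, hX, rfl⟩ _ ⟨Y, hY, rfl⟩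
    have hX' : g (tcoord hkn X) = X := hinj.leftInvOn_invFunOn hX
    have hY' : g (tcoord hkn Y) = Y := hinj.leftInvOn_invFunOn hY
    rw [hX', hY']
    exact dist_le_patchLip hkn h0 h1 (hS hX) (hS hY)
  have := euclideanHausdorffMeasure_image_le hg (stiefelDim n k)
  rwa [hinj.leftInvOn_invFunOn.image_image, euclideanHausdorffMeasure_low hkn] at this

lemma patch_measure_lt_top (hkn : k ≤ n) {ρ : ℝ} (h0 : 0 ≤ ρ) (h1 : ρ < 1) :
    Measure.euclideanHausdorffMeasure (stiefelDim n k) (patch hkn ρ) < ⊤ := by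
  refine (euclideanHausdorffMeasure_le_of_subset_patch hkn h0 h1 subset_rfl).trans_lt ?_
  refine ENNReal.mul_lt_top (by simp) ?_
  refine ((Metric.isBounded_closedBall (x := tcoord hkn (base hkn)) (r := ((1 : NNReal) : ℝ) * ρ)).subset
    ?_).measure_lt_top
  rintro _ ⟨X, hX, rfl⟩
  exact (lipschitzWith_tcoord hkn).mapsTo_closedBall (base hkn) ρ hX.2

/-- By homogeneity every frame has a neighbourhood isometric to a patch at the base frame, which has
finite measure; compactness concludes. -/
lemma isFiniteMeasure_stiefelMeasure (hkn : k ≤ n) :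
    IsFiniteMeasure (stiefelMeasure n k) := by
  refine ⟨?_⟩
  rw [stiefelMeasure, Measure.restrict_apply_univ]
  refine isCompact_stiefel.measure_lt_top_of_nhdsWithin fun X hX => ?_
  obtain ⟨U, hU, rfl⟩ := exists_biMul_base hkn hX
  have hV : (1 : Matrix (Fin k) (Fin k) ℝ) * 1ᵀ = 1 := by simp
  let T := biMulIsometry U 1 hU hV
  refine ⟨T '' patch hkn (1 / 2), ?_, ?_⟩
  · have h1 : T '' patch hkn (1 / 2) =
        stiefel n k ∩ Metric.closedBall (T (base hkn)) (1 / 2) := by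
      rw [patch, Set.image_inter T.injective, T.image_closedBall]
      congr 1
      ext Y
      constructor
      · rintro ⟨Z, hZ, rfl⟩
        exact (biMul_mem_stiefel hU hV Z).mpr hZ
      · intro hY
        refine ⟨T.symm Y, ?_, by simp⟩
        rw [← biMul_mem_stiefel hU hV]
        change T (T.symm Y) ∈ _
        simpa using hY
    rw [h1]
    exact Filter.inter_mem self_mem_nhdsWithin
      (mem_nhdsWithin_of_mem_nhds (Metric.closedBall_mem_nhds _ (by norm_num)))
  · rw [T.isometry.euclideanHausdorffMeasure_image]
    exact patch_measure_lt_top hkn (by norm_num) (by norm_num)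

/-- The surface measure near the base frame, in tangential coordinates. -/
def patchMeasure (hkn : k ≤ n) (ρ : ℝ) : Measure (EuclideanSpace ℝ (Low n k)) :=
  ((stiefelMeasure n k).restrict (patch hkn ρ)).map (tcoord hkn)

lemma patchMeasure_apply (hkn : k ≤ n) (ρ : ℝ) {S : Set (EuclideanSpace ℝ (Low n k))}
    (hS : MeasurableSet S) : patchMeasure hkn ρ S =
      Measure.euclideanHausdorffMeasure (stiefelDim n k) (tcoord hkn ⁻¹' S ∩ patch hkn ρ) := by
  have hm := (continuous_tcoord hkn).measurable
  rw [patchMeasure, Measure.map_apply hm hS, Measure.restrict_apply (hm hS), stiefelMeasure,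
    Measure.restrict_apply ((hm hS).inter (measurableSet_patch hkn ρ)),
    Set.inter_eq_left.mpr]
  exact Set.inter_subset_right.trans Set.inter_subset_left

lemma patchMeasure_le (hkn : k ≤ n) {ρ : ℝ} (h0 : 0 ≤ ρ) (h1 : ρ < 1) :
    patchMeasure hkn ρ ≤ (patchLip ρ ^ stiefelDim n k) • volume := by
  refine Measure.le_iff.mpr fun S hS => ?_
  rw [patchMeasure_apply hkn ρ hS]
  refine (euclideanHausdorffMeasure_le_of_subset_patch hkn h0 h1 Set.inter_subset_right).trans ?_
  rw [Measure.smul_apply, ENNReal.smul_def, smul_eq_mul, ENNReal.coe_pow]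
  gcongr
  rintro _ ⟨X, hX, rfl⟩
  exact hX.1

/-- A ball in the tangent space is covered by the image of the patch, and the tangential coordinates
do not increase measure. -/
lemma exists_restrict_le_patchMeasure (hkn : k ≤ n) {ρ : ℝ} (hρ : 0 < ρ) :
    ∃ r > 0, (volume : Measure (EuclideanSpace ℝ (Low n k))).restrict (Metric.ball 0 r) ≤
      patchMeasure hkn ρ := by
  obtain ⟨r, hr, h⟩ := exists_ball_subset_image_tproj hkn hρ
  refine ⟨r, hr, Measure.le_iff.mpr fun S hS => ?_⟩
  rw [patchMeasure_apply hkn ρ hS, Measure.restrict_apply hS]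
  refine (measure_mono ?_).trans (volume_image_tcoord_le hkn _)
  rintro v ⟨hvS, hv⟩
  obtain ⟨X, hX, hXρ, rfl⟩ := h v (by simpa using hv)
  exact ⟨X, ⟨hvS, hX, by simpa [dist_eq_norm] using hXρ.le⟩, rfl⟩

/-! ### Laplace asymptotics at the base frame -/

/-- The height `∑ d_j (1 - X_jj)` above the base frame. -/
def height (hkn : k ≤ n) (d : Fin k → ℝ) (X : MatSpace n k) : ℝ :=
  ∑ j, d j * (1 - X (Fin.castLE hkn j, j))

/-- The eigenvalue of the Hessian of `height` at the base frame for the coordinate `p`. -/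
def hessEigen (d : Fin k → ℝ) (p : Low n k) : ℝ :=
  if h : (p.1.1 : ℕ) < k then (d ⟨p.1.1, h⟩ + d p.1.2) / 2 else d p.1.2

/-- The Hessian of `height` at the base frame. -/
def hessForm (d : Fin k → ℝ) (v : EuclideanSpace ℝ (Low n k)) : ℝ :=
  ∑ p, hessEigen d p * v p ^ 2

lemma continuous_height (hkn : k ≤ n) (d : Fin k → ℝ) : Continuous (height hkn d) := by
  unfold height; fun_prop

lemma continuous_hessForm (d : Fin k → ℝ) : Continuous (hessForm (n := n) d) := by
  unfold hessForm; fun_prop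

lemma one_le_hessEigen {d : Fin k → ℝ} (hd : ∀ j, 1 ≤ d j) (p : Low n k) : 1 ≤ hessEigen d p := by
  unfold hessEigen
  split_ifs with h
  · linarith [hd ⟨p.1.1, h⟩, hd p.1.2]
  · exact hd _

lemma norm_sq_le_hessForm {d : Fin k → ℝ} (hd : ∀ j, 1 ≤ d j) (v : EuclideanSpace ℝ (Low n k)) :
    ‖v‖ ^ 2 ≤ hessForm d v := by
  rw [EuclideanSpace.norm_sq_eq, hessForm]
  refine Finset.sum_le_sum fun p _ => ?_
  rw [Real.norm_eq_abs, sq_abs]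
  nlinarith [one_le_hessEigen hd p, sq_nonneg (v p)]

lemma sum_sq_sub_base (hkn : k ≤ n) {X : MatSpace n k} (hX : X ∈ stiefel n k) (j : Fin k) :
    ∑ i, (X - base hkn) (i, j) ^ 2 = 2 * (1 - X (Fin.castLE hkn j, j)) := by
  simp only [PiLp.sub_apply, sub_sq, Finset.sum_add_distrib, Finset.sum_sub_distrib,
    sum_sq_col hX j, base_apply]
  simp
  ring

/-- Unit columns give ∑_i (X - E)_ij² = 2(1 - X_jj). The height is therefore an exact quadratic form
in X - E, and only the passage to tangential coordinates produces an error. -/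
lemma two_mul_height (hkn : k ≤ n) (d : Fin k → ℝ) {X : MatSpace n k} (hX : X ∈ stiefel n k) :
    2 * height hkn d X = ∑ i, ∑ j, d j * (X - base hkn) (i, j) ^ 2 := by
  rw [Finset.sum_comm, height, Finset.mul_sum]
  refine Finset.sum_congr rfl fun j _ => ?_
  rw [← Finset.mul_sum, sum_sq_sub_base hkn hX]
  ring

lemma norm_sq_le_two_mul_height (hkn : k ≤ n) {d : Fin k → ℝ} (hd : ∀ j, 1 ≤ d j)
    {X : MatSpace n k} (hX : X ∈ stiefel n k) :
    ‖X - base hkn‖ ^ 2 ≤ 2 * height hkn d X := by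
  rw [two_mul_height hkn d hX, norm_sq_eq_sum]
  refine Finset.sum_le_sum fun i _ => Finset.sum_le_sum fun j _ => ?_
  nlinarith [hd j, sq_nonneg ((X - base hkn) (i, j))]

lemma sum_sq_symPart_eq (hkn : k ≤ n) (Y : MatSpace n k) :
    ∑ p, ∑ q, symPart hkn Y p q ^ 2 = ∑ j, Y (Fin.castLE hkn j, j) ^ 2 +
      ∑ p : Low n k, if h : (p.1.1 : ℕ) < k then
        2 * ((Y p.1 + Y (Fin.castLE hkn p.1.2, ⟨p.1.1, h⟩)) / 2) ^ 2 else 0 := by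
  have h1 : ∑ p, ∑ q, symPart hkn Y p q ^ 2 = ∑ i : Fin n, ∑ q,
      if h : (i : ℕ) < k then symPart hkn Y ⟨i, h⟩ q ^ 2 else 0 := by
    rw [← sum_dite_lt hkn]
    refine Finset.sum_congr rfl fun i _ => ?_
    by_cases h : (i : ℕ) < k <;> simp [h]
  rw [h1, sum_eq_diag_add_low hkn]
  congr 1
  · refine Finset.sum_congr rfl fun j _ => ?_
    simp [symPart_apply]
  · refine Finset.sum_congr rfl fun p _ => ?_
    have h2 : (p.1.2 : ℕ) < k := p.1.2.2
    by_cases h : (p.1.1 : ℕ) < k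
    · have h3 : Fin.castLE hkn ⟨p.1.1, h⟩ = p.1.1 := by ext; simp
      simp only [symPart_apply, h, dif_pos, Fin.val_castLE, h2, Fin.eta, h3]
      ring
    · simp [h]

/-- The quadratic form in X - E differs from the Hessian form by terms containing the normal part,
whose square S is at most (4/3)ρ²‖v‖². The mixed terms are split with weight ρ, so the total error
is O(ρ) times the Hessian form. -/
lemma abs_two_mul_height_sub_le (hkn : k ≤ n) {d : Fin k → ℝ} {Δ : ℝ} (hd : ∀ j, 1 ≤ d j)
    (hΔ : ∀ j, d j ≤ Δ) (hΔ0 : 0 ≤ Δ) {ρ : ℝ} (h0 : 0 < ρ) (h1 : ρ ≤ 1 / 2) {X : MatSpace n k}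
    (hX : X ∈ patch hkn ρ) :
    |2 * height hkn d X - hessForm d (tcoord hkn X)| ≤ 4 * Δ * ρ * hessForm d (tcoord hkn X) := by
  set Y := X - base hkn with hY
  have hYρ : ‖Y‖ ≤ ρ := by simpa [dist_eq_norm] using hX.2
  set v := tcoord hkn X with hv
  have hvY : v = tproj hkn Y := rfl
  have hS := sum_sq_symPart_sub_le hkn hX.1 (base_mem_stiefel hkn) hYρ
    (by simpa using h0.le : ‖base hkn - base hkn‖ ≤ ρ)
  have hn := norm_sub_sq_le_tproj hkn hX.1 (base_mem_stiefel hkn) hYρ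
    (by simpa using h0.le : ‖base hkn - base hkn‖ ≤ ρ)
  rw [← hY] at hS hn
  rw [← hvY] at hn
  set S := ∑ p, ∑ q, symPart hkn Y p q ^ 2 with hSdef
  have hS2 : S ≤ ρ ^ 2 * (4 / 3 * ‖v‖ ^ 2) := by
    refine hS.trans ?_
    gcongr
    have : ρ ^ 2 ≤ 1 / 4 := by nlinarith
    nlinarith [sq_nonneg ‖Y‖]
  have key : |2 * height hkn d X - hessForm d v| ≤ Δ * (1 + 1 / (2 * ρ)) * S + Δ * ρ * ‖v‖ ^ 2 := by
    rw [two_mul_height hkn d hX.1, sum_eq_diag_add_low hkn, hSdef, sum_sq_symPart_eq hkn,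
      EuclideanSpace.norm_sq_eq, hessForm, add_sub_assoc, ← Finset.sum_sub_distrib, mul_add,
      Finset.mul_sum, Finset.mul_sum, Finset.mul_sum, add_assoc, ← Finset.sum_add_distrib]
    refine (abs_add_le _ _).trans (add_le_add ((Finset.abs_sum_le_sum_abs _ _).trans
      (Finset.sum_le_sum fun j _ => ?_)) ((Finset.abs_sum_le_sum_abs _ _).trans
      (Finset.sum_le_sum fun p _ => ?_)))
    · rw [← hY, abs_of_nonneg (by nlinarith [hd j, sq_nonneg (Y (Fin.castLE hkn j, j))])]
      have : 0 ≤ 1 / (2 * ρ) := by positivity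
      have : d j ≤ Δ * (1 + 1 / (2 * ρ)) := by nlinarith [hΔ j]
      gcongr
    · rw [← hY, hvY, tproj_apply, hessEigen]
      by_cases h : (p.1.1 : ℕ) < k
      · simp only [h, dif_pos, Prod.mk.eta]
        set a := Y p.1
        set b := Y (Fin.castLE hkn p.1.2, ⟨p.1.1, h⟩)
        set d1 := d p.1.2
        set d2 := d ⟨p.1.1, h⟩
        have e1 : d1 ≤ Δ := hΔ _
        have e2 : d2 ≤ Δ := hΔ _
        have e3 : 1 ≤ d1 := hd _
        have e4 : 1 ≤ d2 := hd _
        have hs : √2 ^ 2 = (2 : ℝ) := Real.sq_sqrt (by norm_num)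
        rw [Real.norm_eq_abs, sq_abs, div_pow, hs]
        have e5 : d1 * a ^ 2 + d2 * b ^ 2 - (d2 + d1) / 2 * ((a - b) ^ 2 / 2) =
            (d1 + d2) * ((a + b) / 2) ^ 2 + 2 * (d1 - d2) * (((a + b) / 2) * ((a - b) / 2)) := by
          ring
        rw [e5]
        have e6 : |(d1 + d2) * ((a + b) / 2) ^ 2| ≤ 2 * Δ * ((a + b) / 2) ^ 2 := by
          rw [abs_of_nonneg (by positivity)]
          gcongr
          linarith
        -- Weighted inequality 2xy ≤ x²/ρ + ρy²: the normal part x is smaller by a factor ρ than the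
        -- tangential part y, so both terms have order ρ.
        have e7 : |2 * (d1 - d2) * (((a + b) / 2) * ((a - b) / 2))| ≤
            Δ * (((a + b) / 2) ^ 2 / ρ + ρ * ((a - b) / 2) ^ 2) := by
          rw [abs_mul, abs_mul]
          have e8 : |d1 - d2| ≤ Δ := abs_le.mpr ⟨by linarith, by linarith⟩
          have e9 : 2 * |(a + b) / 2 * ((a - b) / 2)| ≤
              ((a + b) / 2) ^ 2 / ρ + ρ * ((a - b) / 2) ^ 2 := by
            rw [abs_mul, ← sq_abs ((a + b) / 2), ← sq_abs ((a - b) / 2)]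
            set x := |(a + b) / 2|
            set y := |(a - b) / 2|
            have : x ^ 2 / ρ + ρ * y ^ 2 - 2 * (x * y) = (x - ρ * y) ^ 2 / ρ := by
              field_simp; ring
            have h5 : 0 ≤ (x - ρ * y) ^ 2 / ρ := by positivity
            linarith
          have := mul_le_mul e8 e9 (by positivity) hΔ0
          rw [abs_two]
          linarith
        refine (abs_add_le _ _).trans ((add_le_add e6 e7).trans ?_)
        have : Δ * (1 + 1 / (2 * ρ)) * (2 * ((a + b) / 2) ^ 2) + Δ * ρ * ((a - b) ^ 2 / 2) -
            (2 * Δ * ((a + b) / 2) ^ 2 + Δ * (((a + b) / 2) ^ 2 / ρ + ρ * ((a - b) / 2) ^ 2)) =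
            Δ * ρ * ((a - b) / 2) ^ 2 := by
          field_simp; ring
        have h5 : 0 ≤ Δ * ρ * ((a - b) / 2) ^ 2 := by positivity
        linarith
      · simp [h]
        positivity
  refine key.trans ?_
  have e1 : Δ * (1 + 1 / (2 * ρ)) * S ≤ Δ * (1 + 1 / (2 * ρ)) * (ρ ^ 2 * (4 / 3 * ‖v‖ ^ 2)) := by
    gcongr
  have e2 : (1 + 1 / (2 * ρ)) * ρ ^ 2 = ρ ^ 2 + ρ / 2 := by field_simp
  have e3 : Δ * (1 + 1 / (2 * ρ)) * (ρ ^ 2 * (4 / 3 * ‖v‖ ^ 2)) =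
      Δ * (ρ ^ 2 + ρ / 2) * (4 / 3 * ‖v‖ ^ 2) := by rw [← e2]; ring
  have e4 : ρ ^ 2 + ρ / 2 ≤ ρ := by nlinarith
  have e5 : Δ * (ρ ^ 2 + ρ / 2) * (4 / 3 * ‖v‖ ^ 2) ≤ Δ * ρ * (4 / 3 * ‖v‖ ^ 2) := by gcongr
  have e6 : Δ * ρ * ‖v‖ ^ 2 ≤ Δ * ρ * hessForm d v := by
    gcongr; exact norm_sq_le_hessForm hd v
  have e7 : 0 ≤ Δ * ρ * ‖v‖ ^ 2 := by positivity
  linarith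

/-- The Gaussian integral of the Hessian form. -/
def gaussConst (n : ℕ) {k : ℕ} (d : Fin k → ℝ) : ℝ :=
  ∏ p : Low n k, √(2 * Real.pi / hessEigen d p)

lemma gaussConst_pos {d : Fin k → ℝ} (hd : ∀ j, 1 ≤ d j) : 0 < gaussConst n d :=
  Finset.prod_pos fun p _ => Real.sqrt_pos.mpr
    (div_pos (by positivity) (one_pos.trans_le (one_le_hessEigen hd p)))

lemma integrable_gauss {d : Fin k → ℝ} (hd : ∀ j, 1 ≤ d j) {s : ℝ} (hs : 0 < s) :
    Integrable fun v : EuclideanSpace ℝ (Low n k) => Real.exp (-(s * hessForm d v / 2)) := by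
  rw [← (PiLp.volume_preserving_toLp (Low n k)).integrable_comp_emb
    (MeasurableEquiv.toLp 2 _).measurableEmbedding]
  have : ((fun v : EuclideanSpace ℝ (Low n k) => Real.exp (-(s * hessForm d v / 2))) ∘
      WithLp.toLp 2) = fun v => ∏ p, Real.exp (-(s * hessEigen d p / 2) * v p ^ 2) := by
    ext v
    simp only [Function.comp, hessForm]
    rw [← Real.exp_sum, Finset.mul_sum, Finset.sum_div, ← Finset.sum_neg_distrib]
    congr 1
    refine Finset.sum_congr rfl fun p _ => ?_
    ring
  rw [this]
  refine Integrable.fintype_prod (f := fun p x => Real.exp (-(s * hessEigen d p / 2) * x ^ 2))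
    fun p => integrable_exp_neg_mul_sq ?_
  have := one_le_hessEigen hd p
  positivity

lemma integral_gauss {d : Fin k → ℝ} (hd : ∀ j, 1 ≤ d j) {s : ℝ} (hs : 0 < s) :
    ∫ v : EuclideanSpace ℝ (Low n k), Real.exp (-(s * hessForm d v / 2)) =
      (√s)⁻¹ ^ Fintype.card (Low n k) * gaussConst n d := by
  rw [← (PiLp.volume_preserving_toLp (Low n k)).integral_comp
    (MeasurableEquiv.toLp 2 _).measurableEmbedding]
  have : ∀ v : Low n k → ℝ, Real.exp (-(s * hessForm d (WithLp.toLp 2 v) / 2)) =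
      ∏ p, Real.exp (-(s * hessEigen d p / 2) * v p ^ 2) := by
    intro v
    simp only [hessForm]
    rw [← Real.exp_sum, Finset.mul_sum, Finset.sum_div, ← Finset.sum_neg_distrib]
    congr 1
    refine Finset.sum_congr rfl fun p _ => ?_
    ring
  simp_rw [this]
  rw [integral_fintype_prod_volume_eq_prod
    (f := fun p x => Real.exp (-(s * hessEigen d p / 2) * x ^ 2)), gaussConst,
    ← Finset.card_univ, ← Finset.prod_const, ← Finset.prod_mul_distrib]
  refine Finset.prod_congr rfl fun p _ => ?_
  rw [integral_gaussian, ← Real.sqrt_inv, ← Real.sqrt_mul (by positivity)]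
  congr 1
  have := one_le_hessEigen hd p
  field_simp

lemma setIntegral_patch_eq (hkn : k ≤ n) (ρ : ℝ) (d : Fin k → ℝ) (s : ℝ) :
    ∫ X in patch hkn ρ, Real.exp (-(s * hessForm d (tcoord hkn X) / 2)) ∂stiefelMeasure n k =
      ∫ v, Real.exp (-(s * hessForm d v / 2)) ∂patchMeasure hkn ρ := by
  rw [patchMeasure, integral_map (continuous_tcoord hkn).aemeasurable]
  have := continuous_hessForm (n := n) d
  exact (by fun_prop : Continuous fun v : EuclideanSpace ℝ (Low n k) =>
    Real.exp (-(s * hessForm d v / 2))).aestronglyMeasurable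

lemma integrable_of_continuous (hkn : k ≤ n) {F : Type*} [NormedAddCommGroup F]
    {f : MatSpace n k → F} (hf : ContinuousOn f (stiefel n k)) :
    Integrable f (stiefelMeasure n k) := by
  have := isFiniteMeasure_stiefelMeasure hkn
  have h : IntegrableOn f (stiefel n k) (stiefelMeasure n k) :=
    hf.integrableOn_compact isCompact_stiefel
  rwa [IntegrableOn, stiefelMeasure, Measure.restrict_restrict measurableSet_stiefel,
    Set.inter_self] at h

/-- The height is bounded below by (1 - 4Δρ) times half the Hessian form, and the patch measure
above by Lebesgue measure times a power of `patchLip ρ`; both factors tend to 1 with ρ. -/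
lemma laplace_patch_le (hkn : k ≤ n) {d : Fin k → ℝ} {Δ : ℝ} (hd : ∀ j, 1 ≤ d j)
    (hΔ : ∀ j, d j ≤ Δ) (hΔ0 : 0 ≤ Δ) {ρ : ℝ} (h0 : 0 < ρ) (h1 : ρ ≤ 1 / 2) (h2 : 4 * Δ * ρ < 1)
    {τ : ℝ} (hτ : 0 < τ) :
    √τ ^ stiefelDim n k * ∫ X in patch hkn ρ, Real.exp (-(τ * height hkn d X)) ∂stiefelMeasure n k ≤
      (patchLip ρ : ℝ) ^ stiefelDim n k * ((√(1 - 4 * Δ * ρ))⁻¹ ^ stiefelDim n k * gaussConst n d) := by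
  have hs : 0 < 1 - 4 * Δ * ρ := by linarith
  have hcont := continuous_height hkn d
  have hcont2 := continuous_hessForm (n := n) d
  have hcont3 := continuous_tcoord hkn
  have e1 : ∫ X in patch hkn ρ, Real.exp (-(τ * height hkn d X)) ∂stiefelMeasure n k ≤
      ∫ X in patch hkn ρ, Real.exp (-((τ * (1 - 4 * Δ * ρ)) * hessForm d (tcoord hkn X) / 2))
        ∂stiefelMeasure n k := by
    refine setIntegral_mono_on ?_ ?_ (measurableSet_patch hkn ρ) fun X hX => ?_
    · exact (integrable_of_continuous hkn (by fun_prop)).integrableOn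
    · exact (integrable_of_continuous hkn (by fun_prop)).integrableOn
    · gcongr
      have := (abs_le.mp (abs_two_mul_height_sub_le hkn hd hΔ hΔ0 h0 h1 hX)).1
      nlinarith
  rw [setIntegral_patch_eq] at e1
  have hint := integrable_gauss (n := n) hd (s := τ * (1 - 4 * Δ * ρ)) (by positivity)
  have e2 : ∫ v, Real.exp (-((τ * (1 - 4 * Δ * ρ)) * hessForm d v / 2)) ∂patchMeasure hkn ρ ≤
      ∫ v, Real.exp (-((τ * (1 - 4 * Δ * ρ)) * hessForm d v / 2))
        ∂((patchLip ρ ^ stiefelDim n k) • (volume : Measure (EuclideanSpace ℝ (Low n k)))) := by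
    refine integral_mono_measure (patchMeasure_le hkn h0.le (by linarith))
      (Eventually.of_forall fun v => by positivity) ?_
    exact hint.smul_measure_nnreal
  rw [integral_smul_nnreal_measure, integral_gauss hd (by positivity), card_low hkn] at e2
  have e3 : √τ ^ stiefelDim n k * (√(τ * (1 - 4 * Δ * ρ)))⁻¹ ^ stiefelDim n k =
      (√(1 - 4 * Δ * ρ))⁻¹ ^ stiefelDim n k := by
    rw [← mul_pow, Real.sqrt_mul hτ.le, mul_inv, ← mul_assoc, mul_inv_cancel₀ (by positivity),
      one_mul]
  calc _ ≤ √τ ^ stiefelDim n k * ((patchLip ρ ^ stiefelDim n k) •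
        ((√(τ * (1 - 4 * Δ * ρ)))⁻¹ ^ stiefelDim n k * gaussConst n d)) := by
        gcongr; exact e1.trans e2
    _ = _ := by
      rw [← e3, NNReal.smul_def, smul_eq_mul]
      push_cast
      ring

lemma le_laplace_patch (hkn : k ≤ n) {d : Fin k → ℝ} {Δ : ℝ} (hd : ∀ j, 1 ≤ d j)
    (hΔ : ∀ j, d j ≤ Δ) (hΔ0 : 0 ≤ Δ) {ρ : ℝ} (h0 : 0 < ρ) (h1 : ρ ≤ 1 / 2) :
    ∃ r > 0, ∀ τ > 0, (√(1 + 4 * Δ * ρ))⁻¹ ^ stiefelDim n k * gaussConst n d -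
      Real.exp (-(τ * r)) * (√2 ^ stiefelDim n k * gaussConst n d) ≤
      √τ ^ stiefelDim n k *
        ∫ X in patch hkn ρ, Real.exp (-(τ * height hkn d X)) ∂stiefelMeasure n k := by
  obtain ⟨r, hr, hle⟩ := exists_restrict_le_patchMeasure hkn h0
  refine ⟨r ^ 2 / 4, by positivity, fun τ hτ => ?_⟩
  have := isFiniteMeasure_stiefelMeasure hkn
  have hs : 0 < 1 + 4 * Δ * ρ := by positivity
  set s := 1 + 4 * Δ * ρ with hsdef
  have hs1 : 1 ≤ s := le_add_of_nonneg_right (by positivity)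
  have hcont := continuous_height hkn d
  have hcont2 := continuous_hessForm (n := n) d
  have hcont3 := continuous_tcoord hkn
  have e1 : ∫ X in patch hkn ρ, Real.exp (-((τ * s) * hessForm d (tcoord hkn X) / 2))
        ∂stiefelMeasure n k ≤
      ∫ X in patch hkn ρ, Real.exp (-(τ * height hkn d X)) ∂stiefelMeasure n k := by
    refine setIntegral_mono_on ?_ ?_ (measurableSet_patch hkn ρ) fun X hX => ?_
    · exact (integrable_of_continuous hkn (by fun_prop)).integrableOn
    · exact (integrable_of_continuous hkn (by fun_prop)).integrableOn
    · gcongr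
      have := (abs_le.mp (abs_two_mul_height_sub_le hkn hd hΔ hΔ0 h0 h1 hX)).2
      nlinarith
  rw [setIntegral_patch_eq] at e1
  have hint := integrable_gauss (n := n) hd (s := τ * s) (by positivity)
  have hint2 := integrable_gauss (n := n) hd (s := τ / 2) (by positivity)
  have hexp1 : ∀ v : EuclideanSpace ℝ (Low n k), Real.exp (-((τ * s) * hessForm d v / 2)) ≤ 1 := by
    intro v
    rw [Real.exp_le_one_iff]
    have := norm_sq_le_hessForm hd v
    have : 0 ≤ hessForm d v := (sq_nonneg _).trans this
    have : 0 ≤ τ * s * hessForm d v / 2 := by positivity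
    linarith
  have e2 : ∫ v in Metric.ball (0 : EuclideanSpace ℝ (Low n k)) r, Real.exp (-((τ * s) * hessForm d v / 2)) ≤
      ∫ v, Real.exp (-((τ * s) * hessForm d v / 2)) ∂patchMeasure hkn ρ := by
    have : IsFiniteMeasure (patchMeasure hkn ρ) := by
      unfold patchMeasure; infer_instance
    refine integral_mono_measure hle (Eventually.of_forall fun v => by positivity) ?_
    refine Integrable.of_bound (C := 1) (by fun_prop : Continuous
      fun v : EuclideanSpace ℝ (Low n k) => Real.exp (-((τ * s) * hessForm d v / 2))).aestronglyMeasurable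
      (Eventually.of_forall fun v => ?_)
    rw [Real.norm_eq_abs, abs_of_pos (Real.exp_pos _)]
    exact hexp1 v
  -- Outside the ball half of the exponent is at least τr²/4 and yields the small factor; the other
  -- half remains a Gaussian of rate τ/2, the source of √2 to the power of the dimension.
  have e3 : ∫ v in (Metric.ball (0 : EuclideanSpace ℝ (Low n k)) r)ᶜ, Real.exp (-((τ * s) * hessForm d v / 2)) ≤
      ∫ v : EuclideanSpace ℝ (Low n k), Real.exp (-(τ * (r ^ 2 / 4))) *
        Real.exp (-((τ / 2) * hessForm d v / 2)) := by
    refine (setIntegral_mono_on hint.integrableOn (hint2.const_mul _).integrableOn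
      Metric.isOpen_ball.measurableSet.compl fun v hv => ?_).trans
      (setIntegral_le_integral (hint2.const_mul _) (Eventually.of_forall fun v => by positivity))
    rw [← Real.exp_add]
    gcongr
    have hv' : r ≤ ‖v‖ := by simpa using hv
    have h3 := norm_sq_le_hessForm hd v
    have h4 : r ^ 2 ≤ ‖v‖ ^ 2 := by gcongr
    have h5 : τ * hessForm d v ≤ τ * s * hessForm d v := by
      have : 0 ≤ hessForm d v := (sq_nonneg _).trans h3
      nlinarith [mul_nonneg hτ.le this]
    have h6 : τ * r ^ 2 ≤ τ * hessForm d v := by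
      gcongr; exact h4.trans h3
    linarith
  rw [integral_const_mul, integral_gauss hd (by positivity), card_low hkn] at e3
  have e4 := integral_add_compl (Metric.isOpen_ball (x := (0 : EuclideanSpace ℝ (Low n k)))
    (ε := r)).measurableSet hint
  rw [integral_gauss hd (by positivity), card_low hkn] at e4
  have e5 : ∀ t > 0, √τ ^ stiefelDim n k * (√(τ * t))⁻¹ ^ stiefelDim n k =
      (√t)⁻¹ ^ stiefelDim n k := by
    intro t ht
    rw [← mul_pow, Real.sqrt_mul hτ.le, mul_inv, ← mul_assoc, mul_inv_cancel₀ (by positivity),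
      one_mul]
  have e6 : √2 = (√(1 / 2 : ℝ))⁻¹ := by simp
  have e7 : τ / 2 = τ * (1 / 2) := by ring
  rw [e6, ← e5 s hs, ← e5 (1 / 2) (by norm_num)]
  rw [e7] at e3
  calc _ = √τ ^ stiefelDim n k * ((√(τ * s))⁻¹ ^ stiefelDim n k * gaussConst n d -
        Real.exp (-(τ * (r ^ 2 / 4))) * ((√(τ * (1 / 2)))⁻¹ ^ stiefelDim n k * gaussConst n d)) := by
        ring
    _ ≤ _ := by
        gcongr
        linarith

lemma tendsto_sqrt_pow_mul_exp (m : ℕ) {c : ℝ} (hc : 0 < c) (C : ℝ) :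
    Tendsto (fun τ : ℝ => √τ ^ m * (Real.exp (-(τ * c)) * C)) atTop (𝓝 0) := by
  have h1 := tendsto_rpow_mul_exp_neg_mul_atTop_nhds_zero ((m : ℝ) / 2) c hc
  have h2 := h1.mul_const C
  rw [zero_mul] at h2
  refine h2.congr' ?_
  filter_upwards [eventually_gt_atTop 0] with τ hτ
  have : √τ ^ m = τ ^ ((m : ℝ) / 2) := by
    rw [Real.sqrt_eq_rpow, ← Real.rpow_natCast, ← Real.rpow_mul hτ.le]
    ring_nf
  rw [this]
  ring_nf

/-- For fixed ρ the lower and upper bounds converge as τ → ∞, since outside the patch the height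
exceeds ρ²/2. Their limits approach `gaussConst` as ρ → 0. -/
lemma tendsto_laplace_mass (hkn : k ≤ n) {d : Fin k → ℝ} (hd : ∀ j, 1 ≤ d j) :
    Tendsto (fun τ : ℝ => ∫ X, √τ ^ stiefelDim n k * Real.exp (-(τ * height hkn d X))
      ∂stiefelMeasure n k) atTop (𝓝 (gaussConst n d)) := by
  have := isFiniteMeasure_stiefelMeasure hkn
  have hcont := continuous_height hkn d
  obtain ⟨Δ, hΔ0, hΔ⟩ : ∃ Δ : ℝ, 0 ≤ Δ ∧ ∀ j, d j ≤ Δ :=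
    ⟨∑ j, d j, Finset.sum_nonneg fun j _ => zero_le_one.trans (hd j), fun j =>
      Finset.single_le_sum (fun i _ => zero_le_one.trans (hd i)) (Finset.mem_univ j)⟩
  simp_rw [integral_const_mul]
  have hint : ∀ τ : ℝ, Integrable (fun X => Real.exp (-(τ * height hkn d X)))
      (stiefelMeasure n k) := fun τ => integrable_of_continuous hkn (by fun_prop)
  have hlo : ∀ ρ : ℝ, ∀ τ : ℝ, ∫ X in patch hkn ρ, Real.exp (-(τ * height hkn d X))
      ∂stiefelMeasure n k ≤ ∫ X, Real.exp (-(τ * height hkn d X)) ∂stiefelMeasure n k :=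
    fun ρ τ => setIntegral_le_integral (hint τ) (Eventually.of_forall fun X => by positivity)
  have hhi : ∀ ρ > 0, ∀ τ > 0, ∫ X, Real.exp (-(τ * height hkn d X)) ∂stiefelMeasure n k ≤
      ∫ X in patch hkn ρ, Real.exp (-(τ * height hkn d X)) ∂stiefelMeasure n k +
        Real.exp (-(τ * (ρ ^ 2 / 2))) * (stiefelMeasure n k).real Set.univ := by
    intro ρ hρ τ hτ
    rw [← integral_add_compl (measurableSet_patch hkn ρ) (hint τ)]
    gcongr
    calc ∫ X in (patch hkn ρ)ᶜ, Real.exp (-(τ * height hkn d X)) ∂stiefelMeasure n k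
        ≤ ∫ X in (patch hkn ρ)ᶜ, Real.exp (-(τ * (ρ ^ 2 / 2))) ∂stiefelMeasure n k := by
          refine integral_mono_ae (hint τ).integrableOn (integrable_const _) ?_
          have h1 : ∀ᵐ X ∂stiefelMeasure n k, X ∈ stiefel n k :=
            ae_restrict_mem measurableSet_stiefel
          filter_upwards [ae_restrict_of_ae h1,
            ae_restrict_mem (measurableSet_patch hkn ρ).compl] with X hX hXp
          gcongr
          have h2 : ρ < ‖X - base hkn‖ := by
            by_contra h
            exact hXp ⟨hX, by simpa [dist_eq_norm] using h⟩
          have h3 := norm_sq_le_two_mul_height hkn hd hX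
          have : ρ ^ 2 ≤ ‖X - base hkn‖ ^ 2 := by gcongr
          linarith
      _ ≤ ∫ X, Real.exp (-(τ * (ρ ^ 2 / 2))) ∂stiefelMeasure n k :=
          setIntegral_le_integral (integrable_const _) (Eventually.of_forall fun X => by positivity)
      _ = _ := by rw [integral_const, smul_eq_mul, mul_comm]
  have hρ : ∀ᶠ ρ in 𝓝[>] (0 : ℝ), 0 < ρ ∧ ρ ≤ 1 / 2 ∧ 4 * Δ * ρ < 1 := by
    have h1 : ∀ᶠ ρ in 𝓝 (0 : ℝ), ρ ≤ 1 / 2 := Iic_mem_nhds (by norm_num)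
    have h2 : ∀ᶠ ρ in 𝓝 (0 : ℝ), 4 * Δ * ρ < 1 := by
      refine (Continuous.tendsto (by fun_prop : Continuous fun ρ : ℝ => 4 * Δ * ρ) 0).eventually_lt_const ?_
      simp
    filter_upwards [self_mem_nhdsWithin, nhdsWithin_le_nhds h1, nhdsWithin_le_nhds h2] with ρ a b c
    exact ⟨a, b, c⟩
  rw [tendsto_order]
  constructor
  · intro a ha
    have h1 : Tendsto (fun ρ : ℝ => (√(1 + 4 * Δ * ρ))⁻¹ ^ stiefelDim n k * gaussConst n d)
        (𝓝[>] 0) (𝓝 (gaussConst n d)) := by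
      have : ContinuousAt (fun ρ : ℝ => (√(1 + 4 * Δ * ρ))⁻¹ ^ stiefelDim n k * gaussConst n d) 0 := by
        refine ContinuousAt.mul (ContinuousAt.pow (ContinuousAt.inv₀ (by fun_prop) ?_) _)
          continuousAt_const
        simp
      simpa using this.tendsto.mono_left nhdsWithin_le_nhds
    obtain ⟨ρ, ⟨h2, h3, -⟩, h4⟩ := (hρ.and (h1.eventually_const_lt ha)).exists
    obtain ⟨r, hr, h5⟩ := le_laplace_patch hkn hd hΔ hΔ0 h2 h3
    have h6 : Tendsto (fun τ : ℝ => (√(1 + 4 * Δ * ρ))⁻¹ ^ stiefelDim n k * gaussConst n d -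
      Real.exp (-(τ * r)) * (√2 ^ stiefelDim n k * gaussConst n d)) atTop
      (𝓝 ((√(1 + 4 * Δ * ρ))⁻¹ ^ stiefelDim n k * gaussConst n d - 0)) := by
      refine tendsto_const_nhds.sub ?_
      simpa using tendsto_sqrt_pow_mul_exp 0 hr (√2 ^ stiefelDim n k * gaussConst n d)
    rw [sub_zero] at h6
    filter_upwards [h6.eventually_const_lt h4, eventually_gt_atTop 0] with τ h7 hτ
    refine h7.trans_le ((h5 τ hτ).trans ?_)
    exact mul_le_mul_of_nonneg_left (hlo ρ τ) (by positivity)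
  · intro b hb
    have h1 : Tendsto (fun ρ : ℝ => (patchLip ρ : ℝ) ^ stiefelDim n k *
        ((√(1 - 4 * Δ * ρ))⁻¹ ^ stiefelDim n k * gaussConst n d))
        (𝓝[>] 0) (𝓝 (gaussConst n d)) := by
      simp_rw [coe_patchLip]
      have : ContinuousAt (fun ρ : ℝ => (√(1 - ρ ^ 2))⁻¹ ^ stiefelDim n k *
          ((√(1 - 4 * Δ * ρ))⁻¹ ^ stiefelDim n k * gaussConst n d)) 0 := by
        refine ContinuousAt.mul (ContinuousAt.pow (ContinuousAt.inv₀ (by fun_prop) ?_) _)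
          (ContinuousAt.mul (ContinuousAt.pow (ContinuousAt.inv₀ (by fun_prop) ?_) _)
          continuousAt_const)
        · simp
        · simp
      simpa using this.tendsto.mono_left nhdsWithin_le_nhds
    obtain ⟨ρ, ⟨h2, h3, h3'⟩, h4⟩ := (hρ.and (h1.eventually_lt_const hb)).exists
    have h6 := (tendsto_sqrt_pow_mul_exp (stiefelDim n k) (c := ρ ^ 2 / 2) (by positivity)
      ((stiefelMeasure n k).real Set.univ)).const_add ((patchLip ρ : ℝ) ^ stiefelDim n k *
        ((√(1 - 4 * Δ * ρ))⁻¹ ^ stiefelDim n k * gaussConst n d))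
    rw [add_zero] at h6
    filter_upwards [h6.eventually_lt_const h4, eventually_gt_atTop 0] with τ h7 hτ
    refine lt_of_le_of_lt ?_ h7
    refine (mul_le_mul_of_nonneg_left (hhi ρ h2 τ hτ) (by positivity)).trans ?_
    rw [mul_add]
    exact add_le_add_left (laplace_patch_le hkn hd hΔ hΔ0 h2 h3 h3' hτ) _

/-- Laplace's method at the base frame. -/
theorem tendsto_laplace (hkn : k ≤ n) {d : Fin k → ℝ} (hd : ∀ j, 1 ≤ d j)
    {a : MatSpace n k → ℂ} (ha : Continuous a) :
    Tendsto (fun τ : ℝ => (√τ : ℂ) ^ stiefelDim n k *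
      ∫ X, a X * Real.exp (-(τ * height hkn d X)) ∂stiefelMeasure n k) atTop
      (𝓝 (gaussConst n d * a (base hkn))) := by
  have := isFiniteMeasure_stiefelMeasure hkn
  have hcont := continuous_height hkn d
  have hG := gaussConst_pos (n := n) hd
  let φ : ℝ → MatSpace n k → ℝ := fun τ X =>
    (gaussConst n d)⁻¹ * (√τ ^ stiefelDim n k * Real.exp (-(τ * height hkn d X)))
  -- The normalized functions exp(-τ · height) form an approximate identity on the Stiefel manifold,
  -- concentrated at the base frame.
  have h := tendsto_setIntegral_peak_smul_of_integrableOn_of_tendsto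
    (μ := Measure.euclideanHausdorffMeasure (stiefelDim n k)) (s := stiefel n k)
    (t := stiefel n k) (x₀ := base hkn) (φ := φ) (l := atTop) (g := a) (a := a (base hkn))
    measurableSet_stiefel measurableSet_stiefel subset_rfl self_mem_nhdsWithin ?_ ?_ ?_ ?_ ?_ ?_ ?_
  · have h2 := h.const_mul (gaussConst n d : ℂ)
    refine h2.congr fun τ => ?_
    rw [← integral_const_mul, ← integral_const_mul, stiefelMeasure]
    congr 1
    ext X
    simp only [φ, Complex.real_smul]
    push_cast
    have : (gaussConst n d : ℂ) ≠ 0 := by exact_mod_cast hG.ne'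
    field_simp
  · have := measure_lt_top (stiefelMeasure n k) Set.univ
    rw [stiefelMeasure, Measure.restrict_apply_univ] at this
    exact this.ne
  · exact Eventually.of_forall fun τ X _ => by positivity
  · intro u hu hbu
    obtain ⟨ρ, hρ, hball⟩ := Metric.isOpen_iff.mp hu _ hbu
    rw [Metric.tendstoUniformlyOn_iff]
    intro ε hε
    have h1 := tendsto_sqrt_pow_mul_exp (stiefelDim n k) (c := ρ ^ 2 / 2) (by positivity)
      ((gaussConst n d)⁻¹)
    filter_upwards [h1.eventually_lt_const hε, eventually_gt_atTop 0] with τ h2 hτ X hX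
    have h0 : 0 ≤ φ τ X := by positivity
    rw [Pi.zero_apply, dist_zero_left, Real.norm_eq_abs, abs_of_nonneg h0]
    refine lt_of_le_of_lt ?_ h2
    simp only [φ]
    rw [mul_left_comm, mul_comm (gaussConst n d)⁻¹]
    have h3 : ρ ≤ ‖X - base hkn‖ := by
      by_contra h
      exact hX.2 (hball (by simpa [dist_eq_norm] using h))
    have h4 := norm_sq_le_two_mul_height hkn hd hX.1
    have : ρ ^ 2 ≤ ‖X - base hkn‖ ^ 2 := by gcongr
    gcongr
    linarith
  · have h1 := (tendsto_laplace_mass hkn hd).const_mul (gaussConst n d)⁻¹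
    rw [inv_mul_cancel₀ hG.ne'] at h1
    refine h1.congr fun τ => ?_
    rw [← integral_const_mul]
    rfl
  · refine Eventually.of_forall fun τ => Continuous.aestronglyMeasurable ?_
    fun_prop
  · exact integrable_of_continuous hkn ha.continuousOn
  · exact ha.continuousAt.tendsto.mono_left nhdsWithin_le_nhds

/-! ### Rotation fields and integration by parts -/

/-- The derivative of `a` along the vector field `X ↦ A X`. -/
def vf (A : Matrix (Fin n) (Fin n) ℝ) (a : MatSpace n k → ℂ) (X : MatSpace n k) : ℂ :=
  fderiv ℝ a X (biMul A 1 X)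

/-- The generator of the rotations in the plane of the coordinates `p` and `q`. -/
def rot (p q : Fin n) : Matrix (Fin n) (Fin n) ℝ := Matrix.single p q 1 - Matrix.single q p 1

lemma rot_transpose (p q : Fin n) : (rot p q)ᵀ = -rot p q := by
  simp [rot, Matrix.transpose_sub]

lemma rot_mul_rot_mul_rot {p q : Fin n} (h : p ≠ q) :
    rot p q * (rot p q * rot p q) = -rot p q := by
  simp [rot, Matrix.mul_sub, Matrix.sub_mul, Matrix.single_mul_single_of_ne, h, h.symm]
  abel

lemma rot_mul_apply (p q : Fin n) (M : Matrix (Fin n) (Fin k) ℝ) (i : Fin n) (j : Fin k) :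
    (rot p q * M) i j = (if i = p then M q j else 0) - if i = q then M p j else 0 := by
  simp only [rot, Matrix.sub_mul, Matrix.sub_apply]
  congr 1
  · by_cases h : i = p
    · subst h; simp
    · rw [Matrix.single_mul_apply_of_ne _ _ _ _ _ h, if_neg h]
  · by_cases h : i = q
    · subst h; simp
    · rw [Matrix.single_mul_apply_of_ne _ _ _ _ _ h, if_neg h]

/-- The rotation by the angle `t` generated by `A`, for `A` skew with `A³ = -A`. -/
def rotBy (A : Matrix (Fin n) (Fin n) ℝ) (t : ℝ) : Matrix (Fin n) (Fin n) ℝ :=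
  1 + Real.sin t • A + (1 - Real.cos t) • (A * A)

lemma rotBy_orthogonal {A : Matrix (Fin n) (Fin n) ℝ} (h1 : Aᵀ = -A) (h3 : A * (A * A) = -A)
    (t : ℝ) : (rotBy A t)ᵀ * rotBy A t = 1 := by
  have h4 : A * A * (A * A) = -(A * A) := by
    rw [Matrix.mul_assoc, h3, Matrix.mul_neg]
  have h3' : A * A * A = -A := by rw [Matrix.mul_assoc, h3]
  simp only [rotBy, Matrix.transpose_add, Matrix.transpose_smul, Matrix.transpose_mul, h1,
    Matrix.transpose_one, Matrix.add_mul, Matrix.mul_add, Matrix.smul_mul, Matrix.mul_smul,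
    Matrix.neg_mul, Matrix.mul_neg, h3, h4, h3', Matrix.one_mul, Matrix.mul_one, neg_neg, smul_neg]
  have hsc := Real.sin_sq_add_cos_sq t
  -- By A⁴ = -A² the product is I + xA² with x = 2(1 - cos t) - sin² t - (1 - cos t)² = 0.
  have e : ∀ (x : ℝ) , (x = 0) → 1 + x • (A * A) = 1 := by rintro _ rfl; simp
  refine Eq.trans ?_
    (e (2 * (1 - Real.cos t) - Real.sin t * Real.sin t - (1 - Real.cos t) * (1 - Real.cos t))
      (by nlinarith))
  module

lemma biMul_rotBy (A : Matrix (Fin n) (Fin n) ℝ) (t : ℝ) (X : MatSpace n k) :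
    biMul (rotBy A t) 1 X = X + Real.sin t • biMul A 1 X +
      (1 - Real.cos t) • biMul (A * A) 1 X := by
  apply toMat_injective
  simp [rotBy, Matrix.add_mul]

lemma continuous_biMul (U : Matrix (Fin n) (Fin n) ℝ) (V : Matrix (Fin k) (Fin k) ℝ) :
    Continuous (biMul U V) := LinearMap.continuous_of_finiteDimensional _

/-- The integral of F over the rotated frames `rotBy A t` X does not depend on t; differentiate
under the integral at t = 0. -/
lemma integral_vf_eq_zero (hkn : k ≤ n) {A : Matrix (Fin n) (Fin n) ℝ} (h1 : Aᵀ = -A)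
    (h3 : A * (A * A) = -A) {F : MatSpace n k → ℂ} (hF : ContDiff ℝ ∞ F) :
    ∫ X, vf A F X ∂stiefelMeasure n k = 0 := by
  have := isFiniteMeasure_stiefelMeasure hkn
  have hA := continuous_biMul (k := k) A 1
  have hAA := continuous_biMul (k := k) (A * A) 1
  let γ : ℝ → MatSpace n k → MatSpace n k := fun t X => X + Real.sin t • biMul A 1 X +
      (1 - Real.cos t) • biMul (A * A) 1 X
  let γ' : ℝ → MatSpace n k → MatSpace n k := fun t X => Real.cos t • biMul A 1 X +
      Real.sin t • biMul (A * A) 1 X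
  have hγ : ∀ X t, HasDerivAt (fun t => γ t X) (γ' t X) t := by
    intro X t
    have a1 := (Real.hasDerivAt_sin t).smul_const (biMul A 1 X)
    have a2 := ((Real.hasDerivAt_cos t).const_sub 1).smul_const (biMul (A * A) 1 X)
    have := (a1.const_add X).add a2
    rw [neg_neg] at this
    exact this
  have hF' : Continuous (fderiv ℝ F) := hF.continuous_fderiv (by simp)
  have hderiv : ∀ X t, HasDerivAt (fun t => F (γ t X)) (fderiv ℝ F (γ t X) (γ' t X)) t :=
    fun X t => ((hF.differentiable (by simp)).differentiableAt.hasFDerivAt).comp_hasDerivAt t (hγ X t)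
  have hγc : Continuous fun p : ℝ × MatSpace n k => γ p.1 p.2 := by
    simp only [γ]; fun_prop
  have hγ'c : Continuous fun p : ℝ × MatSpace n k => γ' p.1 p.2 := by
    simp only [γ']; fun_prop
  have hdc : Continuous fun p : ℝ × MatSpace n k => fderiv ℝ F (γ p.1 p.2) (γ' p.1 p.2) :=
    (hF'.comp hγc).clm_apply hγ'c
  obtain ⟨C, hC⟩ := ((isCompact_closedBall (0 : ℝ) 1).prod
    (isCompact_stiefel (n := n) (k := k))).exists_bound_of_continuousOn hdc.continuousOn
  have key := (hasDerivAt_integral_of_dominated_loc_of_deriv_le (μ := stiefelMeasure n k)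
    (F := fun t X => F (γ t X)) (F' := fun t X => fderiv ℝ F (γ t X) (γ' t X)) (x₀ := 0)
    (bound := fun _ => C) (Metric.ball_mem_nhds 0 one_pos) ?_ ?_ ?_ ?_ (integrable_const C) ?_).2
  · have hconst : (fun t => ∫ X, F (γ t X) ∂stiefelMeasure n k) =
        fun _ => ∫ X, F X ∂stiefelMeasure n k := by
      ext t
      rw [← integral_biMul (rotBy_orthogonal h1 h3 t) (by simp : (1 : Matrix (Fin k) (Fin k) ℝ) * 1ᵀ = 1) F]
      simp_rw [biMul_rotBy]
      rfl
    rw [hconst] at key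
    have h0 := key.unique (hasDerivAt_const 0 _)
    simpa [γ, γ', vf] using h0
  · exact Eventually.of_forall fun t =>
      (hF.continuous.comp (hγc.comp (by fun_prop : Continuous fun X => (t, X)))).aestronglyMeasurable
  · exact integrable_of_continuous hkn
      (hF.continuous.comp (hγc.comp (by fun_prop : Continuous fun X => ((0 : ℝ), X)))).continuousOn
  · exact (hdc.comp (by fun_prop : Continuous fun X => ((0 : ℝ), X))).aestronglyMeasurable
  · filter_upwards [(ae_restrict_mem measurableSet_stiefel :
      ∀ᵐ X ∂stiefelMeasure n k, X ∈ stiefel n k)] with X hX t ht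
    exact hC (t, X) ⟨Metric.ball_subset_closedBall ht, hX⟩
  · exact Eventually.of_forall fun X t _ => hderiv X t

/-- The phase `∑ w_j (1 - X_jj)`. -/
def phase (hkn : k ≤ n) (w : Fin k → ℂ) (X : MatSpace n k) : ℂ :=
  ∑ j, w j * (1 - (X (Fin.castLE hkn j, j) : ℂ))

/-- The oscillatory integral with amplitude `a`. -/
def osc (hkn : k ≤ n) (a : MatSpace n k → ℂ) (w : Fin k → ℂ) : ℂ :=
  ∫ X, a X * Complex.exp (Complex.I * phase hkn w X) ∂stiefelMeasure n k

/-- The matrix entry at `(i, j)` as a complex valued function. -/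
def ent (i : Fin n) (j : Fin k) (X : MatSpace n k) : ℂ := (X (i, j) : ℂ)

lemma contDiff_ent (i : Fin n) (j : Fin k) : ContDiff ℝ ∞ (ent i j) := by
  unfold ent
  exact Complex.ofRealCLM.contDiff.comp (by fun_prop)

lemma contDiff_phase (hkn : k ≤ n) (w : Fin k → ℂ) : ContDiff ℝ ∞ (phase hkn w) := by
  have h := fun j => contDiff_ent (Fin.castLE hkn j) j
  change ContDiff ℝ ∞ fun X => ∑ j, w j * (1 - ent (Fin.castLE hkn j) j X)
  fun_prop

lemma contDiff_vf (A : Matrix (Fin n) (Fin n) ℝ) {a : MatSpace n k → ℂ} (ha : ContDiff ℝ ∞ a) :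
    ContDiff ℝ ∞ (vf A a) := by
  unfold vf
  refine ContDiff.clm_apply (ha.fderiv_right (by simp)) ?_
  exact (LinearMap.toContinuousLinearMap (biMul A 1)).contDiff

lemma vf_mul (A : Matrix (Fin n) (Fin n) ℝ) {a b : MatSpace n k → ℂ} (ha : ContDiff ℝ ∞ a)
    (hb : ContDiff ℝ ∞ b) (X : MatSpace n k) :
    vf A (fun X => a X * b X) X = a X * vf A b X + b X * vf A a X := by
  unfold vf
  rw [fderiv_fun_mul (ha.differentiable (by simp)).differentiableAt
    (hb.differentiable (by simp)).differentiableAt]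
  simp

lemma vf_ent (A : Matrix (Fin n) (Fin n) ℝ) (i : Fin n) (j : Fin k) (X : MatSpace n k) :
    vf A (ent i j) X = ((A * toMat X) i j : ℝ) := by
  have h : HasFDerivAt (ent i j) (Complex.ofRealCLM.comp (EuclideanSpace.proj (𝕜 := ℝ) (i, j)))
      X := (Complex.ofRealCLM.comp (EuclideanSpace.proj (𝕜 := ℝ) (i, j))).hasFDerivAt
  rw [vf, h.fderiv]
  simp [← toMat_apply]

lemma vf_phase (hkn : k ≤ n) (A : Matrix (Fin n) (Fin n) ℝ) (w : Fin k → ℂ) (X : MatSpace n k) :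
    vf A (phase hkn w) X = -∑ j, w j * ((A * toMat X) (Fin.castLE hkn j) j : ℝ) := by
  have h : ∀ j, HasFDerivAt (ent (Fin.castLE hkn j) j)
      (Complex.ofRealCLM.comp (EuclideanSpace.proj (𝕜 := ℝ) (Fin.castLE hkn j, j))) X :=
    fun j => (Complex.ofRealCLM.comp
      (EuclideanSpace.proj (𝕜 := ℝ) (Fin.castLE hkn j, j))).hasFDerivAt
  have h2 : HasFDerivAt (phase hkn w) _ X :=
    HasFDerivAt.fun_sum (u := Finset.univ) fun j _ => ((h j).const_sub 1).const_mul (w j)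
  rw [vf, h2.fderiv]
  simp [← toMat_apply]

/-- Apply `integral_vf_eq_zero` to a·exp(iφ). The right side contains no power of the frequency,
although the phase derivative on the left is linear in w; this is where decay is gained. -/
lemma osc_mul_vf_phase (hkn : k ≤ n) {p q : Fin n} (hpq : p ≠ q) {a : MatSpace n k → ℂ}
    (ha : ContDiff ℝ ∞ a) (w : Fin k → ℂ) :
    osc hkn (fun X => vf (rot p q) (phase hkn w) X * a X) w =
      Complex.I * osc hkn (vf (rot p q) a) w := by
  have hφ := contDiff_phase hkn w
  have he : ContDiff ℝ ∞ fun X => Complex.exp (Complex.I * phase hkn w X) :=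
    Complex.contDiff_exp.comp (contDiff_const.mul hφ)
  have h0 := integral_vf_eq_zero hkn (rot_transpose p q) (rot_mul_rot_mul_rot hpq) (ha.mul he)
  have hexp : ∀ X, vf (rot p q) (fun X => Complex.exp (Complex.I * phase hkn w X)) X =
      Complex.exp (Complex.I * phase hkn w X) * (Complex.I * vf (rot p q) (phase hkn w) X) := by
    intro X
    have h1 : HasFDerivAt (fun X => Complex.I * phase hkn w X) _ X :=
      ((hφ.differentiable (by simp)).differentiableAt.hasFDerivAt (x := X)).const_mul Complex.I
    rw [vf, h1.cexp.fderiv, vf]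
    simp
  have h1 : ∀ X, vf (rot p q) (fun X => a X * Complex.exp (Complex.I * phase hkn w X)) X =
      Complex.I * (vf (rot p q) (phase hkn w) X * a X * Complex.exp (Complex.I * phase hkn w X)) +
        vf (rot p q) a X * Complex.exp (Complex.I * phase hkn w X) := by
    intro X
    rw [vf_mul _ ha he, hexp]
    ring
  have hv := contDiff_vf (rot p q) ha
  have hvφ := contDiff_vf (rot p q) hφ
  change ∫ X, vf (rot p q) (fun X => a X * Complex.exp (Complex.I * phase hkn w X)) X
    ∂stiefelMeasure n k = 0 at h0
  simp_rw [h1] at h0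
  rw [integral_add, integral_const_mul] at h0
  · simp only [osc]
    linear_combination (-Complex.I) * h0 +
      (∫ X, vf (rot p q) (phase hkn w) X * a X * Complex.exp (Complex.I * phase hkn w X)
        ∂stiefelMeasure n k) * Complex.I_mul_I
  · exact integrable_of_continuous hkn
      (contDiff_const.mul ((hvφ.mul ha).mul he)).continuous.continuousOn
  · exact integrable_of_continuous hkn (hv.mul he).continuous.continuousOn

lemma vf_rot_phase (hkn : k ≤ n) (w : Fin k → ℂ) {a b : Fin k} (X : MatSpace n k) :
    vf (rot (Fin.castLE hkn a) (Fin.castLE hkn b)) (phase hkn w) X =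
      w b * ent (Fin.castLE hkn a) b X - w a * ent (Fin.castLE hkn b) a X := by
  rw [vf_phase]
  simp only [rot_mul_apply, (Fin.castLE_injective hkn).eq_iff, Complex.ofReal_sub, mul_sub,
    Finset.sum_sub_distrib, apply_ite Complex.ofReal, Complex.ofReal_zero, mul_ite, mul_zero,
    Finset.sum_ite_eq', Finset.mem_univ, if_true, toMat_apply, ent]
  ring

lemma vf_rot_phase_of_le (hkn : k ≤ n) (w : Fin k → ℂ) {a : Fin k} {i : Fin n} (hi : k ≤ (i : ℕ))
    (X : MatSpace n k) :
    vf (rot (Fin.castLE hkn a) i) (phase hkn w) X = -(w a * ent i a X) := by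
  have h : ∀ x : Fin k, Fin.castLE hkn x ≠ i := fun x hx => by
    have := congrArg Fin.val hx
    simp at this
    omega
  rw [vf_phase]
  simp only [rot_mul_apply, (Fin.castLE_injective hkn).eq_iff, h, if_false, sub_zero,
    apply_ite Complex.ofReal, Complex.ofReal_zero, mul_ite, mul_zero,
    Finset.sum_ite_eq', Finset.mem_univ, if_true, toMat_apply, ent]

/-! ### The ideal generated by the derivatives of the phase -/

/-- Frequencies of size `R` in the closed upper half plane that are uniformly nondegenerate. -/
structure Adm (c : ℝ) (w : Fin k → ℂ) (R : ℝ) : Prop where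
  one_le : 1 ≤ R
  im_nonneg : ∀ j, 0 ≤ (w j).im
  lower : ∀ j, c * R ≤ ‖w j‖
  upper : ∀ j, c * ‖w j‖ ≤ R
  sub : ∀ i j, i ≠ j → c * R ≤ ‖w i - w j‖
  add : ∀ i j, i ≠ j → c * R ≤ ‖w i + w j‖

lemma Adm.pos {c : ℝ} {w : Fin k → ℂ} {R : ℝ} (h : Adm c w R) : 0 < R :=
  one_pos.trans_le h.one_le

/-- `Red hkn c d f`: on the Stiefel manifold, `f w` is a combination of first derivatives of the
phase along rotations, with smooth coefficients that do not depend on `w` and scalar factors that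
are `O(R ^ d)`. -/
inductive Red (hkn : k ≤ n) (c : ℝ) : ℤ → ((Fin k → ℂ) → MatSpace n k → ℂ) → Prop
  | zero (d : ℤ) : Red hkn c d fun _ _ => 0
  | gen (p q : Fin n) (hpq : p ≠ q) : Red hkn c 0 fun w X => vf (rot p q) (phase hkn w) X
  | add {d : ℤ} {f g : (Fin k → ℂ) → MatSpace n k → ℂ} (hf : Red hkn c d f)
      (hg : Red hkn c d g) : Red hkn c d fun w X => f w X + g w X
  | mul {d : ℤ} {f : (Fin k → ℂ) → MatSpace n k → ℂ} (b : MatSpace n k → ℂ)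
      (hb : ContDiff ℝ ∞ b) (hf : Red hkn c d f) : Red hkn c d fun w X => b X * f w X
  | coef {d e d' : ℤ} (hd : d + e = d') {f : (Fin k → ℂ) → MatSpace n k → ℂ}
      (κ : (Fin k → ℂ) → ℂ) (C : ℝ) (hκ : ∀ w R, Adm c w R → ‖κ w‖ ≤ C * R ^ e)
      (hf : Red hkn c d f) : Red hkn c d' fun w X => κ w * f w X
  | congr {d : ℤ} {f g : (Fin k → ℂ) → MatSpace n k → ℂ}
      (h : ∀ w R, Adm c w R → ∀ X ∈ stiefel n k, f w X = g w X) (hf : Red hkn c d f) :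
      Red hkn c d g

namespace Red

variable {hkn : k ≤ n} {c : ℝ}

lemma sum {ι : Type*} (s : Finset ι) {d : ℤ} {f : ι → (Fin k → ℂ) → MatSpace n k → ℂ}
    (h : ∀ i ∈ s, Red hkn c d (f i)) : Red hkn c d fun w X => ∑ i ∈ s, f i w X := by
  classical
  induction s using Finset.induction_on with
  | empty => simpa using Red.zero d
  | insert a s ha ih =>
    simp only [Finset.sum_insert ha]
    exact (h a (Finset.mem_insert_self _ _)).add (ih fun i hi => h i (Finset.mem_insert_of_mem hi))

lemma neg {d : ℤ} {f : (Fin k → ℂ) → MatSpace n k → ℂ} (h : Red hkn c d f) :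
    Red hkn c d fun w X => -f w X := by
  simpa using h.mul (fun _ => -1) contDiff_const

lemma continuousOn {d : ℤ} {f : (Fin k → ℂ) → MatSpace n k → ℂ} (h : Red hkn c d f)
    {w : Fin k → ℂ} {R : ℝ} (hw : Adm c w R) : ContinuousOn (f w) (stiefel n k) := by
  induction h with
  | zero d => exact continuousOn_const
  | gen p q hpq => exact (contDiff_vf _ (contDiff_phase hkn w)).continuous.continuousOn
  | add hf hg ihf ihg => exact ihf.add ihg
  | mul b hb hf ih => exact hb.continuous.continuousOn.mul ih
  | coef hd κ C hκ hf ih => exact continuousOn_const.mul ih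
  | congr h hf ih => exact ih.congr fun X hX => (h w R hw X hX).symm

lemma mul_freq (hc : 0 < c) {d : ℤ} {f : (Fin k → ℂ) → MatSpace n k → ℂ} (h : Red hkn c d f)
    (j : Fin k) : Red hkn c (d + 1) fun w X => w j * f w X := by
  refine h.coef rfl (fun w => w j) c⁻¹ fun w R hw => ?_
  rw [zpow_one, inv_mul_eq_div, le_div_iff₀ hc, mul_comm]
  exact hw.upper j

end Red

lemma continuous_cexp_phase (hkn : k ≤ n) (w : Fin k → ℂ) :
    Continuous fun X => Complex.exp (Complex.I * phase hkn w X) := by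
  have := (contDiff_phase hkn w).continuous
  fun_prop

lemma osc_congr (hkn : k ≤ n) {a b : MatSpace n k → ℂ} (h : ∀ X ∈ stiefel n k, a X = b X)
    (w : Fin k → ℂ) : osc hkn a w = osc hkn b w := by
  refine setIntegral_congr_fun measurableSet_stiefel fun X hX => ?_
  simp only [h X hX]

lemma osc_add (hkn : k ≤ n) {a b : MatSpace n k → ℂ} (ha : ContinuousOn a (stiefel n k))
    (hb : ContinuousOn b (stiefel n k)) (w : Fin k → ℂ) :
    osc hkn (fun X => a X + b X) w = osc hkn a w + osc hkn b w := by
  simp only [osc, add_mul]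
  have he := (continuous_cexp_phase hkn w).continuousOn (s := stiefel n k)
  exact integral_add (integrable_of_continuous hkn (ha.mul he))
    (integrable_of_continuous hkn (hb.mul he))

lemma osc_sum (hkn : k ≤ n) {ι : Type*} (s : Finset ι) {a : ι → MatSpace n k → ℂ}
    (ha : ∀ i ∈ s, ContinuousOn (a i) (stiefel n k)) (w : Fin k → ℂ) :
    osc hkn (fun X => ∑ i ∈ s, a i X) w = ∑ i ∈ s, osc hkn (a i) w := by
  simp only [osc, Finset.sum_mul]
  have he := (continuous_cexp_phase hkn w).continuousOn (s := stiefel n k)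
  exact integral_finsetSum _ fun i hi => integrable_of_continuous hkn ((ha i hi).mul he)

lemma osc_const_mul (hkn : k ≤ n) (z : ℂ) (a : MatSpace n k → ℂ) (w : Fin k → ℂ) :
    osc hkn (fun X => z * a X) w = z * osc hkn a w := by
  simp only [osc, mul_assoc, integral_const_mul]

/-- Integration by parts: multiplying an amplitude by an element of the ideal gains a power of
`R`. -/
lemma Red.bound {hkn : k ≤ n} {c : ℝ} {T T' : (MatSpace n k → ℂ) → Prop}
    (hT : ∀ b, T b → ContDiff ℝ ∞ b)
    (hmul : ∀ g b, ContDiff ℝ ∞ g → T b → T fun X => g X * b X)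
    (hvf : ∀ p q b, T b → T' (vf (rot p q) b)) {F : (Fin k → ℂ) → ℝ → ℝ}
    (hT' : ∀ b, T' b → ∃ C, ∀ w R, Adm c w R → ‖osc hkn b w‖ ≤ C * F w R)
    {d : ℤ} {f : (Fin k → ℂ) → MatSpace n k → ℂ} (h : Red hkn c d f) :
    ∀ b, T b → ∃ C, ∀ w R, Adm c w R →
      ‖osc hkn (fun X => f w X * b X) w‖ ≤ C * (R ^ d * F w R) := by
  induction h with
  | zero d =>
    refine fun b _ => ⟨0, fun w R hw => ?_⟩
    simp [osc]
  | gen p q hpq =>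
    intro b hb
    obtain ⟨C, hC⟩ := hT' _ (hvf p q b hb)
    refine ⟨C, fun w R hw => ?_⟩
    -- A generator is traded for one derivative of the amplitude at no cost in R, which is why
    -- generators have degree 0 in `Red`.
    rw [osc_mul_vf_phase hkn hpq (hT b hb)]
    simpa using hC w R hw
  | @add d f g hf hg ihf ihg =>
    intro b hb
    obtain ⟨C, hC⟩ := ihf b hb
    obtain ⟨C', hC'⟩ := ihg b hb
    refine ⟨C + C', fun w R hw => ?_⟩
    have hbc := (hT b hb).continuous.continuousOn (s := stiefel n k)
    simp only [add_mul]
    rw [osc_add hkn (a := fun X => f w X * b X) (b := fun X => g w X * b X)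
      ((hf.continuousOn hw).mul hbc) ((hg.continuousOn hw).mul hbc)]
    exact (norm_add_le _ _).trans (add_le_add (hC w R hw) (hC' w R hw))
  | mul g hg hf ih =>
    intro b hb
    obtain ⟨C, hC⟩ := ih _ (hmul g b hg hb)
    refine ⟨C, fun w R hw => ?_⟩
    refine le_of_eq_of_le ?_ (hC w R hw)
    congr 2
    ext X
    ring
  | @coef d e d' hd f κ C hκ hf ih =>
    intro b hb
    obtain ⟨C', hC'⟩ := ih b hb
    refine ⟨C * C', fun w R hw => ?_⟩
    simp only [mul_assoc]
    rw [osc_const_mul, norm_mul, ← hd, zpow_add₀ hw.pos.ne']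
    refine (mul_le_mul (hκ w R hw) (hC' w R hw) (norm_nonneg _)
      ((norm_nonneg _).trans (hκ w R hw))).trans (le_of_eq ?_)
    ring
  | congr h hf ih =>
    intro b hb
    obtain ⟨C, hC⟩ := ih b hb
    refine ⟨C, fun w R hw => ?_⟩
    refine le_of_eq_of_le ?_ (hC w R hw)
    congr 1
    exact osc_congr hkn (fun X hX => by rw [h w R hw X hX]) w

/-- These are the entries of the matrix G = WYᵗ - YW in `commutator_identity`, Y being the upper
square block and W = diag(w). -/
lemma red_skew (hkn : k ≤ n) (c : ℝ) (a b : Fin k) : Red hkn c 0 fun w X =>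
    w a * ent (Fin.castLE hkn b) a X - w b * ent (Fin.castLE hkn a) b X := by
  by_cases h : b = a
  · subst h
    simpa using Red.zero 0
  · refine (Red.gen (Fin.castLE hkn b) (Fin.castLE hkn a)
      fun h' => h (Fin.castLE_injective hkn h')).congr fun w R _ X _ => ?_
    rw [vf_rot_phase]

lemma red_lower (hkn : k ≤ n) (c : ℝ) (a : Fin k) {i : Fin n} (hi : k ≤ (i : ℕ)) :
    Red hkn c 0 fun w X => w a * ent i a X := by
  refine (Red.gen (Fin.castLE hkn a) i ?_).neg.congr fun w R _ X _ => ?_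
  · intro h
    have := congrArg Fin.val h
    simp at this
    omega
  · rw [vf_rot_phase_of_le hkn w hi, neg_neg]

/-- Rows from the `k`-th on. -/
def lowerRows (n k : ℕ) : Finset (Fin n) := Finset.univ.filter fun i => k ≤ (i : ℕ)

lemma sum_rows {M : Type*} [AddCommMonoid M] (hkn : k ≤ n) (f : Fin n → M) :
    ∑ i, f i = ∑ a, f (Fin.castLE hkn a) + ∑ i ∈ lowerRows n k, f i := by
  rw [← sum_dite_lt hkn, lowerRows, Finset.sum_filter, ← Finset.sum_add_distrib]
  refine Finset.sum_congr rfl fun i _ => ?_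
  by_cases h : (i : ℕ) < k
  · simp [h, h.not_ge]
  · simp [h, not_lt.mp h]

/-- Since W² = N + PP' and P' = P - G, the cubic terms P³ cancel in the commutator of P with W².
What is left is linear in N and G, whose entries lie in the ideal of phase derivatives. -/
lemma commutator_identity {S : Type*} [Ring S] (W Y Y' P P' N G : S) (hP : P = W * Y')
    (hP' : P' = Y * W) (hN : N = W * (1 - Y' * Y) * W) (hG : G = P - P') :
    P * (W * W) - W * W * P = P * N - P * (P * G) - N * P + P * (G * P) := by
  have h : W * W = N + P * P' := by rw [hN, hP, hP']; noncomm_ring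
  rw [h, hG]
  noncomm_ring

/-- Entry (p, q) of `commutator_identity` for W = diag(w) and Y the upper square block of X.
Orthonormality of the columns turns I - YᵗY into the Gram matrix of the rows from the k-th on, so
every summand on the right contains a phase derivative. -/
lemma ent_mul_eq (hkn : k ≤ n) {X : MatSpace n k} (hX : X ∈ stiefel n k) (w : Fin k → ℂ)
    (p q : Fin k) :
    w p * (w q ^ 2 - w p ^ 2) * ent (Fin.castLE hkn q) p X =
      ∑ a, w p * (ent (Fin.castLE hkn a) p X *
          ∑ i ∈ lowerRows n k, w q * (ent i q X * (w a * ent i a X))) -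
        ∑ a, w p * (ent (Fin.castLE hkn a) p X * ∑ b, w a * (ent (Fin.castLE hkn b) a X *
          (w b * ent (Fin.castLE hkn q) b X - w q * ent (Fin.castLE hkn b) q X))) -
        ∑ a, w a * (ent (Fin.castLE hkn q) a X *
          ∑ i ∈ lowerRows n k, w a * (ent i a X * (w p * ent i p X))) +
        ∑ a, w p * (ent (Fin.castLE hkn a) p X * ∑ b, w b * (ent (Fin.castLE hkn q) b X *
          (w a * ent (Fin.castLE hkn b) a X - w b * ent (Fin.castLE hkn a) b X))) := by
  let Y : Matrix (Fin k) (Fin k) ℂ := Matrix.of fun p q => ent (Fin.castLE hkn p) q X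
  let W : Matrix (Fin k) (Fin k) ℂ := Matrix.diagonal w
  let N : Matrix (Fin k) (Fin k) ℂ := Matrix.of fun a b =>
    ∑ i ∈ lowerRows n k, w b * (ent i b X * (w a * ent i a X))
  have hN : N = W * (1 - Yᵀ * Y) * W := by
    ext a b
    have h1 : ∑ i, ent i a X * ent i b X = if a = b then 1 else 0 := by
      have := congrFun (congrFun hX a) b
      simp only [Matrix.mul_apply, Matrix.transpose_apply, toMat_apply, Matrix.one_apply] at this
      have h2 := congrArg Complex.ofReal this
      simpa [ent, apply_ite Complex.ofReal] using h2
    rw [sum_rows hkn] at h1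
    rw [Matrix.mul_diagonal, Matrix.diagonal_mul, Matrix.sub_apply, Matrix.mul_apply,
      Matrix.one_apply]
    simp only [N, Y, Matrix.of_apply, Matrix.transpose_apply]
    rw [← h1, add_sub_cancel_left, Finset.mul_sum, Finset.sum_mul]
    exact Finset.sum_congr rfl fun i _ => by ring
  have key := congrFun (congrFun (commutator_identity W Y Yᵀ (W * Yᵀ) (Y * W) N
    (W * Yᵀ - Y * W) rfl rfl hN rfl) p) q
  have hP : ∀ a b, (W * Yᵀ) a b = w a * ent (Fin.castLE hkn b) a X := fun a b => by
    simp [W, Y, Matrix.diagonal_mul]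
  have hG : ∀ a b, (W * Yᵀ - Y * W) a b =
      w a * ent (Fin.castLE hkn b) a X - w b * ent (Fin.castLE hkn a) b X := fun a b => by
    simp [W, Y, Matrix.diagonal_mul, Matrix.mul_diagonal, mul_comm]
  have hN' : ∀ a b, N a b = ∑ i ∈ lowerRows n k, w b * (ent i b X * (w a * ent i a X)) :=
    fun a b => rfl
  have hWW : W * W = Matrix.diagonal fun j => w j * w j := Matrix.diagonal_mul_diagonal w w
  rw [hWW] at key
  clear_value N
  generalize W * Yᵀ - Y * W = G at hG key
  generalize W * Yᵀ = P at hP key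
  rw [Matrix.sub_apply, Matrix.mul_diagonal, Matrix.diagonal_mul, Matrix.add_apply,
    Matrix.sub_apply, Matrix.sub_apply] at key
  simp only [Matrix.mul_apply, hP, hG, hN'] at key
  refine Eq.trans ?_ (key.trans ?_)
  · ring
  · congr 1
    · congr 1
      · congr 1
        · exact Finset.sum_congr rfl fun a _ => by ring
        · exact Finset.sum_congr rfl fun a _ => by simp only [mul_assoc]
      · exact Finset.sum_congr rfl fun a _ => by ring
    · refine Finset.sum_congr rfl fun a _ => ?_
      rw [mul_assoc]
      congr 2
      exact Finset.sum_congr rfl fun b _ => by ring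

/-- Off-diagonal matrix entries lie in the ideal generated by the derivatives of the phase. -/
lemma red_offDiag (hkn : k ≤ n) {c : ℝ} (hc : 0 < c) {i : Fin n} {j : Fin k}
    (hij : i ≠ Fin.castLE hkn j) : Red hkn c (-1) fun _ X => ent i j X := by
  have hinv : ∀ w : Fin k → ℂ, ∀ R, Adm c w R → w j ≠ 0 := fun w R hw h => by
    have := hw.lower j
    rw [h, norm_zero] at this
    nlinarith [hw.pos]
  rcases le_or_gt k (i : ℕ) with hi | hi
  · refine ((red_lower hkn c j hi).coef (e := -1) (d' := -1) rfl (fun w => (w j)⁻¹) c⁻¹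
      fun w R hw => ?_).congr fun w R hw X _ => ?_
    · have := hw.pos
      rw [norm_inv, _root_.zpow_neg_one, ← mul_inv]
      exact inv_anti₀ (by positivity) (hw.lower j)
    · rw [← mul_assoc, inv_mul_cancel₀ (hinv w R hw), one_mul]
  · obtain ⟨q, rfl⟩ : ∃ q, i = Fin.castLE hkn q := ⟨⟨i, hi⟩, by ext; simp⟩
    have hqj : q ≠ j := fun h => hij (by rw [h])
    have hN : ∀ a b, Red hkn c 1 fun w X =>
        ∑ i ∈ lowerRows n k, w b * (ent i b X * (w a * ent i a X)) := fun a b =>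
      Red.sum _ fun i hi => (((red_lower hkn c a (by simpa [lowerRows] using hi)).mul _
        (contDiff_ent i b)).mul_freq hc b)
    have e1 : Red hkn c 2 fun w X => ∑ a, w j * (ent (Fin.castLE hkn a) j X *
          ∑ i ∈ lowerRows n k, w q * (ent i q X * (w a * ent i a X))) :=
      Red.sum _ fun a _ => ((hN a q).mul _ (contDiff_ent _ _)).mul_freq hc j
    have e2 : Red hkn c 2 fun w X => ∑ a, w j * (ent (Fin.castLE hkn a) j X * ∑ b, w a *
          (ent (Fin.castLE hkn b) a X *
          (w b * ent (Fin.castLE hkn q) b X - w q * ent (Fin.castLE hkn b) q X))) :=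
      Red.sum _ fun a _ => ((Red.sum _ fun b _ => ((red_skew hkn c b q).mul _
        (contDiff_ent _ _)).mul_freq hc a).mul _ (contDiff_ent _ _)).mul_freq hc j
    have e3 : Red hkn c 2 fun w X => ∑ a, w a * (ent (Fin.castLE hkn q) a X *
          ∑ i ∈ lowerRows n k, w a * (ent i a X * (w j * ent i j X))) :=
      Red.sum _ fun a _ => ((hN j a).mul _ (contDiff_ent _ _)).mul_freq hc a
    have e4 : Red hkn c 2 fun w X => ∑ a, w j * (ent (Fin.castLE hkn a) j X * ∑ b, w b *
          (ent (Fin.castLE hkn q) b X *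
          (w a * ent (Fin.castLE hkn b) a X - w b * ent (Fin.castLE hkn a) b X))) :=
      Red.sum _ fun a _ => ((Red.sum _ fun b _ => ((red_skew hkn c a b).mul _
        (contDiff_ent _ _)).mul_freq hc b).mul _ (contDiff_ent _ _)).mul_freq hc j
    -- The four sums have degree 2, and dividing by w_j (w_q² - w_j²), of size at least c³R³, brings
    -- the degree to -1. Nonvanishing and separation of the w_j² are used exactly here.
    refine (((e1.add e2.neg).add e3.neg).add e4).coef (e := -3) (d' := -1) rfl
      (fun w => (w j * (w q ^ 2 - w j ^ 2))⁻¹) (c ^ 3)⁻¹ (fun w R hw => ?_)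
      |>.congr fun w R hw X hX => ?_
    · have hR := hw.pos
      rw [norm_inv, norm_mul, sq_sub_sq, norm_mul, _root_.zpow_neg, ← mul_inv]
      refine inv_anti₀ (by positivity) ?_
      calc c ^ 3 * R ^ (3 : ℤ) = (c * R) * ((c * R) * (c * R)) := by
            norm_cast; ring
        _ ≤ _ := by
            have := hw.lower j
            have := hw.add q j hqj
            have := hw.sub q j hqj
            gcongr
    · have h1 := ent_mul_eq hkn hX w j q
      have h2 : w j * (w q ^ 2 - w j ^ 2) ≠ 0 := by
        have hR := hw.pos
        have h3 := hw.add q j hqj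
        have h4 := hw.sub q j hqj
        have h5 : 0 < c * R := by positivity
        rw [sq_sub_sq]
        exact mul_ne_zero (hinv w R hw) (mul_ne_zero (norm_pos_iff.mp (h5.trans_le h3))
          (norm_pos_iff.mp (h5.trans_le h4)))
      rw [inv_mul_eq_iff_eq_mul₀ h2, h1]
      ring

/-! ### Hadamard's lemma -/

lemma hasFDerivAt_integral_param {V W : Type} [NormedAddCommGroup V] [NormedSpace ℝ V]
    [FiniteDimensional ℝ V] [NormedAddCommGroup W] [NormedSpace ℝ W]
    {f : ℝ × V → W} (hf : ContDiff ℝ 1 f) (x : V) :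
    HasFDerivAt (fun x => ∫ t in (0 : ℝ)..1, f (t, x))
      (∫ t in (0 : ℝ)..1, (fderiv ℝ f (t, x)).comp (ContinuousLinearMap.inr ℝ ℝ V)) x := by
  have hd : Continuous fun p : ℝ × V => (fderiv ℝ f p).comp (ContinuousLinearMap.inr ℝ ℝ V) :=
    (hf.continuous_fderiv one_ne_zero).clm_comp continuous_const
  obtain ⟨C, hC⟩ := ((isCompact_Icc (a := (0 : ℝ)) (b := 1)).prod
    (isCompact_closedBall x 1)).exists_bound_of_continuousOn hd.continuousOn
  refine intervalIntegral.hasFDerivAt_integral_of_dominated_of_fderiv_le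
    (F := fun x t => f (t, x)) (bound := fun _ => C)
    (F' := fun x t => (fderiv ℝ f (t, x)).comp (ContinuousLinearMap.inr ℝ ℝ V))
    (Metric.ball_mem_nhds x one_pos) ?_ ?_ ?_ ?_ ?_ ?_
  · exact Eventually.of_forall fun y =>
      (hf.continuous.comp (by fun_prop : Continuous fun t : ℝ => (t, y))).aestronglyMeasurable
  · exact (hf.continuous.comp (by fun_prop : Continuous fun t : ℝ => (t, x))).intervalIntegrable _ _
  · exact (hd.comp (by fun_prop : Continuous fun t : ℝ => (t, x))).aestronglyMeasurable
  · refine Eventually.of_forall fun t ht y hy => hC (t, y) ⟨?_, Metric.ball_subset_closedBall hy⟩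
    rw [Set.uIoc_of_le zero_le_one] at ht
    exact Set.Ioc_subset_Icc_self ht
  · exact intervalIntegrable_const
  · refine Eventually.of_forall fun t _ y _ => ?_
    have h1 := ((hf.differentiable one_ne_zero).differentiableAt (x := (t, y))).hasFDerivAt
    exact h1.comp y (hasFDerivAt_prodMk_right t y)

/-- The derivative is again an integral of the same form with values in a space of linear maps, so
the target space has to vary in the induction. -/
lemma contDiff_integral_param_nat {V : Type} [NormedAddCommGroup V] [NormedSpace ℝ V]
    [FiniteDimensional ℝ V] (m : ℕ) : ∀ {W : Type} [NormedAddCommGroup W] [NormedSpace ℝ W]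
    {f : ℝ × V → W}, ContDiff ℝ ∞ f → ContDiff ℝ m (fun x => ∫ t in (0 : ℝ)..1, f (t, x)) := by
  induction m with
  | zero =>
    intro W _ _ f hf
    rw [Nat.cast_zero, contDiff_zero, continuous_iff_continuousAt]
    exact fun x => (hasFDerivAt_integral_param (hf.of_le (by simp)) x).continuousAt
  | succ m ih =>
    intro W _ _ f hf
    rw [Nat.cast_add, Nat.cast_one, contDiff_succ_iff_hasFDerivAt]
    refine ⟨_, ?_, fun x => hasFDerivAt_integral_param (hf.of_le (by simp)) x⟩
    exact ih ((hf.fderiv_right (by simp)).clm_comp contDiff_const)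

lemma contDiff_integral_param {V W : Type} [NormedAddCommGroup V] [NormedSpace ℝ V]
    [FiniteDimensional ℝ V] [NormedAddCommGroup W] [NormedSpace ℝ W]
    {f : ℝ × V → W} (hf : ContDiff ℝ ∞ f) :
    ContDiff ℝ ∞ (fun x => ∫ t in (0 : ℝ)..1, f (t, x)) :=
  contDiff_infty.mpr fun m => contDiff_integral_param_nat m hf

/-- Integrate the derivative of a along the segment from E to X. The segment leaves the Stiefel
manifold, which is harmless because amplitudes are smooth on the whole matrix space. -/
lemma exists_hadamard {a : MatSpace n k → ℂ} (ha : ContDiff ℝ ∞ a) (E : MatSpace n k) :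
    ∃ b : Fin n → Fin k → MatSpace n k → ℂ, (∀ i j, ContDiff ℝ ∞ (b i j)) ∧
      ∀ X, a X - a E = ∑ i, ∑ j, ((X (i, j) : ℂ) - (E (i, j) : ℂ)) * b i j X := by
  let f : ℝ × MatSpace n k → MatSpace n k →L[ℝ] ℂ := fun p => fderiv ℝ a (E + p.1 • (p.2 - E))
  have hf : ContDiff ℝ ∞ f := (ha.fderiv_right (m := ∞) (by simp)).comp (by fun_prop)
  let B : MatSpace n k → MatSpace n k →L[ℝ] ℂ := fun X => ∫ t in (0 : ℝ)..1, f (t, X)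
  have hB : ContDiff ℝ ∞ B := contDiff_integral_param hf
  refine ⟨fun i j X => B X (EuclideanSpace.single (i, j) 1), fun i j =>
    hB.clm_apply contDiff_const, fun X => ?_⟩
  have h1 : a X - a E = B X (X - E) := by
    have hder : ∀ t : ℝ, HasDerivAt (fun t : ℝ => a (E + t • (X - E))) (f (t, X) (X - E)) t := by
      intro t
      have h2 : HasDerivAt (fun t : ℝ => E + t • (X - E)) (X - E) t := by
        simpa using ((hasDerivAt_id t).smul_const (X - E)).const_add E
      exact ((ha.differentiable (by simp)).differentiableAt.hasFDerivAt).comp_hasDerivAt t h2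
    have hcont : Continuous fun t : ℝ => f (t, X) :=
      hf.continuous.comp (by fun_prop)
    have h3 := intervalIntegral.integral_eq_sub_of_hasDerivAt (a := 0) (b := 1)
      (fun t _ => hder t) ((hcont.clm_apply continuous_const).intervalIntegrable _ _)
    simp only [one_smul, zero_smul, add_zero, add_sub_cancel] at h3
    rw [← h3]
    exact (ContinuousLinearMap.intervalIntegral_apply (μ := volume)
      (hcont.intervalIntegrable 0 1) (X - E)).symm
  have h4 : X - E = ∑ p : Fin n × Fin k, (X - E) p • EuclideanSpace.single p (1 : ℝ) := by
    ext q
    simp [Pi.single_apply]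
  rw [h1]
  conv_lhs => rw [h4]
  rw [map_sum, Fintype.sum_prod_type]
  refine Finset.sum_congr rfl fun i _ => Finset.sum_congr rfl fun j _ => ?_
  rw [map_smul, Complex.real_smul]
  simp

/-! ### Amplitudes -/

/-- Generators of the ideal of functions vanishing at the critical frames `[diag(±1); 0]`. -/
def critGen (hkn : k ≤ n) (i : Fin n) (j : Fin k) (X : MatSpace n k) : ℂ :=
  if i = Fin.castLE hkn j then ent i j X ^ 2 - 1 else ent i j X

lemma contDiff_critGen (hkn : k ≤ n) (i : Fin n) (j : Fin k) : ContDiff ℝ ∞ (critGen hkn i j) := by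
  have := contDiff_ent i j
  unfold critGen
  split_ifs
  · fun_prop
  · exact this

/-- The sum of the squares of the generators. -/
def defect (hkn : k ≤ n) (X : MatSpace n k) : ℂ := ∑ i, ∑ j, critGen hkn i j X ^ 2

lemma contDiff_defect (hkn : k ≤ n) : ContDiff ℝ ∞ (defect (n := n) hkn) := by
  have := fun i j => contDiff_critGen hkn i j
  unfold defect
  fun_prop

/-- A frame `[diag(±1); 0]`. -/
def IsCrit (hkn : k ≤ n) (X : MatSpace n k) : Prop := defect hkn X = 0

lemma isCrit_iff (hkn : k ≤ n) (X : MatSpace n k) : IsCrit hkn X ↔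
    ∀ i j, if i = Fin.castLE hkn j then X (i, j) = 1 ∨ X (i, j) = -1 else X (i, j) = 0 := by
  let g : Fin n → Fin k → ℝ := fun i j =>
    if i = Fin.castLE hkn j then X (i, j) ^ 2 - 1 else X (i, j)
  have h1 : ∀ i j, critGen hkn i j X = (g i j : ℂ) := by
    intro i j
    simp only [critGen, g, ent]
    split_ifs <;> push_cast <;> rfl
  have h2 : defect hkn X = ((∑ i, ∑ j, g i j ^ 2 : ℝ) : ℂ) := by
    simp [defect, h1]
  rw [IsCrit, h2, Complex.ofReal_eq_zero, Finset.sum_eq_zero_iff_of_nonneg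
    fun i _ => Finset.sum_nonneg fun j _ => sq_nonneg _]
  simp only [Finset.mem_univ, forall_const]
  refine forall_congr' fun i => ?_
  rw [Finset.sum_eq_zero_iff_of_nonneg fun j _ => sq_nonneg _]
  simp only [Finset.mem_univ, forall_const]
  refine forall_congr' fun j => ?_
  simp only [g, sq_eq_zero_iff]
  split_ifs
  · rw [sub_eq_zero, sq_eq_one_iff]
  · rfl

/-- Smooth amplitudes that vanish near all critical frames. -/
def Off (hkn : k ≤ n) (b : MatSpace n k → ℂ) : Prop :=
  ContDiff ℝ ∞ b ∧ ∀ X, IsCrit hkn X → b =ᶠ[𝓝 X] 0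

/-- Smooth amplitudes that vanish near all critical frames but the base frame. -/
def Amp (hkn : k ≤ n) (b : MatSpace n k → ℂ) : Prop :=
  ContDiff ℝ ∞ b ∧ ∀ X, IsCrit hkn X → X ≠ base hkn → b =ᶠ[𝓝 X] 0

lemma eventuallyEq_mul_zero {X : MatSpace n k} {b : MatSpace n k → ℂ} (h : b =ᶠ[𝓝 X] 0)
    (g : MatSpace n k → ℂ) : (fun X => g X * b X) =ᶠ[𝓝 X] 0 := by
  filter_upwards [h] with Y hY
  simp [hY]

lemma eventuallyEq_vf_zero {X : MatSpace n k} {b : MatSpace n k → ℂ} (h : b =ᶠ[𝓝 X] 0)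
    (A : Matrix (Fin n) (Fin n) ℝ) : vf A b =ᶠ[𝓝 X] 0 := by
  filter_upwards [h.fderiv (𝕜 := ℝ)] with Y hY
  simp [vf, hY]

lemma Off.mul {hkn : k ≤ n} {b : MatSpace n k → ℂ} (g : MatSpace n k → ℂ) (hg : ContDiff ℝ ∞ g)
    (hb : Off hkn b) : Off hkn fun X => g X * b X :=
  ⟨hg.mul hb.1, fun X hX => eventuallyEq_mul_zero (hb.2 X hX) g⟩

lemma Amp.mul {hkn : k ≤ n} {b : MatSpace n k → ℂ} (g : MatSpace n k → ℂ) (hg : ContDiff ℝ ∞ g)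
    (hb : Amp hkn b) : Amp hkn fun X => g X * b X :=
  ⟨hg.mul hb.1, fun X hX hE => eventuallyEq_mul_zero (hb.2 X hX hE) g⟩

lemma Off.vf {hkn : k ≤ n} {b : MatSpace n k → ℂ} (A : Matrix (Fin n) (Fin n) ℝ)
    (hb : Off hkn b) : Off hkn (vf A b) :=
  ⟨contDiff_vf A hb.1, fun X hX => eventuallyEq_vf_zero (hb.2 X hX) A⟩

lemma Amp.vf {hkn : k ≤ n} {b : MatSpace n k → ℂ} (A : Matrix (Fin n) (Fin n) ℝ)
    (hb : Amp hkn b) : Amp hkn (vf A b) :=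
  ⟨contDiff_vf A hb.1, fun X hX hE => eventuallyEq_vf_zero (hb.2 X hX hE) A⟩

lemma Off.amp {hkn : k ≤ n} {b : MatSpace n k → ℂ} (hb : Off hkn b) : Amp hkn b :=
  ⟨hb.1, fun X hX _ => hb.2 X hX⟩

lemma Amp.add {hkn : k ≤ n} {a b : MatSpace n k → ℂ} (ha : Amp hkn a) (hb : Amp hkn b) :
    Amp hkn fun X => a X + b X := by
  refine ⟨ha.1.add hb.1, fun X hX hE => ?_⟩
  filter_upwards [ha.2 X hX hE, hb.2 X hX hE] with Y h1 h2
  simp [h1, h2]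

lemma contDiff_div_of_eventuallyEq_zero {b g : MatSpace n k → ℂ} (hb : ContDiff ℝ ∞ b)
    (hg : ContDiff ℝ ∞ g) (h : ∀ X, g X = 0 → b =ᶠ[𝓝 X] 0) :
    ContDiff ℝ ∞ fun X => b X / g X := by
  rw [contDiff_iff_contDiffAt]
  intro X
  by_cases hX : g X = 0
  · refine (contDiffAt_const (c := (0 : ℂ))).congr_of_eventuallyEq ?_
    filter_upwards [h X hX] with Y hY
    simp [hY]
  · simp only [div_eq_mul_inv]
    exact hb.contDiffAt.mul (hg.contDiffAt.inv hX)

/-- Division by the sum of squares of the generators is smooth, because b vanishes near every zero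
of `defect`. -/
lemma Off.exists_decomp {hkn : k ≤ n} {b : MatSpace n k → ℂ} (hb : Off hkn b) :
    ∃ g : Fin n → Fin k → MatSpace n k → ℂ, (∀ i j, Off hkn (g i j)) ∧
      ∀ X, b X = ∑ i, ∑ j, critGen hkn i j X * g i j X := by
  have h1 : Off hkn fun X => b X / defect hkn X := by
    refine ⟨contDiff_div_of_eventuallyEq_zero hb.1 (contDiff_defect hkn) hb.2, fun X hX => ?_⟩
    filter_upwards [hb.2 X hX] with Y hY
    simp [hY]
  refine ⟨fun i j X => critGen hkn i j X * (b X / defect hkn X),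
    fun i j => h1.mul _ (contDiff_critGen hkn i j), fun X => ?_⟩
  simp only [← mul_assoc, ← sq, ← Finset.sum_mul]
  change b X = defect hkn X * (b X / defect hkn X)
  by_cases hX : defect hkn X = 0
  · have : b X = 0 := (hb.2 X hX).self_of_nhds
    simp [this]
  · rw [mul_div_cancel₀ _ hX]

/-- The diagonal case follows from the off-diagonal one, since X_jj² - 1 = -∑_{i ≠ j} X_ij² on the
Stiefel manifold. -/
lemma red_critGen (hkn : k ≤ n) {c : ℝ} (hc : 0 < c) (i : Fin n) (j : Fin k) :
    Red hkn c (-1) fun _ X => critGen hkn i j X := by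
  by_cases h : i = Fin.castLE hkn j
  · refine (Red.sum (Finset.univ.erase (Fin.castLE hkn j)) fun i' hi' =>
      (red_offDiag hkn hc (Finset.ne_of_mem_erase hi')).mul _ (contDiff_ent i' j)).neg.congr
      fun w R _ X hX => ?_
    have h1 : ∑ i', ent i' j X * ent i' j X = 1 := by
      have := sum_sq_col hX j
      simp only [ent, ← sq]
      exact_mod_cast this
    rw [← Finset.sum_erase_add _ _ (Finset.mem_univ (Fin.castLE hkn j))] at h1
    simp only [critGen, h, if_true]
    linear_combination -h1
  · simpa only [critGen, h, if_false] using red_offDiag hkn hc h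

/-- The common induction step of all the decay estimates: coefficients in the class `T` are
differentiated once into `T'`, and a factor 1/R is gained. The bound `F` stays abstract, so that it
can be a power of R or a comparison with the reference integral. -/
lemma exists_bound_of_decomp {hkn : k ≤ n} {c : ℝ} (hc : 0 < c) {T T' : (MatSpace n k → ℂ) → Prop}
    (hT : ∀ b, T b → ContDiff ℝ ∞ b)
    (hmul : ∀ g b, ContDiff ℝ ∞ g → T b → T fun X => g X * b X)
    (hvf : ∀ p q b, T b → T' (vf (rot p q) b)) {F : (Fin k → ℂ) → ℝ → ℝ}
    (hT' : ∀ b, T' b → ∃ C, ∀ w R, Adm c w R → ‖osc hkn b w‖ ≤ C * F w R)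
    {b : MatSpace n k → ℂ} {g : Fin n → Fin k → MatSpace n k → ℂ} (hg : ∀ i j, T (g i j))
    (hb : ∀ X, b X = ∑ i, ∑ j, critGen hkn i j X * g i j X) :
    ∃ C, ∀ w R, Adm c w R → ‖osc hkn b w‖ ≤ C * (R ^ (-1 : ℤ) * F w R) := by
  choose C hC using fun i j =>
    (red_critGen hkn hc i j).bound hT hmul hvf hT' (g i j) (hg i j)
  refine ⟨∑ i, ∑ j, C i j, fun w R hw => ?_⟩
  have hcont : ∀ i j, Continuous fun X => critGen hkn i j X * g i j X := fun i j =>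
    (contDiff_critGen hkn i j).continuous.mul (hT _ (hg i j)).continuous
  have h1 : osc hkn b w = ∑ i, ∑ j, osc hkn (fun X => critGen hkn i j X * g i j X) w := by
    rw [osc_congr hkn (fun X _ => hb X), osc_sum]
    · refine Finset.sum_congr rfl fun i _ => osc_sum _ _ (fun j _ => (hcont i j).continuousOn) _
    · exact fun i _ => (continuous_finsetSum _ fun j _ => hcont i j).continuousOn
  rw [h1, Finset.sum_mul]
  refine (norm_sum_le _ _).trans (Finset.sum_le_sum fun i _ => ?_)
  rw [Finset.sum_mul]
  exact (norm_sum_le _ _).trans (Finset.sum_le_sum fun j _ => hC i j w R hw)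

lemma ent_diag_le_one {X : MatSpace n k} (hX : X ∈ stiefel n k) (i : Fin n) (j : Fin k) :
    X (i, j) ≤ 1 := by
  have h1 := sum_sq_col hX j
  have h2 := Finset.single_le_sum (f := fun i => X (i, j) ^ 2) (fun i _ => sq_nonneg _)
    (Finset.mem_univ i)
  simp only [h1] at h2
  nlinarith

/-- The real part of the exponent is -∑ Im(w_j)(1 - X_jj), and X_jj ≤ 1 on the Stiefel manifold. -/
lemma norm_cexp_phase_le (hkn : k ≤ n) {w : Fin k → ℂ} (hw : ∀ j, 0 ≤ (w j).im)
    {X : MatSpace n k} (hX : X ∈ stiefel n k) :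
    ‖Complex.exp (Complex.I * phase hkn w X)‖ ≤ 1 := by
  rw [Complex.norm_exp, Real.exp_le_one_iff]
  have : (Complex.I * phase hkn w X).re =
      -∑ j, (w j).im * (1 - X (Fin.castLE hkn j, j)) := by
    simp [phase, Complex.mul_im]
  rw [this, neg_nonpos]
  exact Finset.sum_nonneg fun j _ => mul_nonneg (hw j)
    (sub_nonneg.mpr (ent_diag_le_one hX _ _))

lemma norm_osc_le (hkn : k ≤ n) {w : Fin k → ℂ} (hw : ∀ j, 0 ≤ (w j).im) {b : MatSpace n k → ℂ}
    (hb : Continuous b) : ‖osc hkn b w‖ ≤ ∫ X, ‖b X‖ ∂stiefelMeasure n k := by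
  refine norm_integral_le_of_norm_le (integrable_of_continuous hkn hb.norm.continuousOn) ?_
  filter_upwards [(ae_restrict_mem measurableSet_stiefel :
      ∀ᵐ X ∂stiefelMeasure n k, X ∈ stiefel n k)] with X hX
  rw [norm_mul]
  exact mul_le_of_le_one_right (norm_nonneg _) (norm_cexp_phase_le hkn hw hX)

/-- Away from the critical frames, the oscillatory integral decays rapidly. -/
theorem Off.osc_bound {hkn : k ≤ n} {c : ℝ} (hc : 0 < c) (N : ℕ) :
    ∀ b, Off hkn b → ∃ C, ∀ w R, Adm c w R → ‖osc hkn b w‖ ≤ C * R ^ (-(N : ℤ)) := by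
  induction N with
  | zero =>
    refine fun b hb => ⟨∫ X, ‖b X‖ ∂stiefelMeasure n k, fun w R hw => ?_⟩
    simpa using norm_osc_le hkn hw.im_nonneg hb.1.continuous
  | succ N ih =>
    intro b hb
    obtain ⟨g, hg, hbg⟩ := hb.exists_decomp
    obtain ⟨C, hC⟩ := exists_bound_of_decomp hc (T := Off hkn) (T' := Off hkn) (fun b hb => hb.1)
      (fun g b hg hb => hb.mul g hg) (fun p q b hb => hb.vf _)
      (F := fun _ R => R ^ (-(N : ℤ))) ih hg hbg
    refine ⟨C, fun w R hw => (hC w R hw).trans (le_of_eq ?_)⟩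
    rw [← zpow_add₀ hw.pos.ne']
    congr 2
    push_cast
    ring

/-! ### Cutoffs and decay relative to a reference integral -/

/-- A smooth cutoff at the base frame. -/
def bump (hkn : k ≤ n) : ContDiffBump (base hkn) := ⟨1 / 4, 1 / 2, by norm_num, by norm_num⟩

/-- A smooth cutoff at the base frame, as an amplitude. -/
def chi (hkn : k ≤ n) (X : MatSpace n k) : ℂ := (bump hkn X : ℝ)

lemma contDiff_chi (hkn : k ≤ n) : ContDiff ℝ ∞ (chi (n := n) hkn) :=
  Complex.ofRealCLM.contDiff.comp (bump hkn).contDiff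

lemma chi_eventuallyEq_one (hkn : k ≤ n) : chi hkn =ᶠ[𝓝 (base hkn)] 1 := by
  filter_upwards [(bump hkn).eventuallyEq_one] with X hX
  simp [chi, hX]

@[simp] lemma chi_base (hkn : k ≤ n) : chi hkn (base hkn) = 1 :=
  (chi_eventuallyEq_one hkn).self_of_nhds

lemma chi_eventuallyEq_zero (hkn : k ≤ n) {X : MatSpace n k} (hX : 1 / 2 < ‖X - base hkn‖) :
    chi hkn =ᶠ[𝓝 X] 0 := by
  have h1 : ∀ᶠ Y in 𝓝 X, 1 / 2 < ‖Y - base hkn‖ :=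
    (Continuous.tendsto (by fun_prop : Continuous fun Y => ‖Y - base hkn‖) X).eventually_const_lt hX
  filter_upwards [h1] with Y hY
  have : bump hkn Y = 0 := (bump hkn).zero_of_le_dist (by
    rw [dist_eq_norm]; exact hY.le)
  simp [chi, this]

lemma abs_sub_base_le (hkn : k ≤ n) (X : MatSpace n k) (i : Fin n) (j : Fin k) :
    |X (i, j) - base hkn (i, j)| ≤ ‖X - base hkn‖ := by
  simpa using PiLp.norm_apply_le (X - base hkn) (i, j)

/-- A diagonal entry -1 puts X at distance at least 2 from the base frame, beyond the outer radius
1/2 of the cutoff. -/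
lemma chi_eventuallyEq_zero_of_diag (hkn : k ≤ n) {X : MatSpace n k} {j : Fin k}
    (hX : X (Fin.castLE hkn j, j) = -1) : chi hkn =ᶠ[𝓝 X] 0 := by
  refine chi_eventuallyEq_zero hkn (lt_of_lt_of_le ?_ (abs_sub_base_le hkn X (Fin.castLE hkn j) j))
  rw [hX, base_diag]
  norm_num

lemma IsCrit.exists_diag {hkn : k ≤ n} {X : MatSpace n k} (hX : IsCrit hkn X)
    (hE : X ≠ base hkn) : ∃ j, X (Fin.castLE hkn j, j) = -1 := by
  rw [isCrit_iff] at hX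
  by_contra! h
  refine hE ?_
  ext ⟨i, j⟩
  have h1 := hX i j
  rw [base_apply]
  split_ifs at h1 ⊢ with h2
  · subst h2
    exact h1.resolve_right (h j)
  · exact h1

lemma amp_chi (hkn : k ≤ n) : Amp (n := n) hkn (chi hkn) := by
  refine ⟨contDiff_chi hkn, fun X hX hE => ?_⟩
  obtain ⟨j, hj⟩ := hX.exists_diag hE
  exact chi_eventuallyEq_zero_of_diag hkn hj

lemma Amp.sub_off {hkn : k ≤ n} {a : MatSpace n k → ℂ} (ha : Amp hkn a) :
    Off hkn fun X => (1 - chi hkn X) * a X := by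
  refine ⟨(contDiff_const.sub (contDiff_chi hkn)).mul ha.1, fun X hX => ?_⟩
  by_cases hE : X = base hkn
  · subst hE
    filter_upwards [chi_eventuallyEq_one hkn] with Y hY
    simp [hY]
  · exact eventuallyEq_mul_zero (ha.2 X hX hE) _

/-- The cutoff divided by `1 + X_jj`. -/
def chiDiv (hkn : k ≤ n) (j : Fin k) (X : MatSpace n k) : ℂ :=
  chi hkn X / (1 + ent (Fin.castLE hkn j) j X)

lemma eq_neg_one_of_one_add_ent {i : Fin n} {j : Fin k} {X : MatSpace n k}
    (h : 1 + ent i j X = 0) : X (i, j) = -1 := by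
  have h1 : (X (i, j) : ℂ) = ((-1 : ℝ) : ℂ) := by
    push_cast
    simp only [ent] at h
    linear_combination h
  exact Complex.ofReal_injective h1

lemma chiDiv_mul (hkn : k ≤ n) (j : Fin k) (X : MatSpace n k) :
    chiDiv hkn j X * (1 + ent (Fin.castLE hkn j) j X) = chi hkn X := by
  by_cases h : 1 + ent (Fin.castLE hkn j) j X = 0
  · rw [h, mul_zero]
    exact ((chi_eventuallyEq_zero_of_diag hkn (eq_neg_one_of_one_add_ent h)).self_of_nhds).symm
  · rw [chiDiv, div_mul_cancel₀ _ h]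

lemma amp_chiDiv (hkn : k ≤ n) (j : Fin k) : Amp hkn (chiDiv (n := n) hkn j) := by
  refine ⟨contDiff_div_of_eventuallyEq_zero (contDiff_chi hkn)
    (contDiff_const.add (contDiff_ent _ _)) fun X hX =>
      chi_eventuallyEq_zero_of_diag hkn (eq_neg_one_of_one_add_ent hX), fun X hX hE => ?_⟩
  filter_upwards [(amp_chi hkn).2 X hX hE] with Y hY
  simp [chiDiv, hY]

/-- Away from the base frame `Off.exists_decomp` applies. Near it, Hadamard's lemma expresses a
through the entries of X - E; on the diagonal X_jj - 1 = (X_jj² - 1)/(1 + X_jj), whose denominator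
`chiDiv` absorbs. -/
lemma Amp.exists_decomp {hkn : k ≤ n} {a : MatSpace n k → ℂ} (ha : Amp hkn a)
    (h0 : a (base hkn) = 0) :
    ∃ g : Fin n → Fin k → MatSpace n k → ℂ, (∀ i j, Amp hkn (g i j)) ∧
      ∀ X, a X = ∑ i, ∑ j, critGen hkn i j X * g i j X := by
  obtain ⟨g, hg, hag⟩ := ha.sub_off.exists_decomp
  obtain ⟨b, hb, hab⟩ := exists_hadamard ha.1 (base hkn)
  let u : Fin n → Fin k → MatSpace n k → ℂ := fun i j X =>
    if i = Fin.castLE hkn j then chiDiv hkn j X else chi hkn X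
  have hu : ∀ i j, Amp hkn (u i j) := by
    intro i j
    by_cases h : i = Fin.castLE hkn j
    · simpa only [u, h, if_true] using amp_chiDiv hkn j
    · simpa only [u, h, if_false] using amp_chi hkn
  refine ⟨fun i j X => g i j X + b i j X * u i j X,
    fun i j => (hg i j).amp.add ((hu i j).mul _ (hb i j)), fun X => ?_⟩
  have h1 : a X = (1 - chi hkn X) * a X + chi hkn X * (a X - a (base hkn)) := by
    rw [h0]; ring
  rw [h1, hag, hab, Finset.mul_sum, ← Finset.sum_add_distrib]
  refine Finset.sum_congr rfl fun i _ => ?_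
  rw [Finset.mul_sum, ← Finset.sum_add_distrib]
  refine Finset.sum_congr rfl fun j _ => ?_
  rw [mul_add]
  congr 1
  by_cases h : i = Fin.castLE hkn j
  · subst h
    simp only [u, critGen, if_true, base_diag]
    rw [← chiDiv_mul hkn j X, ent]
    push_cast
    ring
  · simp only [u, critGen, h, if_false, base_off hkn h, ent]
    push_cast
    ring

/-- The size `|osc χ| + R⁻ᴺ` of the reference integral. -/
def refSize (hkn : k ≤ n) (N : ℕ) (w : Fin k → ℂ) (R : ℝ) : ℝ :=
  ‖osc hkn (chi hkn) w‖ + R ^ (-(N : ℤ))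

lemma Amp.sub_chi {hkn : k ≤ n} {a : MatSpace n k → ℂ} (ha : Amp hkn a) :
    Amp hkn fun X => a X + -a (base hkn) * chi hkn X :=
  ha.add ((amp_chi hkn).mul (fun _ => -a (base hkn)) contDiff_const)

/-- Write a = a(E)χ + (a - a(E)χ). The second part vanishes at E and gains 1/R over the bound for
the previous N, which upgrades `refSize` from N to N + 1. No prior knowledge of the true size of osc
χ is needed. -/
theorem Amp.osc_bound {hkn : k ≤ n} {c : ℝ} (hc : 0 < c) (N : ℕ) :
    ∀ a, Amp hkn a → ∃ C, ∀ w R, Adm c w R → ‖osc hkn a w‖ ≤ C * refSize hkn N w R := by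
  induction N with
  | zero =>
    refine fun b hb => ⟨∫ X, ‖b X‖ ∂stiefelMeasure n k, fun w R hw => ?_⟩
    refine (norm_osc_le hkn hw.im_nonneg hb.1.continuous).trans ?_
    refine le_mul_of_one_le_right (integral_nonneg fun X => norm_nonneg _) ?_
    simp [refSize]
  | succ N ih =>
    intro a ha
    obtain ⟨g, hg, hag⟩ := ha.sub_chi.exists_decomp (by simp)
    obtain ⟨C, hC⟩ := exists_bound_of_decomp hc (T := Amp hkn) (T' := Amp hkn) (fun b hb => hb.1)
      (fun g b hg hb => hb.mul g hg) (fun p q b hb => hb.vf _) ih hg hag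
    refine ⟨|C| + ‖a (base hkn)‖, fun w R hw => ?_⟩
    have h1 := hC w R hw
    have h2 : osc hkn a w = osc hkn (fun X => a X + -a (base hkn) * chi hkn X) w +
        a (base hkn) * osc hkn (chi hkn) w := by
      rw [osc_add hkn ha.1.continuous.continuousOn
        (contDiff_const.mul (contDiff_chi hkn)).continuous.continuousOn, osc_const_mul]
      ring
    have hR := hw.pos
    -- The factor 1/R improves the remainder from R^(-N) to R^(-(N+1)) and, as R ≥ 1, does not
    -- enlarge the term ‖osc χ‖.
    have h3 : R ^ (-1 : ℤ) * refSize hkn N w R ≤ refSize hkn (N + 1) w R := by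
      rw [refSize, refSize, mul_add, ← zpow_add₀ hR.ne']
      have h4 : R ^ (-1 : ℤ) ≤ 1 := zpow_le_one_of_nonpos₀ hw.one_le (by norm_num)
      have h5 : (-1 : ℤ) + -(N : ℤ) = -((N + 1 : ℕ) : ℤ) := by push_cast; ring
      rw [h5]
      gcongr
      exact mul_le_of_le_one_left (norm_nonneg _) h4
    have h4 : 0 ≤ R ^ (-1 : ℤ) * refSize hkn N w R := by
      unfold refSize; positivity
    rw [h2]
    refine (norm_add_le _ _).trans ?_
    rw [add_mul, norm_mul]
    refine add_le_add (h1.trans ?_) ?_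
    · exact (mul_le_mul_of_nonneg_right (le_abs_self C) h4).trans
        (mul_le_mul_of_nonneg_left h3 (abs_nonneg C))
    · gcongr
      rw [refSize]
      exact le_add_of_nonneg_right (by positivity)

/-- Amplitudes that vanish at the base frame gain a factor `R⁻¹`. -/
theorem Amp.osc_bound_of_eq_zero {hkn : k ≤ n} {c : ℝ} (hc : 0 < c) (N : ℕ)
    {a : MatSpace n k → ℂ} (ha : Amp hkn a) (h0 : a (base hkn) = 0) :
    ∃ C, ∀ w R, Adm c w R → ‖osc hkn a w‖ ≤ C * (R ^ (-1 : ℤ) * refSize hkn N w R) := by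
  obtain ⟨g, hg, hag⟩ := ha.exists_decomp h0
  exact exists_bound_of_decomp hc (T := Amp hkn) (T' := Amp hkn) (fun b hb => hb.1)
      (fun g b hg hb => hb.mul g hg) (fun p q b hb => hb.vf _) (Amp.osc_bound hc N) hg hag

/-- Amplitudes that vanish to second order at the base frame. -/
def Amp2 (hkn : k ≤ n) (b : MatSpace n k → ℂ) : Prop :=
  Amp hkn b ∧ b (base hkn) = 0 ∧ fderiv ℝ b (base hkn) = 0

lemma Amp2.of_mul {hkn : k ≤ n} {a b : MatSpace n k → ℂ} (ha : ContDiff ℝ ∞ a) (hb : Amp hkn b)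
    (ha0 : a (base hkn) = 0) (hb0 : b (base hkn) = 0) : Amp2 hkn fun X => a X * b X := by
  refine ⟨hb.mul a ha, by simp [ha0], ?_⟩
  rw [fderiv_fun_mul (ha.differentiable (by simp)).differentiableAt
    (hb.1.differentiable (by simp)).differentiableAt]
  ext v
  simp [ha0, hb0]

lemma Amp2.mul {hkn : k ≤ n} {b : MatSpace n k → ℂ} (g : MatSpace n k → ℂ) (hg : ContDiff ℝ ∞ g)
    (hb : Amp2 hkn b) : Amp2 hkn fun X => g X * b X := by
  refine ⟨hb.1.mul g hg, by simp [hb.2.1], ?_⟩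
  rw [fderiv_fun_mul (hg.differentiable (by simp)).differentiableAt
    (hb.1.1.differentiable (by simp)).differentiableAt]
  ext v
  simp [hb.2.1, hb.2.2]

/-- Amplitudes of third order that are divisible by an off-diagonal entry gain a factor `R⁻²`. -/
theorem Amp2.osc_bound {hkn : k ≤ n} {c : ℝ} (hc : 0 < c) (N : ℕ) {i : Fin n} {j : Fin k}
    (hij : i ≠ Fin.castLE hkn j) {b : MatSpace n k → ℂ} (hb : Amp2 hkn b) :
    ∃ C, ∀ w R, Adm c w R → ‖osc hkn (fun X => ent i j X * b X) w‖ ≤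
      C * (R ^ (-1 : ℤ) * (R ^ (-1 : ℤ) * refSize hkn N w R)) :=
  -- The off-diagonal entry pays for one integration by parts. The differentiated amplitude still
  -- vanishes at E, which gives the second factor 1/R.
  (red_offDiag hkn hc hij).bound (T := Amp2 hkn)
    (T' := fun b => Amp hkn b ∧ b (base hkn) = 0)
    (fun b hb => hb.1.1) (fun g b hg hb => hb.mul g hg)
    (fun p q b hb => ⟨hb.1.vf _, by simp [vf, hb.2.2]⟩)
    (fun b hb => hb.1.osc_bound_of_eq_zero hc N hb.2) b hb

/-! ### Second moments at the base frame -/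

/-- Extension of a vector by zero. -/
def ext0 {R : Type*} [Zero R] (n : ℕ) (w : Fin k → R) (i : Fin n) : R :=
  if h : (i : ℕ) < k then w ⟨i, h⟩ else 0

@[simp] lemma ext0_castLE {R : Type*} [Zero R] (hkn : k ≤ n) (w : Fin k → R) (j : Fin k) :
    ext0 n w (Fin.castLE hkn j) = w j := by
  simp [ext0]

lemma ext0_of_le {R : Type*} [Zero R] (w : Fin k → R) {i : Fin n} (hi : k ≤ (i : ℕ)) :
    ext0 n w i = 0 := by
  simp [ext0, hi.not_gt]

lemma exists_eq_castLE (hkn : k ≤ n) {i : Fin n} (hi : (i : ℕ) < k) :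
    ∃ q, i = Fin.castLE hkn q := ⟨⟨i, hi⟩, by ext; simp⟩

lemma Adm.le_norm_ext0_add {c : ℝ} {w : Fin k → ℂ} {R : ℝ} (hkn : k ≤ n) (hw : Adm c w R)
    {i : Fin n} {j : Fin k} (hij : i ≠ Fin.castLE hkn j) : c * R ≤ ‖ext0 n w i + w j‖ := by
  rcases le_or_gt k (i : ℕ) with hi | hi
  · simpa [ext0_of_le w hi] using hw.lower j
  · obtain ⟨q, rfl⟩ := exists_eq_castLE hkn hi
    simpa using hw.add q j fun h => hij (by rw [h])

lemma Amp2.add {hkn : k ≤ n} {a b : MatSpace n k → ℂ} (ha : Amp2 hkn a) (hb : Amp2 hkn b) :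
    Amp2 hkn fun X => a X + b X := by
  refine ⟨ha.1.add hb.1, by simp [ha.2.1, hb.2.1], ?_⟩
  rw [fderiv_fun_add (ha.1.1.differentiable (by simp)).differentiableAt
    (hb.1.1.differentiable (by simp)).differentiableAt, ha.2.2, hb.2.2, add_zero]

lemma Amp2.zero (hkn : k ≤ n) : Amp2 (n := n) hkn fun _ => 0 :=
  ⟨⟨contDiff_const, fun _ _ _ => EventuallyEq.rfl⟩, rfl, by simp⟩

lemma Amp2.sum {hkn : k ≤ n} {ι : Type*} (s : Finset ι) {a : ι → MatSpace n k → ℂ}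
    (ha : ∀ i ∈ s, Amp2 hkn (a i)) : Amp2 hkn fun X => ∑ i ∈ s, a i X := by
  classical
  induction s using Finset.induction_on with
  | empty => simpa using Amp2.zero hkn
  | insert i s hi ih =>
    simp only [Finset.sum_insert hi]
    exact (ha i (Finset.mem_insert_self _ _)).add
      (ih fun j hj => ha j (Finset.mem_insert_of_mem hj))

lemma ent_base (hkn : k ≤ n) {i : Fin n} {j : Fin k} (h : i ≠ Fin.castLE hkn j) :
    ent i j (base hkn) = 0 := by
  simp [ent, base_off hkn h]

lemma amp_ent_mul_chi (hkn : k ≤ n) (i : Fin n) (j : Fin k) :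
    Amp hkn fun X => ent i j X * chi hkn X :=
  (amp_chi hkn).mul _ (contDiff_ent i j)

lemma vf_ent_mul_chi_base (hkn : k ≤ n) (A : Matrix (Fin n) (Fin n) ℝ) {i : Fin n} {j : Fin k}
    (h : i ≠ Fin.castLE hkn j) : vf A (fun X => ent i j X * chi hkn X) (base hkn) =
      ((A * toMat (base hkn)) i j : ℝ) := by
  rw [vf_mul A (contDiff_ent i j) (contDiff_chi hkn), ent_base hkn h, vf_ent]
  simp

/-- The symmetric sum `X_qj + X_jq` is quadratic at the base frame. -/
lemma ent_add_ent (hkn : k ≤ n) {X : MatSpace n k} (hX : X ∈ stiefel n k) {q j : Fin k}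
    (hqj : q ≠ j) :
    ent (Fin.castLE hkn q) j X + ent (Fin.castLE hkn j) q X =
      (1 - ent (Fin.castLE hkn q) q X) * ent (Fin.castLE hkn q) j X +
      (1 - ent (Fin.castLE hkn j) j X) * ent (Fin.castLE hkn j) q X +
      ∑ i ∈ (Finset.univ.erase (Fin.castLE hkn q)).erase (Fin.castLE hkn j),
        (-ent i q X) * ent i j X := by
  have h1 : ∑ i, ent i q X * ent i j X = 0 := by
    have := sum_mul_col hX hqj
    simp only [ent]
    exact_mod_cast this
  have hne : Fin.castLE hkn j ≠ Fin.castLE hkn q := fun h => hqj (Fin.castLE_injective hkn h).symm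
  rw [← Finset.sum_erase_add _ _ (Finset.mem_univ (Fin.castLE hkn q)),
    ← Finset.sum_erase_add _ _ (Finset.mem_erase.mpr ⟨hne, Finset.mem_univ _⟩)] at h1
  simp only [neg_mul, Finset.sum_neg_distrib]
  linear_combination h1

lemma amp2_symmetric_sum (hkn : k ≤ n) {q j : Fin k} (hqj : q ≠ j) : Amp2 hkn fun X =>
    ((1 - ent (Fin.castLE hkn q) q X) * ent (Fin.castLE hkn q) j X +
      (1 - ent (Fin.castLE hkn j) j X) * ent (Fin.castLE hkn j) q X +
      ∑ i ∈ (Finset.univ.erase (Fin.castLE hkn q)).erase (Fin.castLE hkn j),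
        (-ent i q X) * ent i j X) * chi hkn X := by
  have hne : Fin.castLE hkn j ≠ Fin.castLE hkn q := fun h => hqj (Fin.castLE_injective hkn h).symm
  have hd : ∀ a : Fin k, ent (Fin.castLE hkn a) a (base hkn) = 1 := fun a => by simp [ent]
  have h0 : ∀ {i : Fin n} {a : Fin k}, i ≠ Fin.castLE hkn a →
      ent i a (base hkn) * chi hkn (base hkn) = 0 := fun h => by simp [ent_base hkn h]
  simp only [add_mul, Finset.sum_mul, mul_assoc]
  refine ((Amp2.of_mul (contDiff_const.sub (contDiff_ent _ _)) (amp_ent_mul_chi hkn _ _)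
    (by simp [hd]) (h0 hne.symm)).add (Amp2.of_mul (contDiff_const.sub (contDiff_ent _ _))
    (amp_ent_mul_chi hkn _ _) (by simp [hd]) (h0 hne))).add (Amp2.sum _ fun i hi =>
      Amp2.of_mul (contDiff_ent _ _).neg (amp_ent_mul_chi hkn _ _) ?_ (h0 ?_))
  · simp only [Finset.mem_erase] at hi
    simp [ent_base hkn hi.2.1]
  · simp only [Finset.mem_erase] at hi
    exact hi.1

/-- Integrate by parts along the rotation of the planes i and j. For i ≥ k the phase derivative is
∓w_j X_ij. For i = q < k it is w_j X_qj - w_q X_jq, and since X_jq = -X_qj up to quadratic terms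
(`ent_add_ent`), it equals (w_q + w_j)X_qj minus an error w_q S. Differentiating the remaining X_ij
χ gives ±1 at E. -/
lemma osc_second_moment {hkn : k ≤ n} {c : ℝ} (hc : 0 < c) (N : ℕ) {i : Fin n} {j : Fin k}
    (hij : i ≠ Fin.castLE hkn j) : ∃ C, ∀ w R, Adm c w R →
      ‖(ext0 n w i + w j) * osc hkn (fun X => ent i j X * (ent i j X * chi hkn X)) w -
        Complex.I * osc hkn (chi hkn) w‖ ≤ C * (R ^ (-1 : ℤ) * refSize hkn N w R) := by
  have hamp := amp_ent_mul_chi hkn i j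
  rcases le_or_gt k (i : ℕ) with hi | hi
  · have hA := hamp.vf (rot (Fin.castLE hkn j) i)
    have h0 : (-1 : ℂ) * vf (rot (Fin.castLE hkn j) i) (fun X => ent i j X * chi hkn X)
        (base hkn) + (-1) * chi hkn (base hkn) = 0 := by
      rw [vf_ent_mul_chi_base hkn _ hij, rot_mul_apply]
      simp [hij, toMat_apply]
    obtain ⟨C, hC⟩ := ((hA.mul (fun _ => (-1 : ℂ)) contDiff_const).add
      ((amp_chi hkn).mul (fun _ => (-1 : ℂ)) contDiff_const)).osc_bound_of_eq_zero hc N h0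
    refine ⟨C, fun w R hw => le_of_eq_of_le ?_ (hC w R hw)⟩
    have h1 := osc_mul_vf_phase hkn hij.symm hamp.1 w
    have h2 : osc hkn (fun X => vf (rot (Fin.castLE hkn j) i) (phase hkn w) X *
        (ent i j X * chi hkn X)) w =
        -(w j) * osc hkn (fun X => ent i j X * (ent i j X * chi hkn X)) w := by
      rw [← osc_const_mul]
      refine osc_congr hkn (fun X _ => ?_) w
      rw [vf_rot_phase_of_le hkn w hi]
      ring
    rw [osc_add hkn (contDiff_const.mul hA.1).continuous.continuousOn
      (contDiff_const.mul (contDiff_chi hkn)).continuous.continuousOn, osc_const_mul,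
      osc_const_mul, ext0_of_le w hi]
    rw [h2] at h1
    rw [show (0 + w j) * osc hkn (fun X => ent i j X * (ent i j X * chi hkn X)) w -
      Complex.I * osc hkn (chi hkn) w = Complex.I * (-1 * osc hkn (vf (rot (Fin.castLE hkn j) i)
      fun X => ent i j X * chi hkn X) w + -1 * osc hkn (chi hkn) w) by linear_combination -h1]
    simp
  · obtain ⟨q, rfl⟩ := exists_eq_castLE hkn hi
    have hqj : q ≠ j := fun h => hij (by rw [h])
    have hA := hamp.vf (rot (Fin.castLE hkn q) (Fin.castLE hkn j))
    have h0 : vf (rot (Fin.castLE hkn q) (Fin.castLE hkn j))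
        (fun X => ent (Fin.castLE hkn q) j X * chi hkn X)
        (base hkn) + (-1) * chi hkn (base hkn) = 0 := by
      rw [vf_ent_mul_chi_base hkn _ hij, rot_mul_apply]
      simp [hij, toMat_apply]
    obtain ⟨C, hC⟩ := (hA.add
      ((amp_chi hkn).mul (fun _ => (-1 : ℂ)) contDiff_const)).osc_bound_of_eq_zero hc N h0
    obtain ⟨C', hC'⟩ := (amp2_symmetric_sum hkn hqj).osc_bound hc N hij
    refine ⟨C + c⁻¹ * C', fun w R hw => ?_⟩
    have h1 := osc_mul_vf_phase hkn hij hamp.1 w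
    set S : MatSpace n k → ℂ := fun X =>
      ((1 - ent (Fin.castLE hkn q) q X) * ent (Fin.castLE hkn q) j X +
      (1 - ent (Fin.castLE hkn j) j X) * ent (Fin.castLE hkn j) q X +
      ∑ i ∈ (Finset.univ.erase (Fin.castLE hkn q)).erase (Fin.castLE hkn j),
        (-ent i q X) * ent i j X) * chi hkn X with hS
    have hScont : Continuous S := (amp2_symmetric_sum hkn hqj).1.1.continuous
    -- The error X_qj S χ has third order, so it is O(R⁻²) by `Amp2.osc_bound`; the prefactor w_q
    -- leaves O(R⁻¹).
    have h2 : (w q + w j) * osc hkn (fun X => ent (Fin.castLE hkn q) j X *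
          (ent (Fin.castLE hkn q) j X * chi hkn X)) w =
        osc hkn (fun X => vf (rot (Fin.castLE hkn q) (Fin.castLE hkn j)) (phase hkn w) X *
          (ent (Fin.castLE hkn q) j X * chi hkn X)) w +
        w q * osc hkn (fun X => ent (Fin.castLE hkn q) j X * S X) w := by
      rw [← osc_const_mul, ← osc_const_mul, ← osc_add]
      · refine osc_congr hkn (fun X hX => ?_) w
        rw [vf_rot_phase, hS]
        simp only
        rw [← ent_add_ent hkn hX hqj]
        ring
      · exact ((contDiff_vf _ (contDiff_phase hkn w)).mul hamp.1).continuous.continuousOn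
      · exact (continuous_const.mul ((contDiff_ent _ _).continuous.mul hScont)).continuousOn
    rw [h1] at h2
    have h3 := hC w R hw
    have h4 := hC' w R hw
    rw [osc_add hkn hA.1.continuous.continuousOn
      (contDiff_const.mul (contDiff_chi hkn)).continuous.continuousOn, osc_const_mul] at h3
    rw [ext0_castLE, h2]
    have h5 : ‖w q‖ ≤ c⁻¹ * R := by
      rw [inv_mul_eq_div, le_div_iff₀ hc, mul_comm]
      exact hw.upper q
    have hR := hw.pos
    rw [show ∀ x y z u : ℂ, Complex.I * x + z * y - Complex.I * u =
      Complex.I * (x + -1 * u) + z * y by intros; ring]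
    refine (norm_add_le _ _).trans ?_
    rw [norm_mul, Complex.norm_I, one_mul, norm_mul, add_mul]
    refine add_le_add h3 ((mul_le_mul h5 h4 (norm_nonneg _) (by positivity)).trans (le_of_eq ?_))
    rw [_root_.zpow_neg_one]
    field_simp

/-- The leading term of the oscillatory integral with amplitude `(1 - X_jj) χ`. -/
lemma osc_diag_moment {hkn : k ≤ n} {c : ℝ} (hc : 0 < c) (N : ℕ) (j : Fin k) :
    ∃ C, ∀ w R, Adm c w R →
      ‖osc hkn (fun X => (1 - ent (Fin.castLE hkn j) j X) * chi hkn X) w -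
        (∑ i ∈ Finset.univ.erase (Fin.castLE hkn j), Complex.I / (2 * (ext0 n w i + w j))) *
          osc hkn (chi hkn) w‖ ≤ C * (R ^ (-2 : ℤ) * refSize hkn N w R) := by
  have hψ : Amp hkn fun X => chiDiv hkn j X + (-(1 / 2)) * chi hkn X :=
    (amp_chiDiv hkn j).add ((amp_chi hkn).mul (fun _ => -(1 / 2)) contDiff_const)
  have hψ0 : chiDiv hkn j (base hkn) + (-(1 / 2)) * chi hkn (base hkn) = 0 := by
    simp [chiDiv, ent]
    norm_num
  have h1 : ∀ i : Fin n, ∃ C, i ≠ Fin.castLE hkn j → ∀ w R, Adm c w R →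
      ‖osc hkn (fun X => ent i j X * (ent i j X * (chiDiv hkn j X + (-(1 / 2)) * chi hkn X))) w‖ ≤
        C * (R ^ (-1 : ℤ) * (R ^ (-1 : ℤ) * refSize hkn N w R)) := by
    intro i
    by_cases h : i = Fin.castLE hkn j
    · exact ⟨0, fun h' => absurd h h'⟩
    · obtain ⟨C, hC⟩ := (Amp2.of_mul (contDiff_ent i j) hψ (ent_base hkn h) hψ0).osc_bound hc N h
      exact ⟨C, fun _ => hC⟩
  have h2 : ∀ i : Fin n, ∃ C, i ≠ Fin.castLE hkn j → ∀ w R, Adm c w R →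
      ‖(ext0 n w i + w j) * osc hkn (fun X => ent i j X * (ent i j X * chi hkn X)) w -
        Complex.I * osc hkn (chi hkn) w‖ ≤ C * (R ^ (-1 : ℤ) * refSize hkn N w R) := by
    intro i
    by_cases h : i = Fin.castLE hkn j
    · exact ⟨0, fun h' => absurd h h'⟩
    · obtain ⟨C, hC⟩ := osc_second_moment (hkn := hkn) hc N h
      exact ⟨C, fun _ => hC⟩
  choose C1 hC1 using h1
  choose C2 hC2 using h2
  refine ⟨∑ i ∈ Finset.univ.erase (Fin.castLE hkn j), (C1 i + (2 * c)⁻¹ * C2 i), fun w R hw => ?_⟩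
  have hR := hw.pos
  have hcont1 : ∀ i, Continuous fun X => 1 / 2 * (ent i j X * (ent i j X * chi hkn X)) := fun i =>
    (contDiff_const.mul ((contDiff_ent i j).mul (amp_ent_mul_chi hkn i j).1)).continuous
  have hcont2 : ∀ i, Continuous fun X =>
      ent i j X * (ent i j X * (chiDiv hkn j X + (-(1 / 2)) * chi hkn X)) := fun i =>
    ((contDiff_ent i j).mul ((contDiff_ent i j).mul hψ.1)).continuous
  -- On the Stiefel manifold (1 - X_jj)χ = ∑_{i ≠ j} X_ij² χ/(1 + X_jj). Replacing χ/(1 + X_jj) by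
  -- χ/2, its value at E times the cutoff, leaves third-order terms.
  have h3 : osc hkn (fun X => (1 - ent (Fin.castLE hkn j) j X) * chi hkn X) w =
      ∑ i ∈ Finset.univ.erase (Fin.castLE hkn j),
        (1 / 2 * osc hkn (fun X => ent i j X * (ent i j X * chi hkn X)) w +
          osc hkn (fun X => ent i j X * (ent i j X *
            (chiDiv hkn j X + (-(1 / 2)) * chi hkn X))) w) := by
    simp_rw [← osc_const_mul]
    rw [Finset.sum_congr rfl fun i _ =>
      (osc_add hkn (hcont1 i).continuousOn (hcont2 i).continuousOn w).symm, ← osc_sum]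
    · refine osc_congr hkn (fun X hX => ?_) w
      have h4 : ∑ i, ent i j X * ent i j X = 1 := by
        have := sum_sq_col hX j
        simp only [ent, ← sq]
        exact_mod_cast this
      rw [← Finset.sum_erase_add _ _ (Finset.mem_univ (Fin.castLE hkn j))] at h4
      have h5 := chiDiv_mul hkn j X
      have h6 : ∀ i, 1 / 2 * (ent i j X * (ent i j X * chi hkn X)) +
          ent i j X * (ent i j X * (chiDiv hkn j X + (-(1 / 2)) * chi hkn X)) =
          ent i j X * ent i j X * chiDiv hkn j X := fun i => by ring
      simp_rw [h6]
      rw [← Finset.sum_mul]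
      linear_combination (-(1 - ent (Fin.castLE hkn j) j X)) * h5 - chiDiv hkn j X * h4
    · exact fun i _ => ((hcont1 i).add (hcont2 i)).continuousOn
  rw [h3, Finset.sum_mul, ← Finset.sum_sub_distrib, Finset.sum_mul]
  refine (norm_sum_le _ _).trans (Finset.sum_le_sum fun i hi => ?_)
  have hij : i ≠ Fin.castLE hkn j := Finset.ne_of_mem_erase hi
  have h4 := hC1 i hij w R hw
  have h5 := hC2 i hij w R hw
  have h6 := hw.le_norm_ext0_add hkn hij
  have h7 : 0 < c * R := by positivity
  have h8 : ext0 n w i + w j ≠ 0 := norm_pos_iff.mp (h7.trans_le h6)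
  set z := ext0 n w i + w j
  set A := osc hkn (fun X => ent i j X * (ent i j X * chi hkn X)) w
  set B := osc hkn (chi hkn) w
  set D := osc hkn (fun X => ent i j X * (ent i j X *
            (chiDiv hkn j X + (-(1 / 2)) * chi hkn X))) w
  have h9 : 1 / 2 * A + D - Complex.I / (2 * z) * B = D + (2 * z)⁻¹ * (z * A - Complex.I * B) := by
    field_simp
    ring
  rw [h9]
  refine (norm_add_le _ _).trans ?_
  have h10 : R ^ (-2 : ℤ) = R ^ (-1 : ℤ) * R ^ (-1 : ℤ) := by
    rw [← zpow_add₀ hR.ne']; norm_num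
  rw [add_mul (C1 i)]
  have h4' : ‖D‖ ≤ C1 i * (R ^ (-2 : ℤ) * refSize hkn N w R) :=
    h4.trans (le_of_eq (by rw [h10]; ring))
  refine add_le_add h4' ?_
  rw [norm_mul, norm_inv, norm_mul, Complex.norm_ofNat]
  have h11 : (2 * ‖z‖)⁻¹ ≤ (2 * c)⁻¹ * R ^ (-1 : ℤ) := by
    rw [_root_.zpow_neg_one, ← mul_inv]
    exact inv_anti₀ (by positivity) (by linarith)
  refine (mul_le_mul h11 h5 (norm_nonneg _) (by positivity)).trans (le_of_eq ?_)
  rw [h10]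
  ring

/-! ### Transport of the frequency to infinity -/

lemma phase_add_mul (hkn : k ≤ n) (w v : Fin k → ℂ) (t : ℂ) (X : MatSpace n k) :
    phase hkn (fun j => w j + t * v j) X = phase hkn w X + t * phase hkn v X := by
  simp only [phase, Finset.mul_sum, ← Finset.sum_add_distrib]
  exact Finset.sum_congr rfl fun j _ => by ring

lemma hasDerivAt_osc (hkn : k ≤ n) {a : MatSpace n k → ℂ} (ha : Continuous a) (w v : Fin k → ℂ)
    (t : ℝ) : HasDerivAt (fun τ : ℝ => osc hkn a fun j => w j + τ * v j)
      (osc hkn (fun X => Complex.I * phase hkn v X * a X) fun j => w j + t * v j) t := by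
  have := isFiniteMeasure_stiefelMeasure hkn
  have hw := (contDiff_phase hkn w).continuous
  have hv := (contDiff_phase hkn v).continuous
  let F : ℝ → MatSpace n k → ℂ := fun τ X =>
    a X * Complex.exp (Complex.I * (phase hkn w X + τ * phase hkn v X))
  let F' : ℝ → MatSpace n k → ℂ := fun τ X => Complex.I * phase hkn v X * a X *
    Complex.exp (Complex.I * (phase hkn w X + τ * phase hkn v X))
  have hFc : Continuous fun p : ℝ × MatSpace n k => F p.1 p.2 := by
    simp only [F]; fun_prop
  have hF'c : Continuous fun p : ℝ × MatSpace n k => F' p.1 p.2 := by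
    simp only [F']; fun_prop
  have hderiv : ∀ X τ, HasDerivAt (fun τ => F τ X) (F' τ X) τ := by
    intro X τ
    have h1 : HasDerivAt (fun τ : ℝ => Complex.I * (phase hkn w X + τ * phase hkn v X))
        (Complex.I * (1 * phase hkn v X)) τ :=
      (((hasDerivAt_id τ).ofReal_comp.mul_const _).const_add _).const_mul _
    refine (h1.cexp.const_mul (a X)).congr_deriv ?_
    simp only [F']; ring
  obtain ⟨C, hC⟩ := ((isCompact_closedBall t 1).prod
    (isCompact_stiefel (n := n) (k := k))).exists_bound_of_continuousOn hF'c.continuousOn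
  have key := (hasDerivAt_integral_of_dominated_loc_of_deriv_le (μ := stiefelMeasure n k)
    (F := F) (F' := F') (x₀ := t)
    (bound := fun _ => C) (Metric.ball_mem_nhds t one_pos)
    (Eventually.of_forall fun t =>
      (hFc.comp (by fun_prop : Continuous fun X => (t, X))).aestronglyMeasurable)
    (integrable_of_continuous hkn
      (hFc.comp (by fun_prop : Continuous fun X => (t, X))).continuousOn)
    (hF'c.comp (by fun_prop : Continuous fun X => (t, X))).aestronglyMeasurable
    (by
      filter_upwards [(ae_restrict_mem measurableSet_stiefel :
        ∀ᵐ X ∂stiefelMeasure n k, X ∈ stiefel n k)] with X hX t ht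
      exact hC (t, X) ⟨Metric.ball_subset_closedBall ht, hX⟩) (integrable_const C)
    (Eventually.of_forall fun X t _ => hderiv X t)).2
  simpa only [osc, phase_add_mul] using key

/-- A function that converges at infinity and satisfies a differential inequality with an
integrable coefficient is close to its limit. -/
lemma norm_sub_le_of_deriv_bound {F F' : ℝ → ℂ} {K : ℂ} {C r : ℝ} (hr : 0 < r) (hC : 0 ≤ C)
    (hCr : 2 * C ≤ r) (hF : ∀ τ, 0 ≤ τ → HasDerivAt F (F' τ) τ)
    (hF' : ∀ τ, 0 ≤ τ → ‖F' τ‖ ≤ C / (r + τ) ^ 2 * (‖F τ‖ + 1))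
    (hlim : Tendsto F atTop (𝓝 K)) : ‖F 0 - K‖ ≤ C * (2 * ‖K‖ + 2) / r := by
  have hcont : ContinuousOn F (Set.Ici 0) := fun τ hτ => (hF τ hτ).continuousAt.continuousWithinAt
  let S := (fun τ => ‖F τ‖) '' Set.Ici 0
  have hbdd : BddAbove S := by
    have h1 : ∀ᶠ τ in atTop, ‖F τ‖ < ‖K‖ + 1 :=
      hlim.norm.eventually (gt_mem_nhds (by linarith))
    obtain ⟨T, hT⟩ := eventually_atTop.1 h1
    obtain ⟨B, hB⟩ := (isCompact_Icc (a := (0 : ℝ)) (b := T)).exists_bound_of_continuousOn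
      (hcont.mono Set.Icc_subset_Ici_self)
    refine ⟨max B (‖K‖ + 1), ?_⟩
    rintro _ ⟨τ, hτ, rfl⟩
    rcases le_total τ T with h | h
    · exact le_max_of_le_left (hB τ ⟨hτ, h⟩)
    · exact le_max_of_le_right (hT τ h).le
  set M := sSup S
  have hM : ∀ τ, 0 ≤ τ → ‖F τ‖ ≤ M := fun τ hτ => le_csSup hbdd ⟨τ, hτ, rfl⟩
  have hM0 : 0 ≤ M := (norm_nonneg _).trans (hM 0 le_rfl)
  -- The coefficient C/(r + x)² has antiderivative -C/(r + x), hence total mass at most C/r on the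
  -- half line.
  have hinc : ∀ a b, 0 ≤ a → a ≤ b → ‖F b - F a‖ ≤ C * (M + 1) / r := by
    intro a b ha hab
    have h1 : ∀ x, 0 ≤ x → HasDerivAt (fun x => C * (M + 1) * ((r + a)⁻¹ - (r + x)⁻¹))
        (C / (r + x) ^ 2 * (M + 1)) x := by
      intro x hx
      have h2 : HasDerivAt (fun x => r + x) 1 x := (hasDerivAt_id x).const_add r
      refine (((h2.inv (by positivity)).const_sub _).const_mul (C * (M + 1))).congr_deriv ?_
      field_simp
    have h2 := image_norm_le_of_norm_deriv_right_le_deriv_boundary' (f := fun x => F x - F a)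
      (f' := F') (a := a) (b := b) (B := fun x => C * (M + 1) * ((r + a)⁻¹ - (r + x)⁻¹))
      (B' := fun x => C / (r + x) ^ 2 * (M + 1))
      ((hcont.mono fun x hx => ha.trans hx.1).sub continuousOn_const)
      (fun x hx => ((hF x (ha.trans hx.1)).sub_const _).hasDerivWithinAt) (by simp)
      (fun x hx => (h1 x (ha.trans hx.1)).continuousAt.continuousWithinAt)
      (fun x hx => (h1 x (ha.trans hx.1)).hasDerivWithinAt)
      (fun x hx => (hF' x (ha.trans hx.1)).trans (mul_le_mul_of_nonneg_left
        (by linarith [hM x (ha.trans hx.1)]) (by positivity))) (Set.right_mem_Icc.2 hab)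
    refine h2.trans ?_
    rw [div_eq_mul_inv]
    refine mul_le_mul_of_nonneg_left ?_ (by positivity)
    have h3 : (r + a)⁻¹ ≤ r⁻¹ := inv_anti₀ hr (by linarith)
    have h4 : 0 ≤ (r + b)⁻¹ := by have := ha.trans hab; positivity
    linarith
  have hK : ∀ a, 0 ≤ a → ‖K - F a‖ ≤ C * (M + 1) / r := fun a ha =>
    le_of_tendsto (hlim.sub_const _).norm
      ((eventually_ge_atTop a).mono fun b hb => hinc a b ha hb)
  -- The hypothesis 2C ≤ r is needed to absorb the supremum M: it gives M ≤ ‖K‖ + (M + 1)/2, so M ≤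
  -- 2‖K‖ + 1.
  have hhalf : C * (M + 1) / r ≤ (M + 1) / 2 := by
    rw [div_le_div_iff₀ hr two_pos]; nlinarith
  have hMK : M ≤ 2 * ‖K‖ + 1 := by
    have : M ≤ ‖K‖ + (M + 1) / 2 := by
      refine csSup_le ⟨_, 0, Set.self_mem_Ici, rfl⟩ ?_
      rintro _ ⟨τ, hτ, rfl⟩
      have h1 := norm_sub_norm_le (F τ) K
      rw [norm_sub_rev] at h1
      change ‖F τ‖ ≤ _
      linarith [hK τ hτ]
    linarith
  rw [norm_sub_rev]
  exact (hK 0 le_rfl).trans (div_le_div_of_nonneg_right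
    (mul_le_mul_of_nonneg_left (by linarith) hC) hr.le)

/-! ### Square roots, the weight and the path of frequencies -/

/-- The principal square root. -/
def halfPow (z : ℂ) : ℂ := Complex.exp (Complex.log z / 2)

lemma norm_halfPow {z : ℂ} (hz : z ≠ 0) : ‖halfPow z‖ = √‖z‖ := by
  rw [halfPow, Complex.norm_exp, Real.sqrt_eq_rpow, Real.rpow_def_of_pos (norm_pos_iff.2 hz)]
  congr 1
  rw [Complex.div_ofNat_re, Complex.log_re]
  ring

lemma halfPow_ofReal_mul {t : ℝ} (ht : 0 < t) {z : ℂ} (hz : z ≠ 0) :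
    halfPow (t * z) = √t * halfPow z := by
  rw [halfPow, Complex.log_ofReal_mul ht hz, add_div, Complex.exp_add, halfPow]
  congr 1
  rw [Real.sqrt_eq_rpow, Real.rpow_def_of_pos ht]
  push_cast
  ring_nf

lemma halfPow_ofReal {t : ℝ} (ht : 0 < t) : halfPow t = √t := by
  simpa [halfPow] using halfPow_ofReal_mul ht one_ne_zero

lemma hasDerivAt_halfPow {A e : ℂ} {t : ℝ} (h : A + t * e ∈ Complex.slitPlane) :
    HasDerivAt (fun τ : ℝ => halfPow (A + τ * e)) (halfPow (A + t * e) * (e / (2 * (A + t * e)))) t := by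
  have h1 : HasDerivAt (fun τ : ℝ => A + τ * e) (1 * e) t :=
    ((hasDerivAt_id t).ofReal_comp.mul_const _).const_add _
  refine ((h1.clog_real h).div_const 2).cexp.congr_deriv ?_
  rw [halfPow]
  have := Complex.slitPlane_ne_zero h
  field_simp

lemma continuousAt_halfPow {z : ℂ} (h : z ∈ Complex.slitPlane) : ContinuousAt halfPow z :=
  ((continuousAt_clog h).div_const 2).cexp

/-- Positive homogeneity of the square root removes √τ and leaves the argument A/τ + e, which tends
to e off the branch cut. -/
lemma tendsto_halfPow_div (A : ℂ) {e : ℝ} (he : 0 < e) :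
    Tendsto (fun τ : ℝ => halfPow (A + τ * e) / (√τ : ℂ)) atTop (𝓝 (√e : ℂ)) := by
  have h0 : Tendsto (fun τ : ℝ => (τ : ℂ)⁻¹ * A + e) atTop (𝓝 (0 * A + e)) := by
    refine Tendsto.add_const _ (Tendsto.mul_const _ ?_)
    have := tendsto_inv_atTop_zero (𝕜 := ℝ)
    exact_mod_cast (Complex.continuous_ofReal.tendsto 0).comp this
  rw [zero_mul, zero_add] at h0
  have hs : (e : ℂ) ∈ Complex.slitPlane := by simp [he]
  have h1 := (continuousAt_halfPow hs).tendsto.comp h0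
  rw [halfPow_ofReal he] at h1
  refine h1.congr' ?_
  have h2 := h0.eventually_ne (Complex.slitPlane_ne_zero hs)
  filter_upwards [h2, eventually_gt_atTop 0] with τ hτ hpos
  have hτ' : (τ : ℂ) ≠ 0 := by exact_mod_cast hpos.ne'
  have h3 : A + τ * e = (τ : ℂ) * ((τ : ℂ)⁻¹ * A + e) := by field_simp
  rw [h3, halfPow_ofReal_mul hpos hτ, Function.comp, mul_div_cancel_left₀]
  exact_mod_cast (Real.sqrt_pos.2 hpos).ne'

/-- The square root of the determinant of the Hessian of the phase, up to a constant. -/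
def weight (n : ℕ) (w : Fin k → ℂ) : ℂ :=
  ∏ p : Low n k, halfPow (-Complex.I * (ext0 n w p.1.1 + w p.1.2))

lemma Low.ne_castLE (hkn : k ≤ n) (p : Low n k) : p.1.1 ≠ Fin.castLE hkn p.1.2 := fun h => by
  have := p.2
  rw [h] at this
  simp at this

lemma Adm.norm_weight_le {c : ℝ} (hc : 0 < c) (hkn : k ≤ n) {w : Fin k → ℂ} {R : ℝ}
    (hw : Adm c w R) : ‖weight n w‖ ≤ √(2 / c) ^ stiefelDim n k * R ^ stiefelDim n k := by
  rw [weight, norm_prod, ← card_low hkn, ← mul_pow, ← Finset.card_univ,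
    ← Finset.prod_const]
  refine Finset.prod_le_prod (fun p _ => norm_nonneg _) fun p _ => ?_
  have hR := hw.pos
  have h1 := hw.le_norm_ext0_add hkn (p.ne_castLE hkn)
  have h2 : ext0 n w p.1.1 + w p.1.2 ≠ 0 := norm_pos_iff.1 ((mul_pos hc hR).trans_le h1)
  rw [norm_halfPow (mul_ne_zero (by simp) h2)]
  have h3 : ∀ j, ‖w j‖ ≤ R / c := fun j => by
    rw [le_div_iff₀ hc, mul_comm]; exact hw.upper j
  have h4 : ‖ext0 n w p.1.1‖ ≤ R / c := by
    unfold ext0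
    split_ifs
    · exact h3 _
    · simpa using by positivity
  have h5 : ‖-Complex.I * (ext0 n w p.1.1 + w p.1.2)‖ ≤ 2 / c * R := by
    rw [norm_mul, norm_neg, Complex.norm_I, one_mul]
    refine (norm_add_le _ _).trans ?_
    have := h3 p.1.2
    have h6 : 2 / c * R = R / c + R / c := by ring
    linarith
  refine (Real.sqrt_le_sqrt h5).trans ?_
  rw [Real.sqrt_mul (by positivity)]
  refine mul_le_mul_of_nonneg_left ?_ (Real.sqrt_nonneg _)
  -- The factor √R is weakened to R by R ≥ 1; a crude polynomial bound on the weight suffices.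
  rw [Real.sqrt_le_left hR.le]
  nlinarith [hw.one_le]

lemma Adm.le_norm_weight {c : ℝ} (hc : 0 < c) (hkn : k ≤ n) {w : Fin k → ℂ} {R : ℝ}
    (hw : Adm c w R) : √(c * R) ^ stiefelDim n k ≤ ‖weight n w‖ := by
  rw [weight, norm_prod, ← card_low hkn, ← Finset.card_univ, ← Finset.prod_const]
  refine Finset.prod_le_prod (fun p _ => Real.sqrt_nonneg _) fun p _ => ?_
  have h1 := hw.le_norm_ext0_add hkn (p.ne_castLE hkn)
  have h2 : ext0 n w p.1.1 + w p.1.2 ≠ 0 := norm_pos_iff.1 ((mul_pos hc hw.pos).trans_le h1)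
  rw [norm_halfPow (mul_ne_zero (by simp) h2)]
  exact Real.sqrt_le_sqrt (by simpa using h1)

lemma Adm.mono {c c' : ℝ} (hc : c' ≤ c) {w : Fin k → ℂ} {R : ℝ} (h : Adm c w R) : Adm c' w R := by
  have h1 : c' * R ≤ c * R := mul_le_mul_of_nonneg_right hc h.pos.le
  exact ⟨h.one_le, h.im_nonneg, fun j => h1.trans (h.lower j),
    fun j => (mul_le_mul_of_nonneg_right hc (norm_nonneg _)).trans (h.upper j),
    fun i j hij => h1.trans (h.sub i j hij), fun i j hij => h1.trans (h.add i j hij)⟩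

/-- The slope of the path of frequencies. -/
def slope (j : Fin k) : ℝ := (j : ℕ) + 1

lemma one_le_slope (j : Fin k) : 1 ≤ slope j := by simp [slope]

/-- The path of frequencies from `x` towards infinity in the upper half plane. -/
def path (x : Fin k → ℝ) (τ : ℝ) (j : Fin k) : ℂ := x j + τ * (Complex.I * slope j)

lemma le_norm_of_re_im {c r τ : ℝ} (hc1 : c ≤ 1) {z : ℂ} (hτ : 0 ≤ τ) (h1 : c * r ≤ |z.re|)
    (h2 : τ ≤ |z.im|) : c / 2 * (r + τ) ≤ ‖z‖ := by
  have h3 := Complex.abs_re_le_norm z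
  have h4 := Complex.abs_im_le_norm z
  nlinarith

/-- The real parts stay those of x, of size r, while the imaginary parts of w_j and w_i ± w_j have
modulus at least τ because the slopes are distinct positive integers. Nondegeneracy thus persists at
scale r + τ with the constant halved. -/
lemma adm_path {c : ℝ} (hc : 0 < c) (hc1 : c ≤ 1) (hck : c * k ≤ 1) {x : Fin k → ℝ} {r : ℝ}
    (hx : Adm c (fun j => (x j : ℂ)) r) {τ : ℝ} (hτ : 0 ≤ τ) : Adm (c / 2) (path x τ) (r + τ) := by
  have hr := hx.one_le
  have hre : ∀ j, (path x τ j).re = x j := fun j => by simp [path]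
  have him : ∀ j, (path x τ j).im = τ * slope j := fun j => by simp [path]
  refine ⟨by linarith, fun j => ?_, fun j => ?_, fun j => ?_, fun i j hij => ?_, fun i j hij => ?_⟩
  · rw [him]; exact mul_nonneg hτ (zero_le_one.trans (one_le_slope j))
  · refine le_norm_of_re_im hc1 hτ ?_ ?_
    · rw [hre]; simpa using hx.lower j
    · rw [him, abs_mul, abs_of_nonneg hτ]
      exact le_mul_of_one_le_right hτ ((one_le_slope j).trans (le_abs_self _))
  · have h1 := Complex.norm_le_abs_re_add_abs_im (path x τ j)
    rw [hre, him, abs_mul, abs_of_nonneg hτ, abs_of_nonneg (zero_le_one.trans (one_le_slope j))] at h1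
    have h2 : c * |x j| ≤ r := by simpa using hx.upper j
    have h3 : c * slope j ≤ 1 := by
      refine (mul_le_mul_of_nonneg_left ?_ hc.le).trans hck
      have := j.2
      unfold slope
      exact_mod_cast this
    nlinarith [abs_nonneg (x j)]
  · refine le_norm_of_re_im hc1 hτ ?_ ?_
    · have := hx.sub i j hij
      rw [← Complex.ofReal_sub, Complex.norm_real] at this
      simpa [hre] using this
    · rw [Complex.sub_im, him, him, ← mul_sub, abs_mul, abs_of_nonneg hτ]
      refine le_mul_of_one_le_right hτ ?_
      have : (1 : ℤ) ≤ |((i : ℕ) : ℤ) - ((j : ℕ) : ℤ)| :=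
        Int.one_le_abs (sub_ne_zero.2 (by exact_mod_cast fun h => hij (Fin.ext h)))
      have h2 : slope i - slope j = ((((i : ℕ) : ℤ) - ((j : ℕ) : ℤ) : ℤ) : ℝ) := by
        simp [slope]
      rw [h2]
      exact_mod_cast this
  · refine le_norm_of_re_im hc1 hτ ?_ ?_
    · have := hx.add i j hij
      rw [← Complex.ofReal_add, Complex.norm_real] at this
      simpa [hre] using this
    · rw [Complex.add_im, him, him, ← mul_add, abs_mul, abs_of_nonneg hτ]
      refine le_mul_of_one_le_right hτ (le_trans ?_ (le_abs_self _))
      linarith [one_le_slope i, one_le_slope j]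

/-! ### The contribution of the base frame -/

/-- The terms at (i, j) and (j, i) have the same denominator. Pairing them turns the coefficient
from `osc_diag_moment` into the logarithmic derivative of the weight along the path. -/
lemma sum_mul_sum_erase (hkn : k ≤ n) (d : Fin k → ℂ) (w : Fin k → ℂ) :
    ∑ j, d j * ∑ i ∈ Finset.univ.erase (Fin.castLE hkn j),
        Complex.I / (2 * (ext0 n w i + w j)) =
      ∑ p : Low n k, (ext0 n d p.1.1 + d p.1.2) *
        (Complex.I / (2 * (ext0 n w p.1.1 + w p.1.2))) := by
  have h1 := sum_eq_diag_add_low hkn fun i j => if i = Fin.castLE hkn j then 0 else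
    d j * (Complex.I / (2 * (ext0 n w i + w j)))
  rw [Finset.sum_comm] at h1
  simp only [if_true, Finset.sum_const_zero, zero_add] at h1
  have h2 : ∀ j, d j * ∑ i ∈ Finset.univ.erase (Fin.castLE hkn j),
      Complex.I / (2 * (ext0 n w i + w j)) = ∑ i, if i = Fin.castLE hkn j then 0 else
        d j * (Complex.I / (2 * (ext0 n w i + w j))) := by
    intro j
    rw [Finset.mul_sum, ← Finset.sum_erase (Finset.univ) (a := Fin.castLE hkn j) (by simp)]
    exact Finset.sum_congr rfl fun i hi => (if_neg (Finset.ne_of_mem_erase hi)).symm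
  rw [Finset.sum_congr rfl fun j _ => h2 j, h1]
  refine Finset.sum_congr rfl fun p _ => ?_
  rw [if_neg (p.ne_castLE hkn)]
  by_cases h : (p.1.1 : ℕ) < k
  · rw [dif_pos h]
    obtain ⟨q, hq⟩ := exists_eq_castLE hkn h
    have hq' : (⟨p.1.1, h⟩ : Fin k) = q := by ext; simp [hq]
    rw [hq', if_neg, hq]
    · simp only [ext0_castLE]
      rw [add_comm (w p.1.2) (w q)]
      ring
    · rw [← hq]; exact (p.ne_castLE hkn).symm
  · rw [dif_neg h, ext0_of_le d (not_lt.1 h)]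
    ring

/-- The speed of the factor of the weight at `p` along the path of frequencies. -/
def lowSlope (p : Low n k) : ℝ := ext0 n (slope (k := k)) p.1.1 + slope p.1.2

lemma lowSlope_pos (p : Low n k) : 0 < lowSlope p := by
  have h1 := one_le_slope p.1.2
  have h2 : 0 ≤ ext0 n (slope (k := k)) p.1.1 := by
    unfold ext0
    split_ifs
    · exact zero_le_one.trans (one_le_slope _)
    · exact le_rfl
  unfold lowSlope
  linarith

lemma weight_factor (x : Fin k → ℝ) (τ : ℝ) (p : Low n k) :
    -Complex.I * (ext0 n (path x τ) p.1.1 + path x τ p.1.2) =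
      -Complex.I * ((ext0 n x p.1.1 + x p.1.2 : ℝ) : ℂ) + τ * (lowSlope p : ℂ) := by
  have h : ext0 n (path x τ) p.1.1 = ext0 n x p.1.1 + τ * (Complex.I * ext0 n (slope (k := k)) p.1.1) := by
    unfold ext0
    split_ifs <;> simp [path]
  rw [h, lowSlope, path]
  push_cast
  linear_combination (-(τ : ℂ) * ((ext0 n (slope (k := k)) p.1.1 : ℝ) + slope p.1.2)) * Complex.I_mul_I

lemma hasDerivAt_weight_path (hkn : k ≤ n) {c : ℝ} (hc : 0 < c) (x : Fin k → ℝ) {τ R : ℝ}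
    (hτ : 0 ≤ τ) (h : Adm c (path x τ) R) :
    HasDerivAt (fun τ => weight n (path x τ)) (weight n (path x τ) *
      ∑ p : Low n k, (lowSlope p : ℂ) *
        (Complex.I / (2 * (ext0 n (path x τ) p.1.1 + path x τ p.1.2)))) τ := by
  have hne : ∀ p : Low n k, ext0 n (path x τ) p.1.1 + path x τ p.1.2 ≠ 0 := fun p =>
    norm_pos_iff.1 ((mul_pos hc h.pos).trans_le (h.le_norm_ext0_add hkn (p.ne_castLE hkn)))
  -- The argument is nonzero with real part τ · `lowSlope` p ≥ 0, so it avoids the branch cut,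
  -- including at τ = 0 where it is purely imaginary.
  have hslit : ∀ p : Low n k, -Complex.I * ((ext0 n x p.1.1 + x p.1.2 : ℝ) : ℂ) +
      τ * (lowSlope p : ℂ) ∈ Complex.slitPlane := by
    intro p
    have h0 : -Complex.I * ((ext0 n x p.1.1 + x p.1.2 : ℝ) : ℂ) + τ * (lowSlope p : ℂ) ≠ 0 := by
      rw [← weight_factor]; exact mul_ne_zero (by simp) (hne p)
    have hre : 0 ≤ (-Complex.I * ((ext0 n x p.1.1 + x p.1.2 : ℝ) : ℂ) +
        τ * (lowSlope p : ℂ)).re := by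
      simpa using mul_nonneg hτ (lowSlope_pos p).le
    rw [Complex.mem_slitPlane_iff]
    by_contra! hcon
    exact h0 (Complex.ext (le_antisymm hcon.1 hre) hcon.2)
  have h1 := HasDerivAt.fun_finsetProd (u := Finset.univ) fun p (_ : p ∈ Finset.univ) =>
    hasDerivAt_halfPow (hslit p)
  simp only [← weight_factor] at h1
  refine h1.congr_deriv ?_
  rw [Finset.mul_sum]
  refine Finset.sum_congr rfl fun p hp => ?_
  rw [smul_eq_mul, ← mul_assoc, Finset.prod_erase_mul _ _ hp, weight]
  congr 1
  have := hne p
  field_simp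
  simp

lemma hasDerivAt_osc_path (hkn : k ≤ n) (x : Fin k → ℝ) (τ : ℝ) :
    HasDerivAt (fun τ => osc hkn (chi hkn) (path x τ)) (-∑ j, (slope j : ℂ) *
      osc hkn (fun X => (1 - ent (Fin.castLE hkn j) j X) * chi hkn X) (path x τ)) τ := by
  have hchi := (contDiff_chi (n := n) hkn).continuous
  have hent : ∀ (i : Fin n) (j : Fin k), Continuous (ent i j) := fun i j =>
    (contDiff_ent i j).continuous
  refine (hasDerivAt_osc hkn hchi (fun j => (x j : ℂ))
    (fun j => Complex.I * slope j) τ).congr_deriv ?_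
  change osc hkn _ (path x τ) = _
  simp_rw [← osc_const_mul]
  rw [← osc_sum hkn _ fun j _ => (by fun_prop), neg_eq_neg_one_mul, ← osc_const_mul]
  refine osc_congr hkn (fun X _ => ?_) _
  simp only [phase, Finset.mul_sum, Finset.sum_mul, ent]
  refine Finset.sum_congr rfl fun j _ => ?_
  linear_combination ((slope j : ℂ) * (1 - (X (Fin.castLE hkn j, j) : ℂ)) * chi hkn X) *
    Complex.I_mul_I

/-- The constant in the stationary phase expansion. -/
def statConst (n k : ℕ) : ℝ :=
  ∏ p : Low n k, if (p.1.1 : ℕ) < k then √(4 * Real.pi) else √(2 * Real.pi)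

/-- `lowSlope` is twice the Hessian eigenvalue in the square block and equal to it below, so the
slopes cancel and √(4π) or √(2π) remains. -/
lemma prod_sqrt_lowSlope : (∏ p : Low n k, √(lowSlope p)) * gaussConst n (slope (k := k)) =
    statConst n k := by
  rw [gaussConst, ← Finset.prod_mul_distrib, statConst]
  refine Finset.prod_congr rfl fun p _ => ?_
  have h0 := lowSlope_pos p
  rw [← Real.sqrt_mul h0.le, hessEigen]
  unfold lowSlope ext0 at *
  split_ifs with h
  · rw [dif_pos h] at h0
    congr 1
    field_simp
    norm_num
  · rw [dif_neg h] at h0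
    congr 1
    rw [zero_add] at *
    field_simp

/-- Along the path the exponential splits into exp(iφ_x), which joins the amplitude and equals 1 at
E, and the Laplace factor exp(-τ · height) with d = slope. The powers of √τ in the two factors
cancel. -/
lemma tendsto_weight_mul_osc (hkn : k ≤ n) (x : Fin k → ℝ) :
    Tendsto (fun τ => weight n (path x τ) * osc hkn (chi hkn) (path x τ)) atTop
      (𝓝 (statConst n k : ℂ)) := by
  have h1 : Tendsto (fun τ : ℝ => weight n (path x τ) / (√τ : ℂ) ^ stiefelDim n k) atTop
      (𝓝 (∏ p : Low n k, (√(lowSlope p) : ℂ))) := by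
    have := tendsto_finsetProd (Finset.univ : Finset (Low n k)) fun p _ =>
      tendsto_halfPow_div (-Complex.I * ((ext0 n x p.1.1 + x p.1.2 : ℝ) : ℂ)) (lowSlope_pos p)
    refine this.congr fun τ => ?_
    rw [Finset.prod_div_distrib, Finset.prod_const, Finset.card_univ, card_low hkn, weight]
    simp_rw [weight_factor]
  have hchi := (contDiff_chi (n := n) hkn).continuous
  have h2 := tendsto_laplace hkn one_le_slope
    (hchi.mul (continuous_cexp_phase hkn fun j => (x j : ℂ)))
  have h3 : phase hkn (fun j => (x j : ℂ)) (base hkn) = 0 := by simp [phase]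
  simp only [Pi.mul_apply] at h2
  rw [h3, chi_base, mul_zero, Complex.exp_zero, mul_one, mul_one] at h2
  have h4 := h1.mul h2
  have h5 : (∏ p : Low n k, (√(lowSlope p) : ℂ)) * (gaussConst n (slope (k := k)) : ℂ) =
      (statConst n k : ℂ) := by
    rw [← prod_sqrt_lowSlope]; push_cast; rfl
  rw [h5] at h4
  refine h4.congr' ?_
  filter_upwards [eventually_gt_atTop 0] with τ hτ
  have h6 : (√τ : ℂ) ^ stiefelDim n k ≠ 0 :=
    pow_ne_zero _ (by exact_mod_cast (Real.sqrt_pos.2 hτ).ne')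
  rw [← mul_assoc, div_mul_cancel₀ _ h6]
  congr 1
  refine integral_congr_ae (Eventually.of_forall fun X => ?_)
  change chi hkn X * _ * _ = chi hkn X * Complex.exp (Complex.I *
    phase hkn (fun j => (x j : ℂ) + τ * (Complex.I * slope j)) X)
  rw [phase_add_mul, mul_assoc]
  congr 1
  rw [Complex.ofReal_exp, ← Complex.exp_add]
  congr 1
  rw [mul_add]
  congr 1
  simp only [phase, height]
  push_cast
  simp only [Finset.mul_sum, ← Finset.sum_neg_distrib]
  refine Finset.sum_congr rfl fun j _ => ?_
  linear_combination (-(τ : ℂ) * (slope j : ℂ) * (1 - (X (Fin.castLE hkn j, j) : ℂ))) *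
    Complex.I_mul_I

/-- The stationary phase expansion at the base frame. -/
theorem weight_mul_osc_bound (hkn : k ≤ n) {c : ℝ} (hc : 0 < c) : ∃ C, 0 ≤ C ∧ ∀ (x : Fin k → ℝ) r,
    Adm c (fun j => (x j : ℂ)) r →
      ‖weight n (fun j => (x j : ℂ)) * osc hkn (chi hkn) (fun j => (x j : ℂ)) - statConst n k‖ ≤
        C / r := by
  wlog hck : c ≤ 1 ∧ c * k ≤ 1 generalizing c
  · obtain ⟨C, hC0, hC⟩ := this (c := min c (1 / (k + 1))) (by positivity)
      ⟨(min_le_right _ _).trans (by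
        rw [div_le_one (by positivity)]; linarith [(Nat.cast_nonneg k : (0 : ℝ) ≤ k)]),
       (mul_le_mul_of_nonneg_right (min_le_right _ _) (Nat.cast_nonneg k)).trans (by
        rw [one_div, inv_mul_le_one₀ (by positivity)]; linarith)⟩
    exact ⟨C, hC0, fun x r h => hC x r (h.mono (min_le_left _ _))⟩
  have hc2 : 0 < c / 2 := half_pos hc
  -- The order N is the dimension of the manifold, so that R^(-N) times the weight is bounded by the
  -- constant W.
  choose C1 hC1 using fun j => osc_diag_moment (hkn := hkn) hc2 (stiefelDim n k) j
  set m := stiefelDim n k with hm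
  set W := √(2 / (c / 2)) ^ m with hW
  have hW0 : 0 ≤ W := by positivity
  set E := ∑ j, slope j * |C1 j| with hE
  have hE0 : 0 ≤ E := Finset.sum_nonneg fun j _ =>
    mul_nonneg (zero_le_one.trans (one_le_slope j)) (abs_nonneg _)
  set C := E * (1 + W) with hC
  have hC0 : 0 ≤ C := by positivity
  set I0 := ∫ X, ‖chi hkn X‖ ∂stiefelMeasure n k
  have hI0 : 0 ≤ I0 := integral_nonneg fun X => norm_nonneg _
  set K := statConst n k
  refine ⟨C * (2 * ‖(K : ℂ)‖ + 2) + (W * (2 * C) ^ m * I0 + ‖(K : ℂ)‖) * (2 * C), by positivity,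
    fun x r hx => ?_⟩
  have hr := hx.pos
  have hp0 : path x 0 = fun j => (x j : ℂ) := by ext j; simp [path]
  -- The differential inequality needs r ≥ 2C. For smaller r both terms of the difference are
  -- bounded and 1/r is at least 1/(2C), so a larger constant suffices.
  rcases le_or_gt (2 * C) r with hrC | hrC
  · have hadm : ∀ τ, 0 ≤ τ → Adm (c / 2) (path x τ) (r + τ) := fun τ hτ =>
      adm_path hc hck.1 hck.2 hx hτ
    have key := norm_sub_le_of_deriv_bound hr hC0 hrC
      (fun τ hτ => (hasDerivAt_weight_path hkn hc2 x hτ (hadm τ hτ)).mul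
        (hasDerivAt_osc_path hkn x τ)) (fun τ hτ => ?_) (tendsto_weight_mul_osc hkn x)
    · simp only [Pi.mul_apply, hp0] at key
      refine key.trans (div_le_div_of_nonneg_right ?_ hr.le)
      have : 0 ≤ (W * (2 * C) ^ m * I0 + ‖(K : ℂ)‖) * (2 * C) := by positivity
      linarith
    · have ha := hadm τ hτ
      set w := path x τ
      set R := r + τ
      have hR := ha.pos
      have hsum := sum_mul_sum_erase hkn (fun j => (slope j : ℂ)) w
      have hls : ∀ p : Low n k, ext0 n (fun j : Fin k => (slope j : ℂ)) p.1.1 + (slope p.1.2 : ℂ) =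
          (lowSlope p : ℂ) := by
        intro p
        unfold lowSlope ext0
        split_ifs <;> simp
      simp only [hls] at hsum
      rw [← hsum]
      -- The derivative of the product is the weight times the errors of `osc_diag_moment`: the main
      -- terms cancel.
      have h1 : weight n w * (∑ j, (slope j : ℂ) * ∑ i ∈ Finset.univ.erase (Fin.castLE hkn j),
            Complex.I / (2 * (ext0 n w i + w j))) * osc hkn (chi hkn) w +
          weight n w * -∑ j, (slope j : ℂ) *
            osc hkn (fun X => (1 - ent (Fin.castLE hkn j) j X) * chi hkn X) w =
          -(weight n w * ∑ j, (slope j : ℂ) *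
            (osc hkn (fun X => (1 - ent (Fin.castLE hkn j) j X) * chi hkn X) w -
              (∑ i ∈ Finset.univ.erase (Fin.castLE hkn j),
                Complex.I / (2 * (ext0 n w i + w j))) * osc hkn (chi hkn) w)) := by
        simp only [mul_sub, Finset.sum_sub_distrib, ← mul_assoc, ← Finset.sum_mul]
        ring
      rw [h1, norm_neg, norm_mul]
      have h2 : ‖∑ j, (slope j : ℂ) *
            (osc hkn (fun X => (1 - ent (Fin.castLE hkn j) j X) * chi hkn X) w -
              (∑ i ∈ Finset.univ.erase (Fin.castLE hkn j),
                Complex.I / (2 * (ext0 n w i + w j))) * osc hkn (chi hkn) w)‖ ≤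
          E * (R ^ (-2 : ℤ) * refSize hkn m w R) := by
        refine (norm_sum_le _ _).trans ?_
        rw [hE, Finset.sum_mul]
        refine Finset.sum_le_sum fun j _ => ?_
        rw [norm_mul, Complex.norm_real, Real.norm_of_nonneg (zero_le_one.trans (one_le_slope j)),
          mul_assoc]
        refine mul_le_mul_of_nonneg_left ((hC1 j w R ha).trans ?_)
          (zero_le_one.trans (one_le_slope j))
        refine mul_le_mul_of_nonneg_right (le_abs_self _) ?_
        unfold refSize
        positivity
      refine (mul_le_mul_of_nonneg_left h2 (norm_nonneg _)).trans ?_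
      have h3 : ‖weight n w‖ * R ^ (-(m : ℤ)) ≤ W := by
        rw [_root_.zpow_neg, zpow_natCast, ← div_eq_mul_inv, div_le_iff₀ (by positivity)]
        exact ha.norm_weight_le hc2 hkn
      have h4 : R ^ (-2 : ℤ) = (R ^ 2)⁻¹ := by
        rw [_root_.zpow_neg]; rfl
      have h5 : ‖weight n w‖ * refSize hkn m w R ≤
          (1 + W) * (‖weight n w * osc hkn (chi hkn) w‖ + 1) := by
        rw [refSize, mul_add, norm_mul]
        have : 0 ≤ ‖weight n w‖ * ‖osc hkn (chi hkn) w‖ := by positivity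
        nlinarith
      calc ‖weight n w‖ * (E * (R ^ (-2 : ℤ) * refSize hkn m w R))
          = E * (R ^ 2)⁻¹ * (‖weight n w‖ * refSize hkn m w R) := by rw [h4]; ring
        _ ≤ E * (R ^ 2)⁻¹ * ((1 + W) * (‖weight n w * osc hkn (chi hkn) w‖ + 1)) := by gcongr
        _ = _ := by rw [hC]; simp only [Pi.mul_apply]; ring
  · have h1 : ‖weight n (fun j => (x j : ℂ))‖ ≤ W * (2 * C) ^ m := by
      have h2 := (hx.mono (by linarith : c / 2 ≤ c)).norm_weight_le hc2 hkn
      refine h2.trans (mul_le_mul_of_nonneg_left ?_ hW0)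
      gcongr
    have h2 : ‖osc hkn (chi hkn) (fun j => (x j : ℂ))‖ ≤ I0 :=
      norm_osc_le hkn (by simp) (contDiff_chi hkn).continuous
    rw [le_div_iff₀ hr]
    have h3 : ‖weight n (fun j => (x j : ℂ)) * osc hkn (chi hkn) (fun j => (x j : ℂ)) - K‖ ≤
        W * (2 * C) ^ m * I0 + ‖(K : ℂ)‖ := by
      refine (norm_sub_le _ _).trans (add_le_add ?_ le_rfl)
      rw [norm_mul]
      gcongr
    refine (mul_le_mul h3 hrC.le hr.le (by positivity)).trans ?_
    have : 0 ≤ C * (2 * ‖(K : ℂ)‖ + 2) := by positivity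
    linarith

/-! ### Reduction to diagonal frequencies -/

/-- The frequency `[diag(l); 0]`. -/
def diagFreq (hkn : k ≤ n) (l : Fin k → ℝ) : MatSpace n k :=
  ofMat (toMat (base hkn) * diagonal l)

lemma diagFreq_apply (hkn : k ≤ n) (l : Fin k → ℝ) (i : Fin n) (j : Fin k) :
    diagFreq hkn l (i, j) = if i = Fin.castLE hkn j then l j else 0 := by
  simp [diagFreq, Matrix.mul_diagonal, toMat_apply, base_apply]

lemma norm_sq_diagFreq (hkn : k ≤ n) (l : Fin k → ℝ) : ‖diagFreq hkn l‖ ^ 2 = ∑ j, l j ^ 2 := by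
  rw [norm_sq_eq_sum, Finset.sum_comm]
  simp [diagFreq_apply]

lemma trace_diagFreq (hkn : k ≤ n) (l : Fin k → ℝ) (X : MatSpace n k) :
    ((toMat X)ᵀ * toMat (diagFreq hkn l)).trace = ∑ j, l j * X (Fin.castLE hkn j, j) := by
  simp [Matrix.trace, Matrix.mul_apply, toMat_apply, diagFreq_apply, mul_comm]

/-- The singular value decomposition of a matrix of full rank. -/
lemma exists_svd (hkn : k ≤ n) (Ξ : MatSpace n k) (hpos : ∀ j, 0 < singularValue Ξ j) :
    ∃ U V, Uᵀ * U = 1 ∧ V * Vᵀ = 1 ∧ Ξ = biMul U V (diagFreq hkn (singularValue Ξ)) := by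
  set T := Matrix.toEuclideanLin (toMat Ξ)
  have hfin : Module.finrank ℝ (EuclideanSpace ℝ (Fin k)) = k := by simp
  let b := T.isSymmetric_adjoint_comp_self.eigenvectorBasis hfin
  let B : Matrix (Fin k) (Fin k) ℝ := Matrix.of fun i j => b j i
  have hBB : Bᵀ * B = 1 := by
    ext p q
    have := orthonormal_iff_ite.1 b.orthonormal q p
    simpa [Matrix.mul_apply, Matrix.one_apply, B, PiLp.inner_apply, eq_comm] using this
  have hT : ∀ i j, (toMat Ξ * B) i j = T (b j) i := by
    intro i j
    simp [T, B, Matrix.toLpLin_apply, Matrix.mulVec, dotProduct, Matrix.mul_apply]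
  have hgram : (toMat Ξ * B)ᵀ * (toMat Ξ * B) = diagonal fun j => singularValue Ξ j ^ 2 := by
    ext p q
    have h1 : ((toMat Ξ * B)ᵀ * (toMat Ξ * B)) p q = inner ℝ (T (b q)) (T (b p)) := by
      rw [Matrix.mul_apply]
      simp only [Matrix.transpose_apply, hT]
      simp [PiLp.inner_apply]
    have h2 : inner ℝ (T (b q)) (T (b p)) = inner ℝ (b q) ((LinearMap.adjoint T ∘ₗ T) (b p)) := by
      rw [LinearMap.comp_apply, LinearMap.adjoint_inner_right]
    rw [h1, h2, T.isSymmetric_adjoint_comp_self.apply_eigenvectorBasis hfin, inner_smul_right,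
      orthonormal_iff_ite.1 b.orthonormal q p, ← T.sq_singularValues_fin hfin, diagonal_apply]
    rcases eq_or_ne p q with rfl | h
    · simp [singularValue, T]
    · simp [h, h.symm]
  -- In an eigenbasis B of ΞᵗΞ the columns of ΞB are orthogonal with lengths the singular values.
  -- Normalizing them gives a frame, and transitivity of the orthogonal group supplies U.
  let Y : MatSpace n k := ofMat (toMat Ξ * B * diagonal fun j => (singularValue Ξ j)⁻¹)
  have hY : Y ∈ stiefel n k := by
    change (toMat Ξ * B * diagonal fun j => (singularValue Ξ j)⁻¹)ᵀ *
      (toMat Ξ * B * diagonal fun j => (singularValue Ξ j)⁻¹) = 1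
    rw [Matrix.transpose_mul, Matrix.mul_assoc, ← Matrix.mul_assoc (toMat Ξ * B)ᵀ, hgram,
      diagonal_transpose, diagonal_mul_diagonal, diagonal_mul_diagonal, ← diagonal_one]
    congr 1
    ext j
    have := (hpos j).ne'
    field_simp
  obtain ⟨U, hU, hUY⟩ := exists_biMul_base hkn hY
  refine ⟨U, Bᵀ, hU, by simpa using hBB, toMat_injective ?_⟩
  have h1 : U * toMat (base hkn) = toMat Ξ * B * diagonal fun j => (singularValue Ξ j)⁻¹ := by
    simpa [Y] using congrArg toMat hUY
  have h2 : (diagonal fun j => (singularValue Ξ j)⁻¹) * diagonal (singularValue Ξ) = 1 := by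
    rw [diagonal_mul_diagonal, ← diagonal_one]
    congr 1
    ext j
    exact inv_mul_cancel₀ (hpos j).ne'
  rw [toMat_biMul, diagFreq, toMat_ofMat, ← Matrix.mul_assoc, h1, Matrix.mul_assoc (toMat Ξ * B),
    h2, Matrix.mul_one, Matrix.mul_assoc, mul_eq_one_comm.1 hBB, Matrix.mul_one]

lemma norm_biMul {U : Matrix (Fin n) (Fin n) ℝ} {V : Matrix (Fin k) (Fin k) ℝ}
    (hU : Uᵀ * U = 1) (hV : V * Vᵀ = 1) (X : MatSpace n k) : ‖biMul U V X‖ = ‖X‖ :=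
  (biMulIsometry U V hU hV).norm_map X

lemma singularValue_le_norm (hkn : k ≤ n) (Ξ : MatSpace n k) (hpos : ∀ j, 0 < singularValue Ξ j)
    (j : Fin k) : singularValue Ξ j ≤ ‖Ξ‖ := by
  obtain ⟨U, V, hU, hV, h⟩ := exists_svd hkn Ξ hpos
  have h1 : ‖Ξ‖ ^ 2 = ∑ j, singularValue Ξ j ^ 2 := by
    rw [← norm_sq_diagFreq hkn, ← norm_biMul hU hV (diagFreq hkn _), ← h]
  refine le_of_sq_le_sq ?_ (norm_nonneg _)
  rw [h1]
  exact Finset.single_le_sum (f := fun j => singularValue Ξ j ^ 2) (fun j _ => sq_nonneg _)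
    (Finset.mem_univ j)

lemma stiefelFourier_eq (hkn : k ≤ n) (Ξ : MatSpace n k) (hpos : ∀ j, 0 < singularValue Ξ j) :
    stiefelFourier Ξ = ∫ X, Complex.exp (-2 * Real.pi * Complex.I *
      ((∑ j, singularValue Ξ j * X (Fin.castLE hkn j, j) : ℝ) : ℂ)) ∂stiefelMeasure n k := by
  obtain ⟨U, V, hU, hV, h⟩ := exists_svd hkn Ξ hpos
  rw [stiefelFourier, ← integral_biMul hU hV]
  congr 1
  ext X
  rw [← trace_diagFreq]
  congr 3
  conv_lhs => rw [h]
  rw [toMat_biMul, toMat_biMul, Matrix.transpose_mul, Matrix.transpose_mul, Matrix.trace_mul_comm]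
  have h1 : U * toMat (diagFreq hkn (singularValue Ξ)) * V * (Vᵀ * ((toMat X)ᵀ * Uᵀ)) =
      U * toMat (diagFreq hkn (singularValue Ξ)) * ((toMat X)ᵀ * Uᵀ) := by
    rw [Matrix.mul_assoc _ V, ← Matrix.mul_assoc V, hV, Matrix.one_mul]
  rw [h1, Matrix.trace_mul_comm, ← Matrix.mul_assoc, Matrix.mul_assoc _ Uᵀ, hU, Matrix.mul_one]

/-! ### Localization at the critical frames -/

/-- The change of the signs of the columns. -/
def flip (s : Fin k → ℤˣ) : MatSpace n k →ₗ[ℝ] MatSpace n k :=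
  biMul 1 (diagonal fun j => ((s j : ℤ) : ℝ))

lemma flip_apply (s : Fin k → ℤˣ) (X : MatSpace n k) (i : Fin n) (j : Fin k) :
    flip s X (i, j) = ((s j : ℤ) : ℝ) * X (i, j) := by
  rw [flip, ← toMat_apply, toMat_biMul, Matrix.one_mul, Matrix.mul_diagonal, mul_comm, toMat_apply]

lemma sign_mul_self (u : ℤˣ) : ((u : ℤ) : ℝ) * ((u : ℤ) : ℝ) = 1 := by
  rcases Int.units_eq_one_or u with rfl | rfl <;> simp

lemma contDiff_flip (s : Fin k → ℤˣ) : ContDiff ℝ ∞ (flip (n := n) s) :=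
  (LinearMap.toContinuousLinearMap (flip s)).contDiff

lemma integral_flip (s : Fin k → ℤˣ) (f : MatSpace n k → ℂ) :
    ∫ X, f (flip s X) ∂stiefelMeasure n k = ∫ X, f X ∂stiefelMeasure n k := by
  refine integral_biMul (by simp) ?_ f
  rw [diagonal_transpose, diagonal_mul_diagonal, ← diagonal_one]
  congr 1
  ext j
  exact sign_mul_self _

/-- The part of the partition of unity away from the critical frames. -/
def offCrit (hkn : k ≤ n) (X : MatSpace n k) : ℂ := 1 - ∑ s : Fin k → ℤˣ, chi hkn (flip s X)

lemma IsCrit.exists_sign {hkn : k ≤ n} {X : MatSpace n k} (hX : IsCrit hkn X) :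
    ∃ s : Fin k → ℤˣ, X = flip s (base hkn) := by
  rw [isCrit_iff] at hX
  have h1 : ∀ j, ∃ u : ℤˣ, X (Fin.castLE hkn j, j) = ((u : ℤ) : ℝ) := by
    intro j
    have := hX (Fin.castLE hkn j) j
    rw [if_pos rfl] at this
    rcases this with h | h
    · exact ⟨1, by simp [h]⟩
    · exact ⟨-1, by simp [h]⟩
  choose s hs using h1
  refine ⟨s, ?_⟩
  ext ⟨i, j⟩
  rw [flip_apply, base_apply]
  have := hX i j
  split_ifs at this ⊢ with h
  · rw [h, hs, mul_one]
  · rw [this, mul_zero]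

/-- At the critical frame with signs s₀ only the summand s = s₀ is nonzero nearby, and it is 1
there: any other flip leaves a diagonal entry -1. -/
lemma off_offCrit (hkn : k ≤ n) : Off hkn (offCrit (n := n) hkn) := by
  classical
  refine ⟨contDiff_const.sub (ContDiff.sum fun s _ => (contDiff_chi hkn).comp (contDiff_flip s)),
    fun X hX => ?_⟩
  obtain ⟨s₀, rfl⟩ := hX.exists_sign
  have hone : ∀ᶠ X in 𝓝 (flip s₀ (base hkn)), chi hkn (flip s₀ X) = 1 := by
    have h1 : flip s₀ (flip s₀ (base hkn)) = base hkn := by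
      ext ⟨i, j⟩
      rw [flip_apply, flip_apply, ← mul_assoc, sign_mul_self, one_mul]
    have h2 := (contDiff_flip (n := n) s₀).continuous.tendsto (flip s₀ (base hkn))
    rw [h1] at h2
    exact h2.eventually (chi_eventuallyEq_one hkn)
  have hzero : ∀ s : Fin k → ℤˣ, ∀ᶠ X in 𝓝 (flip s₀ (base hkn)), s ≠ s₀ →
      chi hkn (flip s X) = 0 := by
    intro s
    rcases eq_or_ne s s₀ with rfl | hs
    · simp
    · obtain ⟨j, hj⟩ := Function.ne_iff.1 hs
      have h1 : flip s (flip s₀ (base hkn)) (Fin.castLE hkn j, j) = -1 := by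
        rw [flip_apply, flip_apply, base_diag, mul_one, Int.units_ne_iff_eq_neg.1 hj]
        push_cast
        rw [neg_mul, sign_mul_self]
      have h2 := (contDiff_flip (n := n) s).continuous.tendsto (flip s₀ (base hkn))
      filter_upwards [h2.eventually (chi_eventuallyEq_zero_of_diag hkn h1)] with X hX _
      exact hX
  filter_upwards [hone, eventually_all.2 hzero] with X h1 h2
  rw [offCrit, Finset.sum_eq_single s₀ (fun s _ hs => h2 s hs) (by simp), h1]
  simp

/-- The frequency vector at the critical frame with signs `s`. -/
def signedFreq (s : Fin k → ℤˣ) (l : Fin k → ℝ) (j : Fin k) : ℝ :=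
  2 * Real.pi * (((s j : ℤ) : ℝ) * l j)

lemma cexp_diag_eq (hkn : k ≤ n) (s : Fin k → ℤˣ) (l : Fin k → ℝ) (X : MatSpace n k) :
    Complex.exp (-2 * Real.pi * Complex.I *
      ((∑ j, l j * X (Fin.castLE hkn j, j) : ℝ) : ℂ)) =
    Complex.exp (-2 * Real.pi * Complex.I * ((∑ j, ((s j : ℤ) : ℝ) * l j : ℝ) : ℂ)) *
      Complex.exp (Complex.I * phase hkn (fun j => (signedFreq s l j : ℂ)) (flip s X)) := by
  rw [← Complex.exp_add]
  congr 1
  simp only [phase, flip_apply, signedFreq]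
  push_cast
  rw [Finset.mul_sum, Finset.mul_sum, Finset.mul_sum, ← Finset.sum_add_distrib]
  refine Finset.sum_congr rfl fun j _ => ?_
  have h : ((s j : ℤ) : ℂ) * ((s j : ℤ) : ℂ) = 1 := by exact_mod_cast sign_mul_self (s j)
  linear_combination (2 * Real.pi * Complex.I * l j * X (Fin.castLE hkn j, j)) * h

/-- Decomposition of the Fourier transform into the contributions of the critical frames. -/
lemma integral_cexp_eq (hkn : k ≤ n) (l : Fin k → ℝ) :
    ∫ X, Complex.exp (-2 * Real.pi * Complex.I *
      ((∑ j, l j * X (Fin.castLE hkn j, j) : ℝ) : ℂ)) ∂stiefelMeasure n k =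
    ∑ s : Fin k → ℤˣ, Complex.exp (-2 * Real.pi * Complex.I *
        ((∑ j, ((s j : ℤ) : ℝ) * l j : ℝ) : ℂ)) *
          osc hkn (chi hkn) (fun j => (signedFreq s l j : ℂ)) +
      Complex.exp (-2 * Real.pi * Complex.I * ((∑ j, l j : ℝ) : ℂ)) *
        osc hkn (offCrit hkn) (fun j => (signedFreq 1 l j : ℂ)) := by
  set e : MatSpace n k → ℂ := fun X => Complex.exp (-2 * Real.pi * Complex.I *
      ((∑ j, l j * X (Fin.castLE hkn j, j) : ℝ) : ℂ)) with he
  have hec : Continuous e := by simp only [he]; fun_prop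
  have hchi : ∀ s : Fin k → ℤˣ, Continuous fun X => chi hkn (flip (n := n) s X) := fun s =>
    (contDiff_chi hkn).continuous.comp (contDiff_flip s).continuous
  have h1 : ∀ X, e X = ∑ s : Fin k → ℤˣ, chi hkn (flip s X) * e X + offCrit hkn X * e X := by
    intro X
    rw [offCrit, ← Finset.sum_mul]
    ring
  have h2 : ∫ X, e X ∂stiefelMeasure n k = ∑ s : Fin k → ℤˣ,
      ∫ X, chi hkn (flip s X) * e X ∂stiefelMeasure n k +
        ∫ X, offCrit hkn X * e X ∂stiefelMeasure n k := by
    rw [← integral_finsetSum _ fun s _ =>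
      integrable_of_continuous hkn (by fun_prop), ← integral_add]
    · exact integral_congr_ae (Eventually.of_forall h1)
    · exact integrable_of_continuous hkn
        (continuous_finsetSum _ fun s _ => (hchi s).mul hec).continuousOn
    · exact integrable_of_continuous hkn ((off_offCrit hkn).1.continuous.mul hec).continuousOn
  rw [h2]
  congr 1
  -- The column flip preserves the measure and moves the bump to the base frame; the frequency
  -- acquires the signs s.
  · refine Finset.sum_congr rfl fun s _ => ?_
    rw [osc, ← integral_flip s (fun X => chi hkn X * _), ← integral_const_mul]
    congr 1
    ext X
    simp only [he]
    rw [cexp_diag_eq hkn s]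
    ring
  · rw [osc, ← integral_const_mul]
    congr 1
    ext X
    have h3 : flip 1 X = X := by ext ⟨i, j⟩; simp [flip_apply]
    have h4 := cexp_diag_eq hkn 1 l X
    simp only [Pi.one_apply, Units.val_one, Int.cast_one, one_mul, h3] at h4
    simp only [he]
    rw [h4]
    ring

/-! ### The leading term -/

lemma prod_low {M : Type*} [CommMonoid M] (hkn : k ≤ n) (F : Fin n → Fin k → M) :
    ∏ p : Low n k, F p.1.1 p.1.2 = ∏ j, ((∏ q ∈ Finset.Ioi j, F (Fin.castLE hkn q) j) *
      ∏ i ∈ lowerRows n k, F i j) := by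
  have h1 : ∏ p : Low n k, F p.1.1 p.1.2 =
      ∏ p : Fin n × Fin k, if (p.2 : ℕ) < p.1 then F p.1 p.2 else 1 := by
    rw [Finset.prod_ite, Finset.prod_const_one, mul_one]
    exact (Finset.prod_subtype _ (by simp) fun p : Fin n × Fin k => F p.1 p.2).symm
  rw [h1, Fintype.prod_prod_type_right]
  refine Finset.prod_congr rfl fun j _ => ?_
  have h2 : ∀ f : Fin n → M, ∏ i, f i = (∏ a, f (Fin.castLE hkn a)) * ∏ i ∈ lowerRows n k, f i :=
    fun f => sum_rows (M := Additive M) hkn f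
  rw [h2]
  congr 1
  · simp only [Fin.val_castLE, Fin.val_fin_lt]
    rw [Finset.prod_ite, Finset.prod_const_one, mul_one]
    refine Finset.prod_congr ?_ fun _ _ => rfl
    ext; simp
  · refine Finset.prod_congr rfl fun i hi => if_pos ?_
    have : k ≤ (i : ℕ) := by simpa [lowerRows] using hi
    exact j.2.trans_le this

lemma card_lowerRows (hkn : k ≤ n) : (lowerRows n k).card = n - k := by
  have := sum_rows hkn fun _ => 1
  simp at this
  omega

lemma halfPow_neg_I_mul {y : ℝ} {u : ℤˣ} (h : 0 < ((u : ℤ) : ℝ) * y) :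
    halfPow (-Complex.I * y) = (√|y| : ℝ) * Complex.exp (-(Real.pi / 4 * Complex.I * (u : ℤ))) := by
  have hy : y ≠ 0 := fun h0 => by simp [h0] at h
  have h1 : -Complex.I * y = ((|y| : ℝ) : ℂ) * (-Complex.I * ((u : ℤ) : ℂ)) := by
    rcases Int.units_eq_one_or u with rfl | rfl
    · have : 0 < y := by simpa using h
      rw [abs_of_pos this]; push_cast; ring
    · have : y < 0 := by simpa using h
      rw [abs_of_neg this]; push_cast; ring
  rw [h1, halfPow_ofReal_mul (abs_pos.2 hy)]
  · congr 1
    rw [halfPow]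
    congr 1
    rcases Int.units_eq_one_or u with rfl | rfl
    · simp [Complex.log_neg_I]; ring
    · simp [Complex.log_I]; ring
  · refine mul_ne_zero (by simp) ?_
    exact_mod_cast (Units.ne_zero u)

lemma ext0_ofReal (x : Fin k → ℝ) (i : Fin n) :
    ext0 n (fun j => (x j : ℂ)) i = ((ext0 n x i : ℝ) : ℂ) := by
  unfold ext0
  split_ifs <;> simp

/-- The phase `θ_s` of the contribution of the critical frame with signs `s`. -/
def critPhase (n : ℕ) (l : Fin k → ℝ) (s : Fin k → ℤˣ) : ℝ :=
  2 * Real.pi * ∑ j : Fin k, ((s j : ℤ) : ℝ) * (l j - ((n : ℝ) - ((j : ℕ) + 1 : ℝ)) / 8)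

/-- The modulus of the contribution of the critical frame with signs `s`. -/
def critSize (n : ℕ) (l : Fin k → ℝ) (s : Fin k → ℤˣ) : ℝ :=
  |∏ j : Fin k, l j| ^ (-((n : ℝ) - (k : ℝ)) / 2) *
    ∏ i : Fin k, ∏ j ∈ Finset.Ioi i,
      |((s i : ℤ) : ℝ) * l i + ((s j : ℤ) : ℝ) * l j| ^ (-(1 / 2) : ℝ)

lemma abs_rpow_neg_half (a : ℝ) : |a| ^ (-(1 / 2) : ℝ) = (√|a|)⁻¹ := by
  rw [Real.rpow_neg (abs_nonneg _), Real.sqrt_eq_rpow]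

lemma sum_fin_sub (k : ℕ) : (∑ j : Fin k, (k - 1 - (j : ℕ))) * 2 = k * (k - 1) := by
  rw [Fin.sum_univ_eq_sum_range fun j => k - 1 - j, Finset.sum_range_reflect fun j => j,
    Finset.sum_range_id_mul_two]

lemma prod_sqrt_two_pow (k : ℕ) :
    ∏ j : Fin k, √2 ^ (k - 1 - (j : ℕ)) = (2 : ℝ) ^ ((k : ℝ) * ((k : ℝ) - 1) / 4) := by
  rw [Finset.prod_pow_eq_pow_sum, Real.sqrt_eq_rpow, ← Real.rpow_natCast,
    ← Real.rpow_mul (by norm_num)]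
  congr 1
  have h : ((∑ j : Fin k, (k - 1 - (j : ℕ)) : ℕ) : ℝ) * 2 = k * (k - 1) := by
    rcases Nat.eq_zero_or_pos k with rfl | hk
    · simp
    · rw [← Nat.cast_pred hk]
      exact_mod_cast sum_fin_sub k
  linarith

lemma prod_abs_rpow (hkn : k ≤ n) (l : Fin k → ℝ) :
    ∏ j, (|l j| ^ (-(1 / 2) : ℝ)) ^ (n - k) = |∏ j, l j| ^ (-((n : ℝ) - (k : ℝ)) / 2) := by
  rw [Finset.abs_prod, ← Real.finsetProd_rpow _ _ fun j _ => abs_nonneg _]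
  refine Finset.prod_congr rfl fun j _ => ?_
  rw [← Real.rpow_natCast, ← Real.rpow_mul (abs_nonneg _), Nat.cast_sub hkn]
  congr 1
  ring

lemma prod_cexp_pow (hkn : k ≤ n) (s : Fin k → ℤˣ) :
    ∏ j : Fin k, Complex.exp (Real.pi / 4 * Complex.I * (s j : ℤ)) ^ (k - 1 - (j : ℕ)) *
      Complex.exp (Real.pi / 4 * Complex.I * (s j : ℤ)) ^ (n - k) =
    Complex.exp (Complex.I * ((2 * Real.pi * ∑ j : Fin k,
      ((s j : ℤ) : ℝ) * (((n : ℝ) - ((j : ℕ) + 1 : ℝ)) / 8) : ℝ) : ℂ)) := by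
  simp_rw [← pow_add, ← Complex.exp_nat_mul]
  rw [← Complex.exp_sum]
  congr 1
  push_cast
  rw [Finset.mul_sum, Finset.mul_sum]
  refine Finset.sum_congr rfl fun j _ => ?_
  have h : ((k - 1 - (j : ℕ) : ℕ) : ℂ) + ((n - k : ℕ) : ℂ) = n - (j + 1) := by
    have h1 : (k - 1 - (j : ℕ)) + (n - k) + (j + 1) = n := by omega
    have h2 : (((k - 1 - (j : ℕ)) + (n - k) + (j + 1) : ℕ) : ℂ) = n := by rw [h1]
    push_cast at h2
    linear_combination h2
  rw [h]
  ring

/-- For j < i one has l_i < l_j, so the larger summand decides the sign of s_i l_i + s_j l_j: it is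
s_j. This fixes the branch of each square root in the weight. -/
lemma sign_mul_signedFreq_pos {l : Fin k → ℝ} (hl : ∀ j, 0 < l j) (hdec : StrictAnti l)
    (s : Fin k → ℤˣ) (p : Low n k) :
    0 < ((s p.1.2 : ℤ) : ℝ) * (ext0 n (signedFreq s l) p.1.1 + signedFreq s l p.1.2) := by
  have h2 := sign_mul_self (s p.1.2)
  have hpi := Real.pi_pos
  by_cases h : (p.1.1 : ℕ) < k
  · rw [ext0, dif_pos h]
    have h1 : l ⟨p.1.1, h⟩ < l p.1.2 := hdec (Fin.lt_def.2 p.2)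
    have h3 : -1 ≤ ((s p.1.2 : ℤ) : ℝ) * ((s ⟨p.1.1, h⟩ : ℤ) : ℝ) := by
      rcases Int.units_eq_one_or (s p.1.2) with h | h <;>
      rcases Int.units_eq_one_or (s ⟨p.1.1, _⟩) with h' | h' <;> rw [h, h'] <;> norm_num
    have h4 : ((s p.1.2 : ℤ) : ℝ) * (signedFreq s l ⟨p.1.1, h⟩ + signedFreq s l p.1.2) =
        2 * Real.pi * ((((s p.1.2 : ℤ) : ℝ) * ((s ⟨p.1.1, h⟩ : ℤ) : ℝ)) * l ⟨p.1.1, h⟩ +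
          l p.1.2) := by
      simp only [signedFreq]
      linear_combination (2 * Real.pi * l p.1.2) * h2
    rw [h4]
    have h5 := hl ⟨p.1.1, h⟩
    have h6 : 0 < (((s p.1.2 : ℤ) : ℝ) * ((s ⟨p.1.1, h⟩ : ℤ) : ℝ)) * l ⟨p.1.1, h⟩ + l p.1.2 := by
      nlinarith
    positivity
  · rw [ext0, dif_neg h, zero_add]
    have h4 : ((s p.1.2 : ℤ) : ℝ) * signedFreq s l p.1.2 = 2 * Real.pi * l p.1.2 := by
      simp only [signedFreq]
      linear_combination (2 * Real.pi * l p.1.2) * h2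
    rw [h4]
    have := hl p.1.2
    positivity

/-- Each position of `Low` in column j contributes a phase exp(iπs_j/4); there are n - (j + 1) of
them, j counted from 0, which produces the shift in the cosine. In the square block √(4π)/√(2π) = √2
remains, k(k - 1)/2 times, and each position below the block contributes |l_j|^(-1/2). -/
lemma statConst_div_weight (hkn : k ≤ n) {l : Fin k → ℝ} (hl : ∀ j, 0 < l j) (hdec : StrictAnti l)
    (s : Fin k → ℤˣ) :
    (statConst n k : ℂ) / weight n (fun j => (signedFreq s l j : ℂ)) =
      (((2 : ℝ) ^ ((k : ℝ) * ((k : ℝ) - 1) / 4) * critSize n l s : ℝ) : ℂ) *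
      Complex.exp (Complex.I * ((2 * Real.pi * ∑ j : Fin k,
        ((s j : ℤ) : ℝ) * (((n : ℝ) - ((j : ℕ) + 1 : ℝ)) / 8) : ℝ) : ℂ)) := by
  have h3 : 0 < 2 * Real.pi := by positivity
  let F : Fin n → Fin k → ℂ := fun i j => (((if h : (i : ℕ) < k then
    √2 * |((s ⟨i, h⟩ : ℤ) : ℝ) * l ⟨i, h⟩ + ((s j : ℤ) : ℝ) * l j| ^ (-(1 / 2) : ℝ)
    else |l j| ^ (-(1 / 2) : ℝ)) : ℝ) : ℂ) * Complex.exp (Real.pi / 4 * Complex.I * (s j : ℤ))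
  have hF : (statConst n k : ℂ) / weight n (fun j => (signedFreq s l j : ℂ)) =
      ∏ p : Low n k, F p.1.1 p.1.2 := by
    rw [statConst, weight, Complex.ofReal_prod, ← Finset.prod_div_distrib]
    refine Finset.prod_congr rfl fun p _ => ?_
    rw [ext0_ofReal, ← Complex.ofReal_add,
      halfPow_neg_I_mul (sign_mul_signedFreq_pos hl hdec s p), Complex.exp_neg, ← div_div,
      div_inv_eq_mul, ← Complex.ofReal_div]
    simp only [F]
    congr 2
    by_cases h : (p.1.1 : ℕ) < k
    · rw [if_pos h, dif_pos h, ext0, dif_pos h, abs_rpow_neg_half]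
      have h1 : signedFreq s l ⟨p.1.1, h⟩ + signedFreq s l p.1.2 = 2 * Real.pi *
          (((s ⟨p.1.1, h⟩ : ℤ) : ℝ) * l ⟨p.1.1, h⟩ + ((s p.1.2 : ℤ) : ℝ) * l p.1.2) := by
        simp only [signedFreq]; ring
      rw [h1, abs_mul, abs_of_pos h3, Real.sqrt_mul h3.le,
        show 4 * Real.pi = 2 * (2 * Real.pi) by ring, Real.sqrt_mul two_pos.le]
      have h2 : √(2 * Real.pi) ≠ 0 := (Real.sqrt_pos.2 h3).ne'
      rw [mul_comm (√(2 * Real.pi)), mul_div_mul_right _ _ h2, div_eq_mul_inv]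
    · rw [if_neg h, dif_neg h, ext0, dif_neg h, abs_rpow_neg_half, zero_add]
      have h1 : |signedFreq s l p.1.2| = 2 * Real.pi * |l p.1.2| := by
        rw [signedFreq, abs_mul, abs_of_pos h3, abs_mul]
        rcases Int.units_eq_one_or (s p.1.2) with h | h <;> simp [h]
      rw [h1, Real.sqrt_mul h3.le]
      have h2 : √(2 * Real.pi) ≠ 0 := (Real.sqrt_pos.2 h3).ne'
      rw [div_mul_eq_div_div, div_self h2, one_div]
  rw [hF, prod_low hkn]
  have h1 : ∀ j, ∏ q ∈ Finset.Ioi j, F (Fin.castLE hkn q) j =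
      ((√2 ^ (k - 1 - (j : ℕ)) * ∏ q ∈ Finset.Ioi j,
        |((s j : ℤ) : ℝ) * l j + ((s q : ℤ) : ℝ) * l q| ^ (-(1 / 2) : ℝ) : ℝ) : ℂ) *
      Complex.exp (Real.pi / 4 * Complex.I * (s j : ℤ)) ^ (k - 1 - (j : ℕ)) := by
    intro j
    rw [← Fin.card_Ioi, ← Finset.prod_const, ← Finset.prod_const, ← Finset.prod_mul_distrib,
      Complex.ofReal_prod, ← Finset.prod_mul_distrib]
    refine Finset.prod_congr rfl fun q _ => ?_
    simp only [F, Fin.val_castLE, Fin.is_lt, dif_pos, Fin.eta]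
    rw [add_comm (((s q : ℤ) : ℝ) * l q)]
  have h2 : ∀ j, ∏ i ∈ lowerRows n k, F i j =
      (((|l j| ^ (-(1 / 2) : ℝ)) ^ (n - k) : ℝ) : ℂ) *
      Complex.exp (Real.pi / 4 * Complex.I * (s j : ℤ)) ^ (n - k) := by
    intro j
    rw [← card_lowerRows hkn, Complex.ofReal_pow, ← mul_pow, ← Finset.prod_const]
    refine Finset.prod_congr rfl fun i hi => ?_
    have : k ≤ (i : ℕ) := by simpa [lowerRows] using hi
    simp only [F, dif_neg this.not_gt]
  simp_rw [h1, h2]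
  rw [← prod_cexp_pow hkn, critSize, ← prod_sqrt_two_pow, ← prod_abs_rpow hkn,
    ← Finset.prod_mul_distrib, ← Finset.prod_mul_distrib, Complex.ofReal_prod,
    ← Finset.prod_mul_distrib]
  refine Finset.prod_congr rfl fun j _ => ?_
  push_cast
  ring

lemma leadingTerm_eq (n : ℕ) (l : Fin k → ℝ) : leadingTerm n k l =
    (2 : ℝ) ^ ((k : ℝ) * ((k : ℝ) - 1) / 4) *
      ∑ s : Fin k → ℤˣ, Real.cos (critPhase n l s) * critSize n l s := by
  simp only [leadingTerm, critPhase, critSize, mul_assoc]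

lemma critPhase_neg (n : ℕ) (l : Fin k → ℝ) (s : Fin k → ℤˣ) :
    critPhase n l (-s) = -critPhase n l s := by
  simp [critPhase]

lemma critSize_neg (n : ℕ) (l : Fin k → ℝ) (s : Fin k → ℤˣ) :
    critSize n l (-s) = critSize n l s := by
  simp only [critSize]
  congr 1
  refine Finset.prod_congr rfl fun i _ => Finset.prod_congr rfl fun j _ => ?_
  rw [← abs_neg]
  congr 2
  simp
  ring

/-- Average over s and -s: the phase is odd and the size even in s, so the sines cancel. -/
lemma sum_cexp_critPhase (n : ℕ) (l : Fin k → ℝ) :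
    ∑ s : Fin k → ℤˣ, Complex.exp (-(Complex.I * (critPhase n l s : ℂ))) * (critSize n l s : ℂ) =
      ((∑ s : Fin k → ℤˣ, Real.cos (critPhase n l s) * critSize n l s : ℝ) : ℂ) := by
  have h1 := Equiv.sum_comp (Equiv.neg (Fin k → ℤˣ)) fun s =>
    Complex.exp (-(Complex.I * (critPhase n l s : ℂ))) * (critSize n l s : ℂ)
  simp only [Equiv.neg_apply, critPhase_neg, critSize_neg] at h1
  have h2 : (2 : ℂ) * ∑ s : Fin k → ℤˣ,
      Complex.exp (-(Complex.I * (critPhase n l s : ℂ))) * (critSize n l s : ℂ) =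
      2 * ((∑ s : Fin k → ℤˣ, Real.cos (critPhase n l s) * critSize n l s : ℝ) : ℂ) := by
    nth_rewrite 1 [two_mul]
    nth_rewrite 1 [← h1]
    rw [← Finset.sum_add_distrib, Complex.ofReal_sum, Finset.mul_sum]
    refine Finset.sum_congr rfl fun s _ => ?_
    rw [Complex.ofReal_mul, Complex.ofReal_cos, ← mul_assoc, Complex.two_cos]
    push_cast
    ring_nf
  exact mul_left_cancel₀ two_ne_zero h2

/-- The critical frames contribute the leading term. -/
lemma sum_statConst_div_weight (hkn : k ≤ n) {l : Fin k → ℝ} (hl : ∀ j, 0 < l j)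
    (hdec : StrictAnti l) :
    ∑ s : Fin k → ℤˣ, Complex.exp (-2 * Real.pi * Complex.I *
        ((∑ j, ((s j : ℤ) : ℝ) * l j : ℝ) : ℂ)) *
          ((statConst n k : ℂ) / weight n (fun j => (signedFreq s l j : ℂ))) =
      (leadingTerm n k l : ℂ) := by
  rw [leadingTerm_eq, Complex.ofReal_mul, ← sum_cexp_critPhase, Finset.mul_sum]
  refine Finset.sum_congr rfl fun s _ => ?_
  rw [statConst_div_weight hkn hl hdec, mul_left_comm, ← Complex.exp_add, Complex.ofReal_mul,
    mul_assoc]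
  congr 1
  rw [mul_comm]
  congr 2
  rw [critPhase]
  simp only [mul_sub, Finset.sum_sub_distrib]
  push_cast
  ring

/-! ### The asymptotic expansion -/

/-- The difference of the two sides is (k - 1)(n - k/2); this is where k ≥ 1 matters. -/
lemma sub_le_stiefelDim (hk : 1 ≤ k) (hkn : k ≤ n) : n - k ≤ stiefelDim n k := by
  obtain ⟨t, rfl⟩ := Nat.exists_eq_add_of_le' hk
  have h1 : (t + 1) * (t + 1 + 1) / 2 * 2 = (t + 1) * (t + 1 + 1) :=
    Nat.div_mul_cancel (Nat.even_mul_succ_self _).two_dvd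
  have h2 : t * (t + 1) ≤ t * n := Nat.mul_le_mul_left _ hkn
  have h3 : n + (t + 1) * (t + 1 + 1) / 2 ≤ n * (t + 1) + (t + 1) := by nlinarith
  unfold stiefelDim
  omega

lemma strictAnti_singularValue {Ξ : MatSpace n k}
    (h : ∀ i j : Fin k, i ≠ j → 0 < |singularValue Ξ i - singularValue Ξ j|) :
    StrictAnti (singularValue Ξ) := by
  intro i j hij
  refine lt_of_le_of_ne (LinearMap.singularValues_antitone _ (Fin.le_def.1 hij.le)) fun h0 => ?_
  have := h i j hij.ne
  simp only [singularValue] at this h0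
  rw [h0, sub_self, abs_zero] at this
  exact this.false

/-- Signs can only exchange |l_i - l_j| with l_i + l_j, and both are at least δr. The factor 2π
helps the lower bounds and is paid for by 1/(2π) in the upper one. -/
lemma adm_signedFreq {δ r : ℝ} {l : Fin k → ℝ} (hr : 1 ≤ r)
    (hl : ∀ j, δ * r ≤ l j) (hl' : ∀ j, l j ≤ r) (hpos : ∀ j, 0 < l j)
    (hsub : ∀ i j, i ≠ j → δ * r ≤ |l i - l j|) (s : Fin k → ℤˣ) :
    Adm (min δ (1 / (2 * Real.pi))) (fun j => (signedFreq s l j : ℂ)) r := by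
  have hpi : 1 ≤ 2 * Real.pi := by linarith [Real.pi_gt_three]
  have hpi0 : 0 < 2 * Real.pi := one_pos.trans_le hpi
  have hδ : min δ (1 / (2 * Real.pi)) * r ≤ δ * r :=
    mul_le_mul_of_nonneg_right (min_le_left _ _) (by linarith)
  have habs : ∀ j, ‖(signedFreq s l j : ℂ)‖ = 2 * Real.pi * l j := by
    intro j
    rw [Complex.norm_real, Real.norm_eq_abs, signedFreq, abs_mul, abs_of_pos hpi0]
    congr 1
    rcases Int.units_eq_one_or (s j) with h | h <;> simp [h, abs_of_pos (hpos j)]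
  have hcomb : ∀ i j, i ≠ j → ∀ u v : ℤˣ,
      δ * r ≤ |2 * Real.pi * (((u : ℤ) : ℝ) * l i) + 2 * Real.pi * (((v : ℤ) : ℝ) * l j)| := by
    intro i j hij u v
    have h1 : δ * r ≤ |((u : ℤ) : ℝ) * l i + ((v : ℤ) : ℝ) * l j| := by
      have h2 := hsub i j hij
      have h3 : δ * r ≤ |l i + l j| := by
        rw [abs_of_pos (add_pos (hpos i) (hpos j))]
        linarith [hl i, hpos j]
      rcases Int.units_eq_one_or u with rfl | rfl <;> rcases Int.units_eq_one_or v with rfl | rfl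
      · simpa using h3
      · simpa [sub_eq_add_neg] using h2
      · rw [← abs_neg]; simpa [sub_eq_add_neg, add_comm] using h2
      · rw [← abs_neg]; simpa [add_comm] using h3
    rw [← mul_add, abs_mul, abs_of_pos hpi0]
    exact h1.trans (le_mul_of_one_le_left (abs_nonneg _) hpi)
  refine ⟨hr, fun j => by simp, fun j => ?_, fun j => ?_, fun i j hij => ?_, fun i j hij => ?_⟩
  · rw [habs]
    exact hδ.trans ((hl j).trans (le_mul_of_one_le_left (hpos j).le hpi))
  · rw [habs]
    refine (mul_le_mul_of_nonneg_right (min_le_right _ _) (by have := hpos j; positivity)).trans ?_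
    rw [← mul_assoc, one_div, inv_mul_cancel₀ hpi0.ne', one_mul]
    exact hl' j
  · rw [← Complex.ofReal_sub, Complex.norm_real, Real.norm_eq_abs]
    refine hδ.trans ((hcomb i j hij (s i) (-s j)).trans (le_of_eq ?_))
    simp only [signedFreq]
    congr 1
    push_cast
    ring
  · rw [← Complex.ofReal_add, Complex.norm_real, Real.norm_eq_abs]
    exact hδ.trans (hcomb i j hij (s i) (s j))

lemma norm_cexp_neg_two_pi (t : ℝ) : ‖Complex.exp (-2 * Real.pi * Complex.I * (t : ℂ))‖ = 1 := by
  rw [Complex.norm_exp]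
  simp

lemma osc_chi_sub_le {hkn : k ≤ n} {c C r : ℝ} (hc : 0 < c) {x : Fin k → ℝ}
    (hx : Adm c (fun j => (x j : ℂ)) r)
    (h : ‖weight n (fun j => (x j : ℂ)) * osc hkn (chi hkn) (fun j => (x j : ℂ)) - statConst n k‖ ≤
        C / r) :
    ‖osc hkn (chi hkn) (fun j => (x j : ℂ)) - statConst n k / weight n (fun j => (x j : ℂ))‖ ≤
      C / √c ^ stiefelDim n k * r ^ (-(stiefelDim n k : ℝ) / 2 - 1) := by
  have hr := hx.pos
  have h1 := hx.le_norm_weight hc hkn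
  have h0 : 0 < √(c * r) ^ stiefelDim n k := pow_pos (Real.sqrt_pos.2 (by positivity)) _
  have hw : weight n (fun j => (x j : ℂ)) ≠ 0 := norm_pos_iff.1 (h0.trans_le h1)
  have h2 : osc hkn (chi hkn) (fun j => (x j : ℂ)) - statConst n k / weight n (fun j => (x j : ℂ)) =
      (weight n (fun j => (x j : ℂ)) * osc hkn (chi hkn) (fun j => (x j : ℂ)) - statConst n k) /
        weight n (fun j => (x j : ℂ)) := by
    field_simp
  rw [h2, norm_div]
  refine (div_le_div₀ ((norm_nonneg _).trans h) h h0 h1).trans (le_of_eq ?_)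
  have h3 : r ^ (-(stiefelDim n k : ℝ) / 2 - 1) = (√r ^ stiefelDim n k)⁻¹ * r⁻¹ := by
    rw [Real.sqrt_eq_rpow, ← Real.rpow_natCast, ← Real.rpow_mul hr.le, ← Real.rpow_neg hr.le,
      ← Real.rpow_neg_one r, ← Real.rpow_add hr]
    congr 1
    ring
  rw [h3, Real.sqrt_mul hc.le, mul_pow]
  ring

/-- The asymptotic expansion of the Fourier transform of the surface measure. -/
theorem stiefelFourier_sub_leadingTerm_le (hkn : k ≤ n) {δ : ℝ} (hδ : 0 < δ) :
    ∃ C : ℝ, 0 ≤ C ∧ ∀ Ξ : MatSpace n k, 1 ≤ ‖Ξ‖ → (∀ j : Fin k, δ * ‖Ξ‖ ≤ singularValue Ξ j) →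
      (∀ i j : Fin k, i ≠ j → δ * ‖Ξ‖ ≤ |singularValue Ξ i - singularValue Ξ j|) →
      ‖stiefelFourier Ξ - (leadingTerm n k (singularValue Ξ) : ℂ)‖ ≤
        C * ‖Ξ‖ ^ (-(stiefelDim n k : ℝ) / 2 - 1) := by
  set c := min δ (1 / (2 * Real.pi)) with hcdef
  have hc : 0 < c := lt_min hδ (by positivity)
  set m := stiefelDim n k with hm
  obtain ⟨C₁, hC₁, h₁⟩ := weight_mul_osc_bound hkn hc
  -- Order m + 1 is enough for the part away from the critical frames, as m + 1 ≥ m/2 + 1.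
  obtain ⟨C₂, h₂⟩ := (Off.osc_bound hc (m + 1)) _ (off_offCrit hkn)
  refine ⟨Fintype.card (Fin k → ℤˣ) * (C₁ / √c ^ m) + |C₂|, by positivity, fun Ξ hr hl hsub => ?_⟩
  have hr0 : 0 < ‖Ξ‖ := one_pos.trans_le hr
  have hpos : ∀ j, 0 < singularValue Ξ j := fun j => (mul_pos hδ hr0).trans_le (hl j)
  have hdec := strictAnti_singularValue fun i j hij => (mul_pos hδ hr0).trans_le (hsub i j hij)
  have hadm := adm_signedFreq hr hl (singularValue_le_norm hkn Ξ hpos) hpos hsub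
  set l := singularValue Ξ
  rw [stiefelFourier_eq hkn Ξ hpos, integral_cexp_eq hkn, ← sum_statConst_div_weight hkn hpos hdec,
    add_sub_right_comm, ← Finset.sum_sub_distrib, add_mul]
  refine (norm_add_le _ _).trans (add_le_add ?_ ?_)
  · refine (norm_sum_le_of_le (n := fun _ => C₁ / √c ^ m * ‖Ξ‖ ^ (-(m : ℝ) / 2 - 1)) _
      fun s _ => ?_).trans (le_of_eq ?_)
    · rw [← mul_sub, norm_mul, norm_cexp_neg_two_pi, one_mul]
      exact osc_chi_sub_le hc (hadm s) (h₁ _ _ (hadm s))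
    · rw [Finset.sum_const, Finset.card_univ, nsmul_eq_mul, mul_assoc]
  · rw [norm_mul, norm_cexp_neg_two_pi, one_mul]
    refine (h₂ _ _ (hadm 1)).trans ?_
    refine mul_le_mul (le_abs_self _) ?_ (by positivity) (abs_nonneg _)
    rw [← Real.rpow_intCast]
    refine Real.rpow_le_rpow_of_exponent_le hr ?_
    push_cast
    linarith [(Nat.cast_nonneg m : (0 : ℝ) ≤ m)]

end StiefelFourier

end

theorem mainTheorem1 (n k : ℕ) (hk : 1 ≤ k) (hkn : k ≤ n) (δ : ℝ) (hδ : 0 < δ) :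
    ∃ C : ℝ, ∀ Ξ : StiefelFourier.MatSpace n k,
      1 ≤ ‖Ξ‖ →
      (∀ j : Fin k, δ * ‖Ξ‖ ≤ StiefelFourier.singularValue Ξ j) →
      (∀ i j : Fin k, i ≠ j →
        δ * ‖Ξ‖ ≤ |StiefelFourier.singularValue Ξ i - StiefelFourier.singularValue Ξ j|) →
      ‖StiefelFourier.stiefelFourier Ξ -
          (StiefelFourier.leadingTerm n k (StiefelFourier.singularValue Ξ) : ℂ)‖
        ≤ C * ‖Ξ‖ ^ (-(StiefelFourier.stiefelDim n k : ℝ) / 2 - 1) ∧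
      ‖StiefelFourier.stiefelFourier Ξ -
          (StiefelFourier.leadingTerm n k (StiefelFourier.singularValue Ξ) : ℂ)‖
        ≤ C * ‖Ξ‖ ^ (-((n : ℝ) - (k : ℝ) + 2) / 2) := by
  obtain ⟨C, hC0, hC⟩ := StiefelFourier.stiefelFourier_sub_leadingTerm_le hkn hδ
  refine ⟨C, fun Ξ hr hl hsub => ⟨hC Ξ hr hl hsub, (hC Ξ hr hl hsub).trans
    (mul_le_mul_of_nonneg_left (Real.rpow_le_rpow_of_exponent_le hr ?_) hC0)⟩⟩
  -- For ‖Ξ‖ ≥ 1 the weaker bound follows by comparing exponents, since m ≥ n - k.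
  have h : ((n - k : ℕ) : ℝ) ≤ StiefelFourier.stiefelDim n k := by
    exact_mod_cast StiefelFourier.sub_le_stiefelDim hk hkn
  rw [Nat.cast_sub hkn] at h
  linarith
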